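/- Let $d\ge1$ and let $B(x)\subset\mathbb R^d$ be the open unit ball centred at $x$, $B:=B(0)$. A point set is a subset $\mathcal P\subset\mathbb R^d$ having finitely many points in each bounded set; a point process is a probability measure on the space of point sets (with the $\sigma$-algebra generated by the counts $\mathcal P\mapsto\sharp(\mathcal P\cap E)$, $E$ Borel), stationary and ergodic with respect to the translations $\mathcal P\mapsto\mathcal P+z$, $z\in\mathbb R^d$. Set $\mathcal B(\mathcal P):=\bigcup_{x\in\mathcal P}B(x)$ and let $\varphi:=\mathbb P[0\in\mathcal B(\mathcal P)]$ be the volume fraction. Let $\ell\in[0,\infty]$ be the almost sure value of $\inf\{|x-y|_\infty: x,y\in\mathcal P,\ x\ne y\}$. The second-order intensity is, if $\ell>0$, $$\lambda_2:=\sup_{z_1,z_2\in\mathbb R^d}\ell^{-2d}\,\mathbb E\Big[\sum_{x_1,x_2\in\mathcal P,\,x_1\ne x_2}\mathbf 1_{Q_\ell(z_1)}(x_1)\,\mathbf 1_{Q_\ell(z_2)}(x_2)\Big]$$ (with $\lambda_2:=0$ if $\ell=\infty$), where $Q_\ell(z)$ is the cube of sidelength $\ell$ centred at $z$, and, if $\ell=0$,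 $\lambda_2:=\|f_2\|_{L^\infty}$, where $f_2$ is the two-point density, $\mathbb E\big[\sum_{x_1\ne x_2}\zeta(x_1,x_2)\big]=\int\zeta f_2$ ($\lambda_2:=\infty$ if there is none). Let $0<\alpha,\beta$. Let $A_1\in\mathbb R^{d\times d}$ be a (not necessarily symmetric) matrix with $v\cdot A_1v\ge\alpha|v|^2$ and $|A_1v|\le\beta|v|$ for all $v\in\mathbb R^d$, and let $A_2$ be a stationary and ergodic random field of (not necessarily symmetric) matrices that satisfy almost surely the same two bounds. Let a stationary and ergodic point process be given that is independent of $A_2$, and consider the coefficient field $$A(y):=A_1+\mathbf 1_{\mathcal B(\mathcal P)}(y)\,(A_2(y)-A_1),\qquad y\in\mathbb R^d .$$ The effective matrix $\bar A$ is given by $\bar Ae=\mathbb E[A(\nabla\phi_e+e)]$ for $e\in\mathbb R^d$, where $\phi_e$ is the corrector: almost surely $\phi_e\in H^1_{\rm loc}(\mathbb R^d)$, $-\nabla\cdot A(\nabla\phi_e+e)=0$ weakly in $\mathbb R^d$, and $\int_B\phi_e=0$; the gradient $\nabla\phi_e$ is a stationary random field with $\mathbb E[|\nabla\phi_e|^2]<\infty$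 and with vanishing expectation conditionally on the translation-invariant events of $(\mathcal P,A_2)$ (if $(\mathcal P,A_2)$ is jointly ergodic, this just means $\mathbb E[\nabla\phi_e]=0$). The first-order correction $\widehat A_2$ is given by $$\widehat A_2e:=\mathbb E\Big[\frac1{|B|}\int_B(A_2-A_1)(\nabla\psi_e+e)\Big],$$ where $\psi_e$ is almost surely the weak solution in $\dot H^1(\mathbb R^d)$ (functions in $H^1_{\rm loc}(\mathbb R^d)$ with $\nabla\psi_e\in L^2(\mathbb R^d)$, modulo constants) of $-\nabla\cdot\big(A_1+\mathbf 1_B(A_2-A_1)\big)(\nabla\psi_e+e)=0$ in $\mathbb R^d$. Then for every $\delta>0$ there is a constant $C$, depending only on $d,\alpha,\beta,\delta$, such that, whenever $\lambda_2<\infty$ and $|\lambda_2-1|\ge\delta$, $$\big|\bar A-(A_1+\varphi\widehat A_2)\big|\le C\,\lambda_2|\log\lambda_2| ,$$ with the convention $0\,|\log 0|=0$. -/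

import Mathlib

open MeasureTheory Filter Set
open scoped ENNReal Pointwise

noncomputable section

namespace DiluteHomogenization

/-- Euclidean space `ℝ^d`. -/
abbrev Space (d : ℕ) : Type := EuclideanSpace ℝ (Fin d)

/-- Real `d × d` matrices. -/
abbrev Mat (d : ℕ) : Type := Matrix (Fin d) (Fin d) ℝ

/-- The continuous linear map `v ↦ M v` on Euclidean space. -/
abbrev Mat.op {d : ℕ} (M : Mat d) : Space d →L[ℝ] Space d :=
  Matrix.toEuclideanCLM (n := Fin d) (𝕜 := ℝ) M

/-! ### Point sets and point processes -/

/-- A point set: a subset of `ℝ^d` with finitely many points in each bounded set (hence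
countable). -/
@[ext]
structure PointSet (d : ℕ) where
  carrier : Set (Space d)
  finite_inter : ∀ S : Set (Space d), Bornology.IsBounded S → (carrier ∩ S).Finite

namespace PointSet

variable {d : ℕ}

/-- The locally finite measure `∑_{x ∈ 𝒫} δ_x`. -/
def toMeasure (P : PointSet d) : Measure (Space d) :=
  Measure.sum fun x : P.carrier => Measure.dirac (x : Space d)

/-- The smallest σ-algebra for which the counts `𝒫 ↦ ♯(𝒫 ∩ E)`, `E` Borel, are measurable;
equivalently, for which the evaluations `𝒫 ↦ ∑_{x ∈ 𝒫} f x`, `f` continuous with compact support,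
are measurable. -/
instance : MeasurableSpace (PointSet d) :=
  MeasurableSpace.comap toMeasure inferInstance

/-- The translate `𝒫 + z`. -/
def translate (z : Space d) (P : PointSet d) : PointSet d where
  carrier := {x | x - z ∈ P.carrier}
  finite_inter S hS := by
    have hb : Bornology.IsBounded ((fun x : Space d => x - z) '' S) := by
      have := hS.sub (Bornology.isBounded_singleton (x := z))
      rwa [Set.sub_singleton] at this
    refine Set.Finite.of_finite_image (f := fun x : Space d => x - z)
      ((P.finite_inter _ hb).subset ?_) (fun a _ b _ h => by simpa using h)
    rintro _ ⟨x, ⟨hx, hxS⟩, rfl⟩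
    exact ⟨hx, x, hxS, rfl⟩

/-- The group `ℝ^d` acts on point sets by translation. -/
instance : AddAction (Space d) (PointSet d) where
  vadd := translate
  zero_vadd P := by
    ext x
    change x - 0 ∈ P.carrier ↔ x ∈ P.carrier
    rw [sub_zero]
  add_vadd y z P := by
    ext x
    change x - (y + z) ∈ P.carrier ↔ x - y - z ∈ P.carrier
    rw [sub_sub]

/-- The union `⋃_{x ∈ 𝒫} B(x)` of the open unit balls centred at the points of `𝒫`. -/
def inclusions (P : PointSet d) : Set (Space d) :=
  ⋃ x ∈ P.carrier, Metric.ball x 1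

/-- `inf {|x - y|_∞ : x, y ∈ 𝒫, x ≠ y}`, equal to `∞` if `𝒫` has at most one point. -/
def separation (P : PointSet d) : ℝ≥0∞ :=
  ⨅ x ∈ P.carrier, ⨅ y ∈ P.carrier, ⨅ _ : x ≠ y, edist (WithLp.ofLp x) (WithLp.ofLp y)

/-- `∑_{x₁, x₂ ∈ 𝒫, x₁ ≠ x₂} ζ(x₁, x₂)`. -/
def pairSum (P : PointSet d) (ζ : Space d × Space d → ℝ≥0∞) : ℝ≥0∞ :=
  ∑' p : {p : P.carrier × P.carrier // p.1 ≠ p.2}, ζ ((p.1.1 : Space d), (p.1.2 : Space d))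

end PointSet

section PointProcess

variable {d : ℕ}

/-- The volume fraction `φ = 𝔼[1_{ℬ(𝒫)}]` of the inclusions (evaluated at the origin). -/
def volumeFraction (ℙ : Measure (PointSet d)) : ℝ :=
  ℙ.real {P | (0 : Space d) ∈ P.inclusions}

/-- The minimal lengthscale `ℓ` of a point process. The variable `separation` is almost surely
constant for a stationary ergodic process, and `ℓ` is that constant. -/
def minimalLength (ℙ : Measure (PointSet d)) : ℝ≥0∞ :=
  essInf PointSet.separation ℙ

/-- The cube of sidelength `r` centred at `z`. -/
def cube (r : ℝ) (z : Space d) : Set (Space d) :=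
  {x | ∀ i, z i - r / 2 ≤ x i ∧ x i < z i + r / 2}

/-- `f` is a `2`-point density of the point process. -/
def IsTwoPointDensity (ℙ : Measure (PointSet d)) (f : Space d × Space d → ℝ≥0∞) : Prop :=
  Measurable f ∧ ∀ ζ : Space d × Space d → ℝ≥0∞, Measurable ζ →
    ∫⁻ P, P.pairSum ζ ∂ℙ = ∫⁻ x, ζ x * f x

/-- The second-order intensity `λ₂ ∈ [0, ∞]`. If `ℓ > 0`, it is the largest expected number of
pairs of distinct points in `Q_ℓ(z₁) × Q_ℓ(z₂)`, normalized by `ℓ^{-2d}`. If `ℓ = 0`, it is the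
`L^∞` norm of the `2`-point density (which is unique almost everywhere), with value `∞` if there is
no such density. -/
def secondIntensity (ℙ : Measure (PointSet d)) : ℝ≥0∞ :=
  open scoped Classical in
  if minimalLength ℙ = 0 then
    ⨅ (f : Space d × Space d → ℝ≥0∞) (_ : IsTwoPointDensity ℙ f), essSup f volume
  else
    ⨆ (z₁ : Space d) (z₂ : Space d),
      (minimalLength ℙ)⁻¹ ^ d * (minimalLength ℙ)⁻¹ ^ d *
        ∫⁻ P, P.pairSum
          ((cube (minimalLength ℙ).toReal z₁ ×ˢ cube (minimalLength ℙ).toReal z₂).indicator 1) ∂ℙ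

end PointProcess

/-! ### Sobolev functions and weak solutions -/

section Sobolev

variable {d : ℕ}

/-- Square integrability on bounded sets. -/
def IsL2loc {F : Type*} [NormedAddCommGroup F] (u : Space d → F) : Prop :=
  ∀ R : ℝ, MemLp u 2 (volume.restrict (Metric.ball 0 R))

/-- `u` belongs to `H¹_loc(ℝ^d)` and its weak gradient is `G`. -/
structure HasWeakGradient (u : Space d → ℝ) (G : Space d → Space d) : Prop where
  l2loc : IsL2loc u
  l2loc_grad : IsL2loc G
  integral_eq : ∀ η : Space d → ℝ, ContDiff ℝ (⊤ : ℕ∞) η → HasCompactSupport η →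
    ∫ y, u y • gradient η y = - ∫ y, η y • G y

/-- `∇ · a F = 0` in `ℝ^d` in the weak sense. -/
def IsDivFree (a : Space d → Mat d) (F : Space d → Space d) : Prop :=
  ∀ η : Space d → ℝ, ContDiff ℝ (⊤ : ℕ∞) η → HasCompactSupport η →
    ∫ y, inner ℝ (gradient η y) ((a y).op (F y)) = 0

/-- Ellipticity of a (possibly non-symmetric) matrix: `v · M v ≥ α |v|²` and `|M v| ≤ β |v|`. -/
def IsElliptic (α β : ℝ) (M : Mat d) : Prop :=
  ∀ v : Space d, α * ‖v‖ ^ 2 ≤ inner ℝ v (M.op v) ∧ ‖M.op v‖ ≤ β * ‖v‖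

/-- The two-phase coefficient field `y ↦ A₁ + 1_S(y) (A₂(y) - A₁)`. -/
def twoPhase (A₁ : Mat d) (S : Set (Space d)) (A₂ : Space d → Mat d) (y : Space d) : Mat d :=
  A₁ + S.indicator (fun x => A₂ x - A₁) y

end Sobolev

/-! ### Correctors, effective matrix, single-inclusion problem

Stationary random fields are functions `f((-y) + ω)` of position `y` and environment `ω`, where
`ℝ^d` acts on environments by measure-preserving translations. The environment is a pair `(𝒫, ω)`
of independent components, so that the law is a product measure. -/

section Homogenization

variable {d : ℕ} {Ω : Type*} [AddAction (Space d) Ω]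

/-- The stationary field `y ↦ f((-y) + ω)` generated by `f`. -/
def field {X F : Type*} [AddAction (Space d) X] (f : X → F) (ω : X) (y : Space d) : F :=
  f ((-y) +ᵥ ω)

/-- `A(y) = A₁ + 1_{ℬ(𝒫)}(y) (A₂(y) - A₁)`, where `A₂` is the stationary field generated by `a₂`. -/
def coefficient (A₁ : Mat d) (a₂ : Ω → Mat d) (ω : PointSet d × Ω) : Space d → Mat d :=
  twoPhase A₁ ω.1.inclusions (field a₂ ω.2)

variable [MeasurableSpace Ω]

/-- `ϕ` is the corrector in direction `e`, and its gradient is the stationary field generated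
by `g`. The condition `mean_zero` is `𝔼[∇ϕ | translation-invariant events] = 0`; if the joint law
of `(𝒫, A₂)` is ergodic, then invariant events have probability `0` or `1` and the condition is just
`𝔼[∇ϕ] = 0`. -/
structure IsCorrector (ℙ₁ : Measure (PointSet d)) (ℙ₂ : Measure Ω) (A₁ : Mat d) (a₂ : Ω → Mat d)
    (e : Space d) (ϕ : PointSet d × Ω → Space d → ℝ) (g : PointSet d × Ω → Space d) : Prop where
  memLp : MemLp g 2 (ℙ₁.prod ℙ₂)
  mean_zero : ∀ I : Set (PointSet d × Ω), MeasurableSet I →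
    (∀ z : Space d, (fun ω => z +ᵥ ω) ⁻¹' I =ᵐ[ℙ₁.prod ℙ₂] I) → ∫ ω in I, g ω ∂(ℙ₁.prod ℙ₂) = 0
  gradient_eq : ∀ᵐ ω ∂(ℙ₁.prod ℙ₂), HasWeakGradient (ϕ ω) (field g ω)
  anchored : ∀ᵐ ω ∂(ℙ₁.prod ℙ₂), ⨍ y in Metric.ball (0 : Space d) 1, ϕ ω y = 0
  equation : ∀ᵐ ω ∂(ℙ₁.prod ℙ₂), IsDivFree (coefficient A₁ a₂ ω) (fun y => field g ω y + e)

/-- `Abar` is the effective matrix: `Abar e = 𝔼[A (∇ϕ_e + e)]` for all `e`, where `ϕ_e` is the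
corrector in direction `e` (the stationary field in the expectation is evaluated at the origin). -/
def IsEffectiveMatrix (ℙ₁ : Measure (PointSet d)) (ℙ₂ : Measure Ω) (A₁ : Mat d) (a₂ : Ω → Mat d)
    (Abar : Mat d) : Prop :=
  ∀ e : Space d, ∃ (ϕ : PointSet d × Ω → Space d → ℝ) (g : PointSet d × Ω → Space d),
    IsCorrector ℙ₁ ℙ₂ A₁ a₂ e ϕ g ∧
      Abar.op e = ∫ ω, (coefficient A₁ a₂ ω 0).op (g ω + e) ∂(ℙ₁.prod ℙ₂)

/-- `ψ` is a random solution, in the homogeneous Sobolev space of functions with square-integrable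
gradient, of the single-inclusion problem
`-∇ · (A₁ + 1_B (A₂ - A₁)) (∇ψ + e) = 0` in `ℝ^d`, and `G = ∇ψ`. -/
structure IsSingleInclusion (ℙ₂ : Measure Ω) (A₁ : Mat d) (a₂ : Ω → Mat d) (e : Space d)
    (ψ : Ω → Space d → ℝ) (G : Ω → Space d → Space d) : Prop where
  measurable : AEStronglyMeasurable (Function.uncurry G) (ℙ₂.prod volume)
  gradient_eq : ∀ᵐ ω ∂ℙ₂, HasWeakGradient (ψ ω) (G ω)
  memLp : ∀ᵐ ω ∂ℙ₂, MemLp (G ω) 2 volume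
  equation : ∀ᵐ ω ∂ℙ₂,
    IsDivFree (twoPhase A₁ (Metric.ball 0 1) (field a₂ ω)) (fun y => G ω y + e)

/-- `Ahat` is the first-order correction: `Ahat e = 𝔼[⨍_B (A₂ - A₁) (∇ψ_e + e)]` for all `e`, where
`ψ_e` solves the single-inclusion problem in direction `e`. -/
def IsFirstOrderCorrection (ℙ₂ : Measure Ω) (A₁ : Mat d) (a₂ : Ω → Mat d) (Ahat : Mat d) : Prop :=
  ∀ e : Space d, ∃ (ψ : Ω → Space d → ℝ) (G : Ω → Space d → Space d),
    IsSingleInclusion ℙ₂ A₁ a₂ e ψ G ∧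
      Ahat.op e =
        ∫ ω, (⨍ y in Metric.ball (0 : Space d) 1, (field a₂ ω y - A₁).op (G ω y + e)) ∂ℙ₂

end Homogenization

end DiluteHomogenization

end

open DiluteHomogenization

open MeasureTheory Filter Set
open ProbabilityTheory (Kernel IsSFiniteKernel IsFiniteKernel)
open scoped ENNReal Pointwise Topology

noncomputable section

namespace DiluteHomogenization

variable {d : ℕ}

/-! Fix one realization and a large cube Q. Each point x whose neighbours are at distance at least 4
receives a dyadic radius ρ_x, of the order of the distance to its nearest neighbour but at most 2^K;
the balls B(x, ρ_x) are disjoint and contain no other inclusion. Inclusions without such a ball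
inside Q form the bad set Z. The corrector gradient U is compared with Φ = Σ H_x, where H_x is the
Dirichlet solution of the single-inclusion problem in B(x, ρ_x).

The analytic core is `exists_residual_bound`: tested with a curl-free field k, the residual of H_x
has size ρ_x^{-d/2} ‖k‖ in L² of the ball. Up to gradients supported in the ball, k solves the
constant-coefficient transposed equation there, and by the mean value property
(`exists_interior_bound`) such a field carries only a fraction of order ρ^{-d} of its energy in the
unit ball, where the inclusion sits. Cauchy–Schwarz over the disjoint balls then bounds the energy
of W = U - Φ by Σ ρ_x^{-d} + |Z|, plus a term T that appears because U is not a gradient vanishing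
on the boundary of Q.

An estimate of the flux linear in ‖W‖ would only give the square root of the desired rate. In
`exists_error_bound` the flux in direction e' is therefore tested with a second ansatz Σ J_x, built
from the transposed coefficients. Orthogonality and reciprocity remove the linear terms. What
remains is W against dual residuals, contributions of Z, and the difference between H_x and the
whole-space solution. That difference is of order ρ_x^{-d}, again by duality (`exists_comparison`).

Taking expectations removes T: it is the integral over Q of a stationary field whose mean is zero,
since a stationary gradient with vanishing conditional mean is orthogonal to a stationary solenoidal
field (`integral_inner_eq_zero`). Hence neither sublinearity of the corrector nor boundary layers of
solutions have to be controlled. As A₂ is independent of the points, every good inclusion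
contributes on average the volume of the unit ball times e' · Â e. The total volume of good
inclusions is that of all inclusions in Q minus |Z|, which produces the volume fraction
(`exists_cube_bound`).

It remains to count. Up to constants, Σ ρ_x^{-d} is at most 2^{-Kd} |Q| plus, for every k < K,
2^{-kd} times the number of pairs at distance below 2^{k+2}. The expected number of such pairs is of
order λ₂ 2^{kd} |Q| (`lintegral_nearPairs_le`), so all K scales contribute equally. The error per
volume is of order 2^{-K} + K λ₂, and K close to log₂(1/λ₂) gives λ₂ |log λ₂|
(`le_mul_abs_log_of_forall_scale`). The gap δ absorbs a bare λ₂ into the logarithm. -/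

/-! ### Test functions and partial derivatives -/

/-- The partial derivative in the `i`-th coordinate direction. -/
def pd (i : Fin d) (η : Space d → ℝ) (y : Space d) : ℝ :=
  fderiv ℝ η y (EuclideanSpace.single i 1)

/-- Smooth functions whose support is compact and contained in `D`. -/
structure IsTest (D : Set (Space d)) (η : Space d → ℝ) : Prop where
  contDiff : ContDiff ℝ (⊤ : ℕ∞) η
  compact : HasCompactSupport η
  subset : tsupport η ⊆ D

theorem IsTest.mono {D D' : Set (Space d)} {η : Space d → ℝ} (h : IsTest D η) (hD : D ⊆ D') :
    IsTest D' η := ⟨h.1, h.2, h.3.trans hD⟩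

theorem tsupport_pd_subset (i : Fin d) (η : Space d → ℝ) : tsupport (pd i η) ⊆ tsupport η := by
  refine closure_minimal ?_ (isClosed_tsupport η)
  intro y hy
  by_contra h
  apply hy
  have : fderiv ℝ η y = 0 := by
    by_contra h0
    exact h (support_fderiv_subset ℝ h0)
  simp [pd, this]

theorem IsTest.pd {D : Set (Space d)} {η : Space d → ℝ} (h : IsTest D η) (i : Fin d) :
    IsTest D (pd i η) where
  contDiff := by
    have : ContDiff ℝ (⊤ : ℕ∞) (fderiv ℝ η) := h.contDiff.fderiv_right (by simp)
    exact this.clm_apply contDiff_const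
  compact := h.compact.mono' ((subset_tsupport _).trans (tsupport_pd_subset i η))
  subset := (tsupport_pd_subset i η).trans h.subset

theorem gradient_apply {η : Space d → ℝ} (y : Space d) (i : Fin d) :
    gradient η y i = pd i η y := by
  have := inner_gradient_left (𝕜 := ℝ) (f := η) (x := y) (y := EuclideanSpace.single i (1 : ℝ))
  rw [pd, ← this]
  rw [EuclideanSpace.inner_single_right]
  simp

theorem pd_comm {η : Space d → ℝ} (h : ContDiff ℝ (⊤ : ℕ∞) η) (i j : Fin d) (y : Space d) :
    pd i (pd j η) y = pd j (pd i η) y := by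
  have h1 : Differentiable ℝ (fderiv ℝ η) :=
    (h.fderiv_right (m := 1) (by norm_cast)).differentiable one_ne_zero
  have key : ∀ a b : Space d, fderiv ℝ (fun z => fderiv ℝ η z a) y b
      = fderiv ℝ (fderiv ℝ η) y b a := by
    intro a b
    have := fderiv_clm_apply (c := fderiv ℝ η) (u := fun _ => a) (x := y) (h1 y)
      (differentiableAt_const a)
    simp [this]
  have hs : IsSymmSndFDerivAt ℝ η y := by
    apply ContDiffAt.isSymmSndFDerivAt (n := 2)
    · exact (h.of_le (by norm_cast)).contDiffAt
    · simp
  change fderiv ℝ (fun z => fderiv ℝ η z _) y _ = fderiv ℝ (fun z => fderiv ℝ η z _) y _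
  rw [key, key]
  exact hs _ _

theorem IsTest.continuous {D : Set (Space d)} {η : Space d → ℝ} (h : IsTest D η) : Continuous η :=
  h.contDiff.continuous

theorem IsTest.eq_zero {D : Set (Space d)} {η : Space d → ℝ} (h : IsTest D η) {y : Space d}
    (hy : y ∉ D) : η y = 0 := by
  by_contra h0
  exact hy (h.subset (subset_tsupport _ h0))

/-! ### Elliptic matrices -/

/-- The transpose. -/
abbrev Mat.tr (M : Mat d) : Mat d := Matrix.transpose M

theorem Mat.op_apply (M : Mat d) (v : Space d) (i : Fin d) : M.op v i = ∑ j, M i j * v j := by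
  rw [Mat.op, Matrix.ofLp_toEuclideanCLM]
  rfl

theorem Mat.inner_op_left (M : Mat d) (v w : Space d) :
    inner ℝ (M.op v) w = inner ℝ v (M.tr.op w) := by
  simp only [PiLp.inner_apply, Mat.op_apply, RCLike.inner_apply, conj_trivial, Finset.mul_sum,
    Finset.sum_mul, Matrix.transpose_apply]
  rw [Finset.sum_comm]
  exact Finset.sum_congr rfl fun i _ => Finset.sum_congr rfl fun j _ => by ring

/-- The dual problem uses transposed coefficients with the same constants. The upper bound follows
from |Mᵗv|² = v · M(Mᵗv). -/
theorem IsElliptic.transpose {α β : ℝ} {M : Mat d} (h : IsElliptic α β M) (hβ : 0 ≤ β) :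
    IsElliptic α β M.tr := by
  intro v
  constructor
  · rw [← Mat.inner_op_left, real_inner_comm]
    exact (h v).1
  · by_cases h0 : M.tr.op v = 0
    · rw [h0, norm_zero]; positivity
    have hpos : 0 < ‖M.tr.op v‖ := norm_pos_iff.mpr h0
    have h1 : ‖M.tr.op v‖ * ‖M.tr.op v‖ ≤ (β * ‖v‖) * ‖M.tr.op v‖ := by
      rw [← real_inner_self_eq_norm_mul_norm, ← Mat.inner_op_left]
      refine (real_inner_le_norm _ _).trans ?_
      have := (h (M.tr.op v)).2
      calc _ ≤ β * ‖M.tr.op v‖ * ‖v‖ := by gcongr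
        _ = _ := by ring
    exact le_of_mul_le_mul_right h1 hpos

/-- The inverse of the symmetric part of an elliptic matrix. -/
theorem IsElliptic.exists_inverse_symm {α β : ℝ} {A : Mat d} (h : IsElliptic α β A) (hα : 0 < α)
    (hβ : 0 < β) :
    ∃ T : Mat d, (∀ i j, T i j = T j i) ∧ (∑ i, ∑ j, A i j * T j i = d) ∧
      (∀ z, inner ℝ (T.op z) (A.op (T.op z)) = inner ℝ z (T.op z)) ∧
      (∀ z, α / β ^ 2 * ‖z‖ ^ 2 ≤ inner ℝ z (T.op z)) ∧
      (∀ z, inner ℝ z (T.op z) ≤ ‖z‖ ^ 2 / α) := by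
  -- The operator Σ A i j ∂ᵢ∂ⱼ only sees the symmetric part; the sublevel sets of z · S⁻¹z are the
  -- ellipsoids adapted to its mean value property.
  set S : Mat d := (1 / 2 : ℝ) • (A + A.transpose) with hS
  have hST : S.transpose = S := by
    rw [hS, Matrix.transpose_smul, Matrix.transpose_add, Matrix.transpose_transpose, add_comm]
  have hSop : ∀ v, S.op v = (1 / 2 : ℝ) • (A.op v + A.tr.op v) := by
    intro v
    simp [hS, Mat.op]
  have hin : ∀ v, inner ℝ v (S.op v) = inner ℝ v (A.op v) := by
    intro v
    rw [hSop, inner_smul_right, inner_add_right, ← Mat.inner_op_left, real_inner_comm v (A.op v)]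
    ring
  have hnorm : ∀ v, ‖S.op v‖ ≤ β * ‖v‖ := by
    intro v
    rw [hSop, norm_smul]
    have h1 := (h v).2
    have h2 := (h.transpose hβ.le v).2
    have h3 := norm_add_le (A.op v) (A.tr.op v)
    rw [Real.norm_of_nonneg (by norm_num)]
    linarith
  have hunit : IsUnit S := by
    rw [← Matrix.mulVec_injective_iff_isUnit]
    intro x y hxy
    have h0 : S.op (WithLp.toLp 2 (x - y)) = 0 := by
      have : S.mulVec (x - y) = 0 := by rw [Matrix.mulVec_sub]; exact sub_eq_zero.mpr hxy
      rw [Mat.op, Matrix.toEuclideanCLM_toLp, this, WithLp.toLp_zero]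
    have h1 := (h (WithLp.toLp 2 (x - y))).1
    rw [← hin, h0, inner_zero_right] at h1
    have h2 : ‖(WithLp.toLp 2 (x - y) : Space d)‖ = 0 := by
      by_contra hne
      have : 0 < ‖(WithLp.toLp 2 (x - y) : Space d)‖ ^ 2 := by positivity
      nlinarith
    have h3 := norm_eq_zero.mp h2
    have h4 : x - y = 0 := by simpa using congrArg WithLp.ofLp h3
    exact sub_eq_zero.mp h4
  have hdet : IsUnit S.det := (Matrix.isUnit_iff_isUnit_det _).mp hunit
  have hmul : S * S⁻¹ = 1 := Matrix.mul_nonsing_inv _ hdet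
  have hsymm : (S⁻¹).transpose = S⁻¹ := by rw [Matrix.transpose_nonsing_inv, hST]
  have hSTz : ∀ z, S.op ((S⁻¹).op z) = z := by
    intro z
    have : S.op * (S⁻¹).op = 1 := by rw [Mat.op, Mat.op, ← map_mul, hmul, map_one]
    simpa using congrArg (fun f => f z) this
  have hkey : ∀ z, inner ℝ ((S⁻¹).op z) (A.op ((S⁻¹).op z)) = inner ℝ z ((S⁻¹).op z) := by
    intro z
    rw [← hin, hSTz, real_inner_comm]
  refine ⟨S⁻¹, fun i j => ?_, ?_, hkey, fun z => ?_, fun z => ?_⟩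
  · conv_lhs => rw [← hsymm]
    rfl
  -- Against the symmetric matrix S⁻¹ the antisymmetric part of A has zero trace, so A may be
  -- replaced by S.
  · have h1 : (A * S⁻¹).trace = (A.transpose * S⁻¹).trace := by
      rw [← Matrix.trace_transpose, Matrix.transpose_mul, hsymm, Matrix.trace_mul_comm]
    have h2 : (S * S⁻¹).trace = (A * S⁻¹).trace := by
      rw [hS, Matrix.smul_mul, Matrix.add_mul, Matrix.trace_smul, Matrix.trace_add, ← h1, ← hS,
        smul_eq_mul]
      ring
    rw [hmul, Matrix.trace_one, Fintype.card_fin] at h2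
    rw [h2]
    rfl
  · rw [← hkey]
    have h1 := (h ((S⁻¹).op z)).1
    -- Since S S⁻¹z = z, this reads |z| ≤ β |S⁻¹z| and turns α |S⁻¹z|² into the lower bound α/β²
    -- |z|².
    have h2 := hnorm ((S⁻¹).op z)
    rw [hSTz] at h2
    have h3 : ‖z‖ ^ 2 ≤ β ^ 2 * ‖(S⁻¹).op z‖ ^ 2 := by
      rw [← mul_pow]; gcongr
    refine le_trans ?_ h1
    rw [div_mul_eq_mul_div, div_le_iff₀ (by positivity)]
    nlinarith
  · have h1 := (h ((S⁻¹).op z)).1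
    rw [hkey] at h1
    have h2 := real_inner_le_norm z ((S⁻¹).op z)
    set a := ‖(S⁻¹).op z‖
    have ha : 0 ≤ a := norm_nonneg _
    have h4 : α * a ≤ ‖z‖ := by
      rcases ha.eq_or_lt with h0 | h0
      · rw [← h0]; simp
      · refine le_of_mul_le_mul_right ?_ h0
        nlinarith
    rw [le_div_iff₀ hα]
    nlinarith [norm_nonneg z]

/-! ### A bump function on the line and its primitive -/

/-- A smooth even bump, equal to one on `[-1/2, 1/2]` and vanishing off `(-1, 1)`. -/
def bump : ContDiffBump (0 : ℝ) := ⟨1 / 2, 1, by norm_num, by norm_num⟩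

/-- The primitive of the bump that vanishes on `[1, ∞)`. -/
def bumpPrim (t : ℝ) : ℝ := ∫ s in (1 : ℝ)..t, bump s

theorem hasDerivAt_bumpPrim (t : ℝ) : HasDerivAt bumpPrim (bump t) t :=
  intervalIntegral.integral_hasDerivAt_right (bump.continuous.intervalIntegrable _ _)
    (bump.continuous.stronglyMeasurableAtFilter _ _) bump.continuous.continuousAt

theorem contDiff_bumpPrim : ContDiff ℝ (⊤ : ℕ∞) bumpPrim := by
  rw [contDiff_infty_iff_deriv]
  refine ⟨fun t => (hasDerivAt_bumpPrim t).differentiableAt, ?_⟩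
  have : deriv bumpPrim = bump := funext fun t => (hasDerivAt_bumpPrim t).deriv
  rw [this]
  exact bump.contDiff

theorem bump_eq_zero {t : ℝ} (ht : 1 ≤ t) : bump t = 0 := by
  apply bump.zero_of_le_dist
  simpa [bump, abs_of_nonneg (zero_le_one.trans ht)] using ht

theorem bumpPrim_eq_zero {t : ℝ} (ht : 1 ≤ t) : bumpPrim t = 0 := by
  unfold bumpPrim
  rw [intervalIntegral.integral_congr (g := fun _ => 0)]
  · simp
  · intro s hs
    rw [uIcc_of_le ht] at hs
    exact bump_eq_zero hs.1

/-! ### The mean value property for constant-coefficient elliptic equations -/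

/-- The quadratic form `z ↦ z · T z`. -/
def quad (T : Mat d) (z : Space d) : ℝ := inner ℝ z (T.op z)

theorem hasFDerivAt_quad {T : Mat d} (hT : ∀ i j, T i j = T j i) (z : Space d) :
    HasFDerivAt (quad T) ((2 : ℝ) • innerSL ℝ (T.op z)) z := by
  have h := (hasFDerivAt_id (𝕜 := ℝ) z).inner ℝ (T.op.hasFDerivAt (x := z))
  refine HasFDerivAt.congr_fderiv h (ContinuousLinearMap.ext fun v => ?_)
  have htr : T.tr = T := by ext i j; exact (hT i j).symm
  have : inner ℝ z (T.op v) = inner ℝ (T.op z) v := by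
    rw [Mat.inner_op_left, htr]
  change inner ℝ z (T.op v) + inner ℝ v (T.op z) = 2 * inner ℝ (T.op z) v
  rw [this, real_inner_comm v (T.op z)]
  ring

theorem contDiff_quad (T : Mat d) : ContDiff ℝ (⊤ : ℕ∞) (quad T) :=
  contDiff_id.inner ℝ (T.op.contDiff)

theorem quad_continuous (T : Mat d) : Continuous (quad T) := (contDiff_quad T).continuous

/-- A potential whose elliptic operator is the radial derivative of the averaging kernel. -/
def radial (T : Mat d) (x : Space d) (R : ℝ) (z : Space d) : ℝ := bumpPrim (quad T (z - x) / R ^ 2)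

theorem contDiff_radial (T : Mat d) (x : Space d) (R : ℝ) : ContDiff ℝ (⊤ : ℕ∞) (radial T x R) :=
  contDiff_bumpPrim.comp
    (((contDiff_quad T).comp (contDiff_id.sub contDiff_const)).div_const _)

theorem hasFDerivAt_quad_scaled {T : Mat d} (hT : ∀ i j, T i j = T j i) (x : Space d) (R : ℝ)
    (z : Space d) :
    HasFDerivAt (fun z => quad T (z - x) / R ^ 2)
      ((R ^ 2)⁻¹ • (2 : ℝ) • innerSL ℝ (T.op (z - x))) z := by
  have h := ((hasFDerivAt_quad hT (z - x)).comp z ((hasFDerivAt_id z).sub_const x)).const_mul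
    (R ^ 2)⁻¹
  refine (h.congr_fderiv ?_).congr_of_eventuallyEq (Eventually.of_forall fun y => ?_)
  · ext v; simp
  · simp [div_eq_inv_mul]

theorem pd_radial {T : Mat d} (hT : ∀ i j, T i j = T j i) (x : Space d) (R : ℝ) (j : Fin d) :
    pd j (radial T x R) = fun z =>
      bump (quad T (z - x) / R ^ 2) * (2 / R ^ 2 * T.op (z - x) j) := by
  funext z
  have h := (hasDerivAt_bumpPrim (quad T (z - x) / R ^ 2)).comp_hasFDerivAt z
    (hasFDerivAt_quad_scaled hT x R z)
  unfold pd
  rw [show radial T x R = bumpPrim ∘ fun z => quad T (z - x) / R ^ 2 from rfl, h.fderiv]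
  simp [EuclideanSpace.inner_single_right]
  left
  ring

theorem pd_pd_radial {T : Mat d} (hT : ∀ i j, T i j = T j i) (x : Space d) (R : ℝ) (i j : Fin d)
    (z : Space d) :
    pd i (pd j (radial T x R)) z =
      deriv bump (quad T (z - x) / R ^ 2) * (2 / R ^ 2 * T.op (z - x) i) *
          (2 / R ^ 2 * T.op (z - x) j)
        + bump (quad T (z - x) / R ^ 2) * (2 / R ^ 2 * T j i) := by
  rw [pd_radial hT]
  have hb : HasDerivAt bump (deriv bump (quad T (z - x) / R ^ 2)) (quad T (z - x) / R ^ 2) :=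
    ((bump.contDiff (n := 1)).differentiable one_ne_zero _).hasDerivAt
  have h1 := hb.comp_hasFDerivAt z (hasFDerivAt_quad_scaled hT x R z)
  have h2 : HasFDerivAt (fun z => 2 / R ^ 2 * T.op (z - x) j)
      ((2 / R ^ 2) • ((EuclideanSpace.proj j : Space d →L[ℝ] ℝ) ∘L T.op)) z := by
    have := ((((EuclideanSpace.proj j : Space d →L[ℝ] ℝ) ∘L T.op).hasFDerivAt (x := z - x)).comp z
      ((hasFDerivAt_id z).sub_const x)).const_mul (2 / R ^ 2)
    refine (this.congr_fderiv ?_).congr_of_eventuallyEq (Eventually.of_forall fun y => ?_)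
    · ext v; simp
    · simp
  have h3 := h1.mul h2
  unfold pd
  have h4 : (fun z => bump (quad T (z - x) / R ^ 2) * (2 / R ^ 2 * T.op (z - x) j)) =
    (bump ∘ fun z => quad T (z - x) / R ^ 2) * fun z => 2 / R ^ 2 * T.op (z - x) j := rfl
  rw [h4, h3.fderiv]
  have h5 : (EuclideanSpace.proj j : Space d →L[ℝ] ℝ) (T.op (EuclideanSpace.single i 1)) = T j i := by
    change T.op (EuclideanSpace.single i 1) j = T j i
    rw [Mat.op_apply]; simp
  simp only [add_apply, smul_apply, smul_eq_mul,
    ContinuousLinearMap.comp_apply, h5, innerSL_apply_apply,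
    EuclideanSpace.inner_single_right, Function.comp_apply, conj_trivial]
  ring

theorem inner_op_eq_sum (A : Mat d) (v : Space d) :
    inner ℝ v (A.op v) = ∑ i, ∑ j, A i j * (v i * v j) := by
  simp only [PiLp.inner_apply, Mat.op_apply, RCLike.inner_apply, conj_trivial, Finset.sum_mul]
  exact Finset.sum_congr rfl fun i _ => Finset.sum_congr rfl fun j _ => by ring

/-- The action of the elliptic operator on the radial potential. -/
theorem elliptic_radial {A T : Mat d} (hT : ∀ i j, T i j = T j i)
    (htr : ∑ i, ∑ j, A i j * T j i = d)
    (hq : ∀ z, inner ℝ (T.op z) (A.op (T.op z)) = inner ℝ z (T.op z))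
    (x : Space d) {R : ℝ} (hR : 0 < R) (z : Space d) :
    ∑ i, ∑ j, A i j * pd i (pd j (radial T x R)) z =
      2 / R ^ 2 * (d * bump (quad T (z - x) / R ^ 2) +
        2 * (quad T (z - x) / R ^ 2) * deriv bump (quad T (z - x) / R ^ 2)) := by
  simp only [pd_pd_radial hT]
  have h1 := hq (z - x)
  rw [inner_op_eq_sum] at h1
  change _ = quad T (z - x) at h1
  set w := T.op (z - x)
  set t := quad T (z - x) / R ^ 2 with ht
  have h2 : ∑ i, ∑ j, A i j * (deriv bump t * (2 / R ^ 2 * w i) * (2 / R ^ 2 * w j)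
      + bump t * (2 / R ^ 2 * T j i)) =
      (deriv bump t * (2 / R ^ 2) ^ 2) * ∑ i, ∑ j, A i j * (w i * w j) +
      bump t * (2 / R ^ 2) * ∑ i, ∑ j, A i j * T j i := by
    simp only [Finset.mul_sum, ← Finset.sum_add_distrib]
    exact Finset.sum_congr rfl fun i _ => Finset.sum_congr rfl fun j _ => by ring
  rw [h2, h1, htr]
  have h3 : quad T (z - x) = t * R ^ 2 := by rw [ht]; field_simp
  rw [h3]
  field_simp
  ring

/-- The primitive of the bump is normalized to vanish on [1, ∞), so the potential lives where z · Tz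
< R²; the lower bound on the form places this set in a ball of radius R/κ. -/
theorem radial_isTest {T : Mat d} {κ : ℝ} (hκ : 0 < κ) (hlow : ∀ z, κ ^ 2 * ‖z‖ ^ 2 ≤ quad T z)
    (x : Space d) {R : ℝ} (hR : 0 < R) {D : Set (Space d)}
    (hD : Metric.closedBall x (R / κ) ⊆ D) : IsTest D (radial T x R) := by
  have hs : tsupport (radial T x R) ⊆ Metric.closedBall x (R / κ) := by
    refine closure_minimal (fun z hz => ?_) Metric.isClosed_closedBall
    by_contra h
    apply hz
    apply bumpPrim_eq_zero
    rw [Metric.mem_closedBall, dist_eq_norm, not_le, div_lt_iff₀ hκ] at h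
    rw [one_le_div (by positivity)]
    refine le_trans ?_ (hlow _)
    rw [← mul_pow]
    have : R ≤ κ * ‖z - x‖ := by linarith
    gcongr
  exact ⟨contDiff_radial T x R,
    HasCompactSupport.of_support_subset_isCompact (isCompact_closedBall x (R / κ))
      ((subset_tsupport _).trans hs), hs.trans hD⟩

/-- Average of `f` against the averaging kernel at scale `R` around `x`. -/
def kernelMean (T : Mat d) (f : Space d → ℝ) (x : Space d) (R : ℝ) : ℝ :=
  ∫ z, (R ^ d)⁻¹ * bump (quad T (z - x) / R ^ 2) * f z

theorem exists_bound_deriv_bump : ∃ M : ℝ, 0 < M ∧ ∀ t : ℝ, |deriv bump t| ≤ M ∧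
    |t * deriv bump t| ≤ M := by
  have hc : Continuous (deriv bump) := (bump.contDiff (n := 1)).continuous_deriv le_rfl
  have hs : HasCompactSupport (deriv bump) := bump.hasCompactSupport.deriv
  obtain ⟨M₁, h₁⟩ := hs.exists_bound_of_continuous hc
  obtain ⟨M₂, h₂⟩ := (hs.mul_left (f := fun t : ℝ => t)).exists_bound_of_continuous
    (continuous_id.mul hc)
  refine ⟨max 1 (max M₁ M₂), by positivity, fun t => ⟨?_, ?_⟩⟩
  · exact (h₁ t).trans ((le_max_left _ _).trans (le_max_right _ _))
  · exact (h₂ t).trans ((le_max_right _ _).trans (le_max_right _ _))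

/-- The bracket is exactly the one in `elliptic_radial`: up to a factor depending only on R, the
R-derivative of the kernel is the elliptic operator applied to a test function. -/
theorem hasDerivAt_kernel (T : Mat d) (x z : Space d) {R : ℝ} (hR : 0 < R) :
    HasDerivAt (fun R : ℝ => (R ^ d)⁻¹ * bump (quad T (z - x) / R ^ 2))
      (-((R ^ d)⁻¹ * R⁻¹ * (d * bump (quad T (z - x) / R ^ 2) +
        2 * (quad T (z - x) / R ^ 2) * deriv bump (quad T (z - x) / R ^ 2)))) R := by
  have hb : HasDerivAt bump (deriv bump (quad T (z - x) / R ^ 2)) (quad T (z - x) / R ^ 2) :=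
    ((bump.contDiff (n := 1)).differentiable one_ne_zero _).hasDerivAt
  have h1 : HasDerivAt (fun R : ℝ => quad T (z - x) / R ^ 2) (-(2 * (quad T (z - x)) / R ^ 3)) R := by
    have := (hasDerivAt_pow 2 R).inv (by positivity : R ^ 2 ≠ 0)
    have := this.const_mul (quad T (z - x))
    refine this.congr_deriv ?_
    simp only [Nat.cast_ofNat, Nat.add_one_sub_one, pow_one]
    field_simp
  have h2 : HasDerivAt (fun R : ℝ => (R ^ d)⁻¹) (-(d * (R ^ d)⁻¹ * R⁻¹)) R := by
    have := (hasDerivAt_pow d R).inv (by positivity : R ^ d ≠ 0)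
    refine this.congr_deriv ?_
    rcases d with _ | n
    · simp
    · simp only [Nat.add_sub_cancel, pow_succ]
      field_simp
  have h3 := h2.mul (hb.comp R h1)
  refine h3.congr_deriv ?_
  simp only [Function.comp]
  field_simp
  ring

/-- The derivative of the kernel is a multiple of the operator applied to `radial`, which is an
admissible test function. Only the very weak equation is needed, so no regularity of f enters. -/
theorem hasDerivAt_kernelMean {A T : Mat d} (hT : ∀ i j, T i j = T j i)
    (htr : ∑ i, ∑ j, A i j * T j i = d)
    (hq : ∀ z, inner ℝ (T.op z) (A.op (T.op z)) = inner ℝ z (T.op z))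
    {κ : ℝ} (hκ : 0 < κ) (hlow : ∀ z, κ ^ 2 * ‖z‖ ^ 2 ≤ quad T z) {D : Set (Space d)}
    {f : Space d → ℝ} (hf : Integrable f)
    (hharm : ∀ η, IsTest D η → ∫ z, f z * ∑ i, ∑ j, A i j * pd i (pd j η) z = 0)
    (x : Space d) {R : ℝ} (hR : 0 < R) (hD : Metric.closedBall x (R / κ) ⊆ D) :
    HasDerivAt (kernelMean T f x) 0 R := by
  obtain ⟨M, hM, hMb⟩ := exists_bound_deriv_bump
  set F : ℝ → Space d → ℝ := fun R z => (R ^ d)⁻¹ * bump (quad T (z - x) / R ^ 2) * f z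
  set F' : ℝ → Space d → ℝ := fun R z =>
    (-((R ^ d)⁻¹ * R⁻¹ * (d * bump (quad T (z - x) / R ^ 2) +
        2 * (quad T (z - x) / R ^ 2) * deriv bump (quad T (z - x) / R ^ 2)))) * f z
  have hqc : ∀ R : ℝ, Continuous fun z : Space d => quad T (z - x) / R ^ 2 := fun R =>
    ((quad_continuous T).comp (continuous_id.sub continuous_const)).div_const _
  have hbc : ∀ R : ℝ, Continuous fun z : Space d => bump (quad T (z - x) / R ^ 2) := fun R =>
    bump.continuous.comp (hqc R)
  have hdc : ∀ R : ℝ, Continuous fun z : Space d => deriv bump (quad T (z - x) / R ^ 2) := fun R =>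
    ((bump.contDiff (n := 1)).continuous_deriv le_rfl).comp (hqc R)
  have hball : ∀ R' ∈ Metric.ball R (R / 2), R / 2 < R' := by
    intro R' hR'
    rw [Metric.mem_ball, Real.dist_eq, abs_lt] at hR'
    linarith
  have key := hasDerivAt_integral_of_dominated_loc_of_deriv_le (μ := (volume : Measure (Space d)))
    (F := F) (F' := F') (x₀ := R) (s := Metric.ball R (R / 2))
    (bound := fun z => ((R / 2) ^ d)⁻¹ * (R / 2)⁻¹ * (d + 2 * M) * |f z|)
    (Metric.ball_mem_nhds _ (by positivity))
    (Eventually.of_forall fun R' =>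
      ((continuous_const.mul (hbc R')).aestronglyMeasurable.mul hf.aestronglyMeasurable))
    ?_ ?_ ?_ ?_ ?_
  · have h0 : ∫ z, F' R z = 0 := by
      have := hharm _ (radial_isTest hκ hlow x hR hD)
      simp only [elliptic_radial hT htr hq x hR] at this
      -- The factor -R^{-d} R/2 converts the prefactor 2/R² of `elliptic_radial` into the prefactor
      -- -R^{-d} R^{-1} of `hasDerivAt_kernel`.
      have h2 : ∀ z, F' R z = (-((R ^ d)⁻¹ * R / 2)) * (f z * (2 / R ^ 2 *
        (d * bump (quad T (z - x) / R ^ 2) +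
        2 * (quad T (z - x) / R ^ 2) * deriv bump (quad T (z - x) / R ^ 2)))) := by
        intro z
        simp only [F']
        generalize (d * bump (quad T (z - x) / R ^ 2) +
          2 * (quad T (z - x) / R ^ 2) * deriv bump (quad T (z - x) / R ^ 2)) = Y
        have : (R ^ d) ≠ 0 := by positivity
        field_simp
      rw [integral_congr_ae (Eventually.of_forall h2), integral_const_mul, this, mul_zero]
    have := key.2
    rw [h0] at this
    exact this
  · refine Integrable.mono' (hf.norm.const_mul (R ^ d)⁻¹)
      ((continuous_const.mul (hbc R)).aestronglyMeasurable.mul hf.aestronglyMeasurable)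
      (Eventually.of_forall fun z => ?_)
    simp only [F, norm_mul]
    rw [Real.norm_of_nonneg (by positivity : 0 ≤ (R ^ d)⁻¹), mul_assoc]
    gcongr
    rw [Real.norm_of_nonneg (bump.nonneg)]
    exact mul_le_of_le_one_left (norm_nonneg _) bump.le_one
  · refine AEStronglyMeasurable.mul (Continuous.aestronglyMeasurable ?_) hf.aestronglyMeasurable
    exact (continuous_const.mul ((continuous_const.mul (hbc R)).add
      ((continuous_const.mul (hqc R)).mul (hdc R)))).neg
  · refine Eventually.of_forall fun z R' hR' => ?_
    have h1 := hball R' hR'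
    have hR'0 : 0 < R' := by linarith
    simp only [F', norm_mul, norm_neg]
    rw [Real.norm_of_nonneg (by positivity : 0 ≤ (R' ^ d)⁻¹),
      Real.norm_of_nonneg (by positivity : 0 ≤ R'⁻¹), Real.norm_eq_abs (f z)]
    gcongr
    have h2 := (hMb (quad T (z - x) / R' ^ 2)).2
    refine (norm_add_le _ _).trans ?_
    rw [mul_assoc 2, norm_mul, norm_mul (2 : ℝ), Real.norm_of_nonneg (bump.nonneg)]
    simp only [Real.norm_eq_abs, Nat.abs_cast, Nat.abs_ofNat]
    have h3 : (d : ℝ) * bump (quad T (z - x) / R' ^ 2) ≤ d :=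
      mul_le_of_le_one_right (by positivity) bump.le_one
    linarith
  · exact hf.norm.const_mul _
  · refine Eventually.of_forall fun z R' hR' => ?_
    exact (hasDerivAt_kernel T x z (by linarith [hball R' hR'])).mul_const _

theorem bump_quad_eq_zero {T : Mat d} {κ : ℝ} (hκ : 0 < κ)
    (hlow : ∀ z, κ ^ 2 * ‖z‖ ^ 2 ≤ quad T z) {R : ℝ} (hR : 0 < R) {x z : Space d}
    (hz : z ∉ Metric.closedBall x (R / κ)) : bump (quad T (z - x) / R ^ 2) = 0 := by
  apply bump_eq_zero
  rw [Metric.mem_closedBall, dist_eq_norm, not_le, div_lt_iff₀ hκ] at hz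
  rw [one_le_div (by positivity)]
  refine le_trans ?_ (hlow _)
  rw [← mul_pow]
  have : R ≤ κ * ‖z - x‖ := by linarith
  gcongr

/-- The total mass of the averaging kernel. -/
def kernelMass (T : Mat d) : ℝ := ∫ z, bump (quad T z)

theorem integral_kernel (T : Mat d) (x : Space d) {R : ℝ} (hR : 0 < R) :
    ∫ z, (R ^ d)⁻¹ * bump (quad T (z - x) / R ^ 2) = kernelMass T := by
  rw [integral_sub_right_eq_self (μ := volume)
    (fun z => (R ^ d)⁻¹ * bump (quad T z / R ^ 2)) x, integral_const_mul]
  have h1 : ∀ z : Space d, bump (quad T z / R ^ 2) = bump (quad T (R⁻¹ • z)) := by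
    intro z
    congr 1
    simp only [quad, map_smul, inner_smul_left, inner_smul_right, conj_trivial]
    field_simp
  simp_rw [h1]
  rw [Measure.integral_comp_inv_smul (volume : Measure (Space d)) (fun z => bump (quad T z)) R]
  simp only [finrank_euclideanSpace, Fintype.card_fin, smul_eq_mul, kernelMass]
  rw [abs_of_pos (by positivity)]
  field_simp

theorem continuous_bump_quad (T : Mat d) (x : Space d) (R : ℝ) :
    Continuous fun z : Space d => bump (quad T (z - x) / R ^ 2) :=
  bump.continuous.comp
    (((quad_continuous T).comp (continuous_id.sub continuous_const)).div_const _)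

theorem integrable_kernel {T : Mat d} {κ : ℝ} (hκ : 0 < κ)
    (hlow : ∀ z, κ ^ 2 * ‖z‖ ^ 2 ≤ quad T z) (x : Space d) {R : ℝ} (hR : 0 < R) :
    Integrable fun z : Space d => (R ^ d)⁻¹ * bump (quad T (z - x) / R ^ 2) := by
  refine (Continuous.integrable_of_hasCompactSupport (continuous_bump_quad T x R) ?_).const_mul _
  refine HasCompactSupport.intro (isCompact_closedBall x (R / κ)) fun z hz => ?_
  exact bump_quad_eq_zero hκ hlow hR hz

theorem integrable_kernel_mul (T : Mat d) (x : Space d) (R : ℝ) {f : Space d → ℝ}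
    (hf : Integrable f) :
    Integrable fun z : Space d => (R ^ d)⁻¹ * bump (quad T (z - x) / R ^ 2) * f z := by
  refine hf.bdd_mul (c := |(R ^ d)⁻¹|)
    (continuous_const.mul (continuous_bump_quad T x R)).aestronglyMeasurable
    (Eventually.of_forall fun z => ?_)
  rw [norm_mul, Real.norm_of_nonneg bump.nonneg, Real.norm_eq_abs]
  exact mul_le_of_le_one_right (abs_nonneg _) bump.le_one

/-- Averages against the kernel converge at Lebesgue points. -/
theorem ae_tendsto_kernelMean {T : Mat d} {κ : ℝ} (hκ : 0 < κ)
    (hlow : ∀ z, κ ^ 2 * ‖z‖ ^ 2 ≤ quad T z) {f : Space d → ℝ} (hf : Integrable f) :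
    ∀ᵐ x, Tendsto (kernelMean T f x) (𝓝[>] 0) (𝓝 (f x * kernelMass T)) := by
  filter_upwards [IsUnifLocDoublingMeasure.ae_tendsto_average_norm_sub
    (μ := (volume : Measure (Space d))) hf.locallyIntegrable 1] with x hx
  have hlim : Tendsto (fun R : ℝ => R / κ) (𝓝[>] 0) (𝓝[>] 0) := by
    refine tendsto_nhdsWithin_iff.mpr ⟨?_, ?_⟩
    · have : Tendsto (fun R : ℝ => R / κ) (𝓝 0) (𝓝 (0 / κ)) := tendsto_id.div_const κ
      rw [zero_div] at this
      exact this.mono_left nhdsWithin_le_nhds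
    · filter_upwards [self_mem_nhdsWithin] with R hR
      exact div_pos hR hκ
  have h1 := hx (fun _ : ℝ => x) (fun R => R / κ) hlim (by
    filter_upwards [self_mem_nhdsWithin] with R hR
    have : (0 : ℝ) < R := hR
    simp; positivity)
  set ω := (volume : Measure (Space d)).real (Metric.closedBall 0 1)
  have h2 := h1.const_mul (ω * (κ ^ d)⁻¹)
  rw [mul_zero] at h2
  rw [tendsto_iff_norm_sub_tendsto_zero]
  refine squeeze_zero' (Eventually.of_forall fun _ => norm_nonneg _) ?_ h2
  filter_upwards [self_mem_nhdsWithin] with R hR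
  have hR : (0 : ℝ) < R := hR
  have hk := integral_kernel T x hR
  have e1 : kernelMean T f x R - f x * kernelMass T =
      ∫ z, (R ^ d)⁻¹ * bump (quad T (z - x) / R ^ 2) * (f z - f x) := by
    rw [← hk, mul_comm (f x), ← integral_mul_const, kernelMean,
      ← integral_sub (integrable_kernel_mul T x R hf) ((integrable_kernel hκ hlow x hR).mul_const _)]
    congr 1
    funext z
    ring
  have hfi : IntegrableOn (fun z => ‖f z - f x‖) (Metric.closedBall x (R / κ)) := by
    refine (Integrable.sub hf.integrableOn ?_).norm
    exact integrableOn_const measure_closedBall_lt_top.ne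
  have e2 : ‖kernelMean T f x R - f x * kernelMass T‖ ≤
      (R ^ d)⁻¹ * ∫ z in Metric.closedBall x (R / κ), ‖f z - f x‖ := by
    rw [e1, ← integral_const_mul, ← integral_indicator measurableSet_closedBall]
    refine norm_integral_le_of_norm_le ?_ (Eventually.of_forall fun z => ?_)
    · exact (integrable_indicator_iff measurableSet_closedBall).mpr (hfi.const_mul _)
    · by_cases hz : z ∈ Metric.closedBall x (R / κ)
      · rw [indicator_of_mem hz, norm_mul, norm_mul, Real.norm_of_nonneg bump.nonneg,
          Real.norm_of_nonneg (by positivity : 0 ≤ (R ^ d)⁻¹)]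
        gcongr
        exact mul_le_of_le_one_right (by positivity) bump.le_one
      · rw [indicator_of_notMem hz, bump_quad_eq_zero hκ hlow hR hz]
        simp
  refine e2.trans (le_of_eq ?_)
  rw [setAverage_eq, measureReal_def, Measure.addHaar_closedBall' _ _ (by positivity), smul_eq_mul]
  simp only [finrank_euclideanSpace, Fintype.card_fin]
  rw [ENNReal.toReal_mul, ENNReal.toReal_ofReal (by positivity), ← measureReal_def]
  have hω : 0 < ω := by
    apply ENNReal.toReal_pos
    · exact (Metric.measure_closedBall_pos volume _ one_pos).ne'
    · exact measure_closedBall_lt_top.ne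
  change _ = ω * (κ ^ d)⁻¹ * (((R / κ) ^ d * ω)⁻¹ * _)
  rw [div_pow]
  have : (κ ^ d) ≠ 0 := by positivity
  have : (R ^ d) ≠ 0 := by positivity
  field_simp

/-- The mean does not depend on R, and as R tends to 0 it converges to f(x) times the kernel mass at
Lebesgue points. The exceptional null set does not depend on R. -/
theorem ae_eq_kernelMean {A T : Mat d} (hT : ∀ i j, T i j = T j i)
    (htr : ∑ i, ∑ j, A i j * T j i = d)
    (hq : ∀ z, inner ℝ (T.op z) (A.op (T.op z)) = inner ℝ z (T.op z))
    {κ : ℝ} (hκ : 0 < κ) (hlow : ∀ z, κ ^ 2 * ‖z‖ ^ 2 ≤ quad T z) {D : Set (Space d)}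
    {f : Space d → ℝ} (hf : Integrable f)
    (hharm : ∀ η, IsTest D η → ∫ z, f z * ∑ i, ∑ j, A i j * pd i (pd j η) z = 0) :
    ∀ᵐ x, ∀ R : ℝ, 0 < R → Metric.closedBall x (R / κ) ⊆ D →
      f x * kernelMass T = kernelMean T f x R := by
  filter_upwards [ae_tendsto_kernelMean hκ hlow hf] with x hx R hR hD
  have hconst : ∀ r ∈ Ioc 0 R, kernelMean T f x r = kernelMean T f x R := by
    intro r hr
    have h := Convex.norm_image_sub_le_of_norm_hasDerivWithin_le (𝕜 := ℝ)
      (f := kernelMean T f x) (f' := fun _ => 0) (C := 0)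
      (s := Icc r R) (x := r) (y := R) (fun t ht => ?_) (by simp) (convex_Icc r R)
      (left_mem_Icc.mpr hr.2) (right_mem_Icc.mpr hr.2)
    · rw [zero_mul, norm_le_zero_iff, sub_eq_zero] at h
      exact h.symm
    · have ht0 : 0 < t := hr.1.trans_le ht.1
      refine (hasDerivAt_kernelMean hT htr hq hκ hlow hf hharm x ht0 ?_).hasDerivWithinAt
      exact (Metric.closedBall_subset_closedBall (by gcongr; exact ht.2)).trans hD
  have hlim : Tendsto (kernelMean T f x) (𝓝[>] 0) (𝓝 (kernelMean T f x R)) := by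
    refine tendsto_const_nhds.congr' ?_
    filter_upwards [Ioc_mem_nhdsGT hR] with r hr
    exact (hconst r hr).symm
  exact tendsto_nhds_unique hx hlim

/-- Interior estimate for constant-coefficient elliptic equations. -/
theorem exists_interior_bound (d : ℕ) {α β : ℝ} (hα : 0 < α) (hβ : 0 < β) :
    ∃ C : ℝ, 0 < C ∧ ∀ A : Mat d, IsElliptic α β A → ∀ (c : Space d) (ρ : ℝ), 0 < ρ →
      ∀ f : Space d → ℝ, MemLp f 2 →
      (∀ η, IsTest (Metric.ball c ρ) η → ∫ z, f z * ∑ i, ∑ j, A i j * pd i (pd j η) z = 0) →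
      ∀ᵐ x, x ∈ Metric.ball c (ρ / 2) → f x ^ 2 ≤ C * (ρ ^ d)⁻¹ * ∫ z in Metric.ball c ρ, f z ^ 2 := by
  -- With this κ, κ² = α/β² is the lower constant of the form T in `IsElliptic.exists_inverse_symm`.
  set κ := Real.sqrt α / β with hκd
  have hκ : 0 < κ := by positivity
  set ω := (volume : Measure (Space d)).real (Metric.ball 0 1)
  -- On the ball of radius √(α/2) the form is at most 1/2 and the bump equals one, so c₀ bounds the
  -- kernel mass from below uniformly in A.
  set c₀ := (volume : Measure (Space d)).real (Metric.closedBall 0 (Real.sqrt (α / 2)))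
  have hω : 0 < ω := ENNReal.toReal_pos (Metric.measure_ball_pos volume _ one_pos).ne'
    measure_ball_lt_top.ne
  have hc₀ : 0 < c₀ := ENNReal.toReal_pos
    (Metric.measure_closedBall_pos volume _ (by positivity)).ne' measure_closedBall_lt_top.ne
  refine ⟨((κ / 2) ^ d)⁻¹ ^ 2 * ω / c₀ ^ 2, by positivity, fun A hA c ρ hρ f hf hharm => ?_⟩
  obtain ⟨T, hT, htr, hq, hlow, hup⟩ := hA.exists_inverse_symm hα hβ
  have hlow' : ∀ z, κ ^ 2 * ‖z‖ ^ 2 ≤ quad T z := by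
    intro z
    rw [hκd, div_pow, Real.sq_sqrt hα.le]
    exact hlow z
  have hmass : c₀ ≤ kernelMass T := by
    have hint : Integrable fun z : Space d => bump (quad T z) := by
      simpa using integrable_kernel hκ hlow' 0 one_pos
    have h1 : c₀ = ∫ z in Metric.closedBall (0 : Space d) (Real.sqrt (α / 2)), (1 : ℝ) := by
      simp [c₀]
    rw [h1, kernelMass, ← integral_indicator measurableSet_closedBall]
    refine integral_mono_of_nonneg (Eventually.of_forall fun z => ?_) hint
      (Eventually.of_forall fun z => ?_)
    · exact indicator_nonneg (fun _ _ => zero_le_one) z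
    · by_cases hz : z ∈ Metric.closedBall (0 : Space d) (Real.sqrt (α / 2))
      · simp only [indicator_of_mem hz]
        refine (bump.one_of_mem_closedBall ?_).ge
        have h0 : 0 ≤ quad T z := le_trans (by positivity) (hlow' z)
        have h3 : ‖z‖ ^ 2 ≤ α / 2 := by
          rw [mem_closedBall_zero_iff] at hz
          calc ‖z‖ ^ 2 ≤ Real.sqrt (α / 2) ^ 2 := by gcongr
            _ = _ := Real.sq_sqrt (by positivity)
        have h2 : quad T z ≤ 1 / 2 := by
          refine (hup z).trans ?_
          rw [div_le_iff₀ hα]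
          linarith
        simpa [bump, abs_of_nonneg h0] using h2
      · simp only [indicator_of_notMem hz]
        exact bump.nonneg
  -- Cutting f to the ball makes it integrable on the whole space, and test functions supported in
  -- the ball do not notice.
  set B := Metric.ball c ρ with hB
  set f₀ := B.indicator f with hf₀
  have hfB : MemLp f 2 (volume.restrict B) := hf.restrict B
  have hfin : IsFiniteMeasure (volume.restrict B) := ⟨by
    rw [Measure.restrict_apply_univ]; exact measure_ball_lt_top⟩
  have hfi : IntegrableOn f B := hfB.integrable (by norm_num)
  have hf₀i : Integrable f₀ := (integrable_indicator_iff measurableSet_ball).mpr hfi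
  have hharm₀ : ∀ η, IsTest B η → ∫ z, f₀ z * ∑ i, ∑ j, A i j * pd i (pd j η) z = 0 := by
    intro η hη
    rw [← hharm η hη]
    congr 1
    funext z
    by_cases hz : z ∈ B
    · simp [hf₀, hz]
    · have : ∀ i j, pd i (pd j η) z = 0 := fun i j => ((hη.pd j).pd i).eq_zero hz
      simp [this]
  filter_upwards [ae_eq_kernelMean hT htr hq hκ hlow' hf₀i hharm₀] with x hx hxb
  -- This scale gives R/κ = ρ/2, so the kernel around a point of the half ball stays inside the
  -- ball.
  have hR : 0 < κ * ρ / 2 := by positivity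
  have hxB : x ∈ B := Metric.ball_subset_ball (by linarith) hxb
  have h1 := hx (κ * ρ / 2) hR (by
    have : κ * ρ / 2 / κ = ρ / 2 := by field_simp
    rw [this]
    intro z hz
    rw [Metric.mem_ball] at hxb ⊢
    rw [Metric.mem_closedBall] at hz
    linarith [dist_triangle z x c])
  rw [hf₀, indicator_of_mem hxB, ← hf₀] at h1
  set J := ∫ z in B, |f z|
  have hJ0 : 0 ≤ J := integral_nonneg fun _ => abs_nonneg _
  have h2 : |kernelMean T f₀ x (κ * ρ / 2)| ≤ ((κ * ρ / 2) ^ d)⁻¹ * J := by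
    rw [← integral_const_mul, ← integral_indicator measurableSet_ball, ← Real.norm_eq_abs]
    refine norm_integral_le_of_norm_le ?_ (Eventually.of_forall fun z => ?_)
    · exact (integrable_indicator_iff measurableSet_ball).mpr (hfi.norm.const_mul _)
    · by_cases hz : z ∈ B
      · rw [indicator_of_mem hz, norm_mul, norm_mul, Real.norm_of_nonneg bump.nonneg,
          Real.norm_of_nonneg (by positivity : 0 ≤ ((κ * ρ / 2) ^ d)⁻¹), hf₀, indicator_of_mem hz,
          Real.norm_eq_abs]
        gcongr
        exact mul_le_of_le_one_right (by positivity) bump.le_one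
      · have hz' : z ∉ Metric.ball c ρ := hz
        simp [hf₀, hz, indicator_of_notMem hz']
  have h3 : J ^ 2 ≤ (ρ ^ d * ω) * ∫ z in B, f z ^ 2 := by
    have hvol : (volume : Measure (Space d)).real B = ρ ^ d * ω := by
      rw [measureReal_def, Measure.addHaar_ball_of_pos _ _ hρ, ENNReal.toReal_mul,
        ENNReal.toReal_ofReal (by positivity)]
      simp [ω, measureReal_def]
    -- Cauchy–Schwarz against 1 passes from the L¹ to the L² norm at the cost of the volume ω ρ^d;
    -- with the squared factor ρ^{-2d} of the kernel this leaves ρ^{-d}.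
    have hh := integral_mul_le_Lp_mul_Lq_of_nonneg (μ := volume.restrict B) (p := 2) (q := 2)
      Real.HolderConjugate.two_two (f := fun z => |f z|) (g := fun _ => (1 : ℝ))
      (Eventually.of_forall fun _ => abs_nonneg _) (Eventually.of_forall fun _ => zero_le_one)
      (by simpa using hfB.norm) (by simpa using memLp_const 1)
    simp only [mul_one, one_div, one_pow, integral_const, measureReal_restrict_apply_univ,
      smul_eq_mul, mul_one, hvol, Real.rpow_two, sq_abs] at hh
    have hpos : 0 ≤ ∫ z in B, f z ^ 2 := integral_nonneg fun _ => sq_nonneg _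
    calc J ^ 2 ≤ ((∫ z in B, f z ^ 2) ^ (2 : ℝ)⁻¹ * (ρ ^ d * ω) ^ (2 : ℝ)⁻¹) ^ 2 := by
          gcongr
      _ = _ := by
          rw [mul_pow, ← Real.rpow_natCast, ← Real.rpow_natCast, ← Real.rpow_mul hpos,
            ← Real.rpow_mul (by positivity)]
          norm_num
          ring
  have h4 : |f x| * c₀ ≤ ((κ * ρ / 2) ^ d)⁻¹ * J := by
    refine le_trans ?_ h2
    rw [← h1, abs_mul, abs_of_nonneg (hc₀.le.trans hmass)]
    gcongr
  have h5 : (|f x| * c₀) ^ 2 ≤ (((κ * ρ / 2) ^ d)⁻¹ * J) ^ 2 := by gcongr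
  rw [mul_pow, sq_abs, mul_pow] at h5
  have h6 : f x ^ 2 * c₀ ^ 2 ≤
      ((κ * ρ / 2) ^ d)⁻¹ ^ 2 * ((ρ ^ d * ω) * ∫ z in B, f z ^ 2) := by
    refine h5.trans ?_
    gcongr
  rw [← le_div_iff₀ (by positivity)] at h6
  refine h6.trans (le_of_eq ?_)
  have : (κ * ρ / 2) ^ d = (κ / 2) ^ d * ρ ^ d := by rw [← mul_pow]; ring
  rw [this]
  have : (κ / 2) ^ d ≠ 0 := by positivity
  have : ρ ^ d ≠ 0 := by positivity
  field_simp

/-! ### Square-integrable vector fields and multiplication operators -/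

/-- Square-integrable vector fields on `ℝ^d`. -/
abbrev L2 (d : ℕ) : Type := Lp (Space d) 2 (volume : Measure (Space d))

theorem Mat.op_eq_sum (M : Mat d) (v : Space d) :
    M.op v = ∑ i, ∑ j, (M i j * v j) • EuclideanSpace.single i (1 : ℝ) := by
  ext k
  rw [Mat.op_apply]
  simp [Finset.sum_apply, ← Finset.sum_smul, Pi.single_apply]

theorem aestronglyMeasurable_coord {X : Type*} [MeasurableSpace X] {μ : Measure X}
    {f : X → Space d} (hf : AEStronglyMeasurable f μ) (i : Fin d) :
    AEStronglyMeasurable (fun x => f x i) μ :=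
  (EuclideanSpace.proj i : Space d →L[ℝ] ℝ).continuous.comp_aestronglyMeasurable hf

theorem aestronglyMeasurable_op {X : Type*} [MeasurableSpace X] {μ : Measure X}
    {b : X → Mat d} (hb : ∀ i j, AEStronglyMeasurable (fun x => b x i j) μ) {f : X → Space d}
    (hf : AEStronglyMeasurable f μ) : AEStronglyMeasurable (fun x => (b x).op (f x)) μ := by
  simp_rw [Mat.op_eq_sum]
  refine Finset.aestronglyMeasurable_fun_sum _ fun i _ =>
    Finset.aestronglyMeasurable_fun_sum _ fun j _ => ?_
  exact ((hb i j).mul (aestronglyMeasurable_coord hf j)).smul_const _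

/-- Measurable matrix fields that are almost everywhere bounded by `M` as operators. -/
structure IsBddField (M : ℝ) (b : Space d → Mat d) : Prop where
  measurable : ∀ i j, Measurable fun y => b y i j
  bound : ∀ᵐ y, ∀ v, ‖(b y).op v‖ ≤ M * ‖v‖

theorem IsBddField.memLp {M : ℝ} {b : Space d → Mat d} (hb : IsBddField M b) {f : Space d → Space d}
    {μ : Measure (Space d)} (hμ : μ ≪ volume) (hf : MemLp f 2 μ) :
    MemLp (fun y => (b y).op (f y)) 2 μ := by
  refine hf.of_le_mul (c := M) (aestronglyMeasurable_op
    (fun i j => (hb.measurable i j).aestronglyMeasurable) hf.aestronglyMeasurable) ?_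
  filter_upwards [hμ.ae_le hb.bound] with y hy using hy _

/-- Multiplication of vector fields by a bounded matrix field. -/
def mulOp {M : ℝ} {b : Space d → Mat d} (hb : IsBddField M b) : L2 d →L[ℝ] L2 d :=
  LinearMap.mkContinuous
    { toFun := fun f => (hb.memLp Measure.AbsolutelyContinuous.rfl (Lp.memLp f)).toLp
      map_add' := fun f g => by
        rw [← MemLp.toLp_add, MemLp.toLp_eq_toLp_iff]
        filter_upwards [Lp.coeFn_add f g] with y hy
        rw [hy, Pi.add_apply, Pi.add_apply, map_add]
      map_smul' := fun c f => by
        rw [RingHom.id_apply, ← MemLp.toLp_const_smul, MemLp.toLp_eq_toLp_iff]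
        filter_upwards [Lp.coeFn_smul c f] with y hy
        rw [hy, Pi.smul_apply, Pi.smul_apply, map_smul] } M fun f => by
      refine Lp.norm_le_mul_norm_of_ae_le_mul ?_
      filter_upwards [hb.bound,
        (hb.memLp Measure.AbsolutelyContinuous.rfl (Lp.memLp f)).coeFn_toLp] with y hy h
      simp only [LinearMap.coe_mk, AddHom.coe_mk]
      rw [h]
      exact hy _

theorem coeFn_mulOp {M : ℝ} {b : Space d → Mat d} (hb : IsBddField M b) (f : L2 d) :
    mulOp hb f =ᵐ[volume] fun y => (b y).op (f y) :=
  (hb.memLp Measure.AbsolutelyContinuous.rfl (Lp.memLp f)).coeFn_toLp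

theorem norm_mulOp_le {M : ℝ} {b : Space d → Mat d} (hb : IsBddField M b) (f : L2 d) :
    ‖mulOp hb f‖ ≤ M * ‖f‖ := by
  refine Lp.norm_le_mul_norm_of_ae_le_mul ?_
  filter_upwards [hb.bound, coeFn_mulOp hb f] with y hy h
  rw [h]
  exact hy _

theorem Mat.norm_tr_le {M : Mat d} {c : ℝ} (hc : 0 ≤ c) (h : ∀ v, ‖M.op v‖ ≤ c * ‖v‖)
    (v : Space d) : ‖M.tr.op v‖ ≤ c * ‖v‖ := by
  by_cases h0 : M.tr.op v = 0
  · rw [h0, norm_zero]; positivity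
  have hpos : 0 < ‖M.tr.op v‖ := norm_pos_iff.mpr h0
  have h1 : ‖M.tr.op v‖ * ‖M.tr.op v‖ ≤ (c * ‖v‖) * ‖M.tr.op v‖ := by
    rw [← real_inner_self_eq_norm_mul_norm, ← Mat.inner_op_left]
    refine (real_inner_le_norm _ _).trans ?_
    calc _ ≤ c * ‖M.tr.op v‖ * ‖v‖ := by gcongr; exact h _
      _ = _ := by ring
  exact le_of_mul_le_mul_right h1 hpos

theorem IsBddField.tr {M : ℝ} {b : Space d → Mat d} (hb : IsBddField M b) (hM : 0 ≤ M) :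
    IsBddField M fun y => (b y).tr where
  measurable i j := hb.measurable j i
  bound := by
    filter_upwards [hb.bound] with y hy using Mat.norm_tr_le hM hy

theorem inner_mulOp {M : ℝ} {b : Space d → Mat d} (hb : IsBddField M b) (hM : 0 ≤ M) (f g : L2 d) :
    inner ℝ f (mulOp hb g) = inner ℝ (mulOp (hb.tr hM) f) g := by
  rw [L2.inner_def, L2.inner_def]
  refine integral_congr_ae ?_
  filter_upwards [coeFn_mulOp hb g, coeFn_mulOp (hb.tr hM) f] with y h1 h2
  rw [h1, h2, Mat.inner_op_left, Mat.tr, Mat.tr, Matrix.transpose_transpose]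

theorem coercive_mulOp {M α : ℝ} {b : Space d → Mat d} (hb : IsBddField M b)
    (he : ∀ᵐ y, ∀ v, α * ‖v‖ ^ 2 ≤ inner ℝ v ((b y).op v)) (f : L2 d) :
    α * ‖f‖ ^ 2 ≤ inner ℝ f (mulOp hb f) := by
  rw [← real_inner_self_eq_norm_sq f, L2.inner_def, L2.inner_def, ← integral_const_mul]
  refine integral_mono_ae ((L2.integrable_inner f f).const_mul α)
    (L2.integrable_inner f (mulOp hb f)) ?_
  filter_upwards [he, coeFn_mulOp hb f] with y h1 h2
  simp only [h2, real_inner_self_eq_norm_sq]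
  exact h1 _

/-! ### Restriction to a measurable set -/

/-- The matrix field equal to the identity on `D` and vanishing elsewhere. -/
def cutField (D : Set (Space d)) : Space d → Mat d := D.indicator fun _ => 1

theorem cutField_op (D : Set (Space d)) (y v : Space d) :
    (cutField D y).op v = D.indicator (fun _ => v) y := by
  by_cases h : y ∈ D
  · simp [cutField, h, Mat.op]
  · simp [cutField, h, Mat.op]

theorem isBddField_cut {D : Set (Space d)} (hD : MeasurableSet D) : IsBddField 1 (cutField D) where
  measurable i j := by
    have : (fun y => cutField D y i j) = D.indicator fun _ => (1 : Mat d) i j := by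
      funext y
      by_cases h : y ∈ D <;> simp [cutField, h]
    rw [this]
    exact measurable_const.indicator hD
  bound := Eventually.of_forall fun y v => by
    rw [cutField_op, one_mul]
    exact norm_indicator_le_norm_self (fun _ => v) y

/-- Restriction of vector fields to a measurable set. -/
def cut {D : Set (Space d)} (hD : MeasurableSet D) : L2 d →L[ℝ] L2 d := mulOp (isBddField_cut hD)

theorem coeFn_cut {D : Set (Space d)} (hD : MeasurableSet D) (f : L2 d) :
    cut hD f =ᵐ[volume] D.indicator f := by
  filter_upwards [coeFn_mulOp (isBddField_cut hD) f] with y hy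
  rw [cut, hy, cutField_op]
  by_cases h : y ∈ D <;> simp [h]

theorem norm_sq_eq_integral (f : L2 d) : ‖f‖ ^ 2 = ∫ y, ‖f y‖ ^ 2 := by
  rw [← real_inner_self_eq_norm_sq, L2.inner_def]
  simp_rw [real_inner_self_eq_norm_sq]

theorem norm_cut_sq {D : Set (Space d)} (hD : MeasurableSet D) (f : L2 d) :
    ‖cut hD f‖ ^ 2 = ∫ y in D, ‖f y‖ ^ 2 := by
  rw [norm_sq_eq_integral, ← integral_indicator hD]
  refine integral_congr_ae ?_
  filter_upwards [coeFn_cut hD f] with y hy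
  rw [hy]
  by_cases h : y ∈ D <;> simp [h]

theorem norm_cut_le {D : Set (Space d)} (hD : MeasurableSet D) (f : L2 d) : ‖cut hD f‖ ≤ ‖f‖ := by
  simpa [cut] using norm_mulOp_le (isBddField_cut hD) f

theorem inner_cut {D : Set (Space d)} (hD : MeasurableSet D) (f g : L2 d) :
    inner ℝ (cut hD f) g = inner ℝ f (cut hD g) := by
  rw [L2.inner_def, L2.inner_def]
  refine integral_congr_ae ?_
  filter_upwards [coeFn_cut hD f, coeFn_cut hD g] with y h1 h2
  rw [h1, h2]
  by_cases h : y ∈ D <;> simp [h]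

theorem norm_integrable_sq (f : L2 d) : Integrable fun y => ‖f y‖ ^ 2 := by
  have := L2.integrable_inner (𝕜 := ℝ) f f
  simpa [real_inner_self_eq_norm_sq] using this

/-! ### Closed spaces of gradients -/

/-- The closure in `L²` of the gradients of test functions in `D`. -/
def gradSpace (D : Set (Space d)) : Submodule ℝ (L2 d) :=
  (Submodule.span ℝ {g : L2 d | ∃ η, IsTest D η ∧ g =ᵐ[volume] gradient η}).topologicalClosure

theorem gradSpace_le {D : Set (Space d)} {K : Submodule ℝ (L2 d)} (hK : IsClosed (K : Set (L2 d)))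
    (h : ∀ (g : L2 d) (η : Space d → ℝ), IsTest D η → g =ᵐ[volume] gradient η → g ∈ K) :
    gradSpace D ≤ K := by
  refine Submodule.topologicalClosure_minimal _ ?_ hK
  rw [Submodule.span_le]
  rintro g ⟨η, hη, hg⟩
  exact h g η hη hg

theorem IsTest.gradient_continuous {D : Set (Space d)} {η : Space d → ℝ} (h : IsTest D η) :
    Continuous (gradient η) := by
  have : Continuous (fderiv ℝ η) := h.contDiff.continuous_fderiv (by simp)
  exact (InnerProductSpace.toDual ℝ (Space d)).symm.continuous.comp this

theorem IsTest.gradient_hasCompactSupport {D : Set (Space d)} {η : Space d → ℝ} (h : IsTest D η) :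
    HasCompactSupport (gradient η) := by
  refine (h.compact.fderiv ℝ).comp_left (g := (InnerProductSpace.toDual ℝ (Space d)).symm) (by simp)

theorem IsTest.memLp_gradient {D : Set (Space d)} {η : Space d → ℝ} (h : IsTest D η) (p : ℝ≥0∞) :
    MemLp (gradient η) p (volume : Measure (Space d)) :=
  h.gradient_continuous.memLp_of_hasCompactSupport h.gradient_hasCompactSupport

theorem IsTest.gradient_eq_zero {D : Set (Space d)} {η : Space d → ℝ} (h : IsTest D η)
    {y : Space d} (hy : y ∉ D) : gradient η y = 0 := by
  ext i
  rw [gradient_apply, (h.pd i).eq_zero hy]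
  rfl

/-- The gradient of a test function as an `L²` vector field. -/
def gradL2 {D : Set (Space d)} {η : Space d → ℝ} (h : IsTest D η) : L2 d := (h.memLp_gradient 2).toLp

theorem coeFn_gradL2 {D : Set (Space d)} {η : Space d → ℝ} (h : IsTest D η) :
    gradL2 h =ᵐ[volume] gradient η := (h.memLp_gradient 2).coeFn_toLp

theorem gradL2_mem {D : Set (Space d)} {η : Space d → ℝ} (h : IsTest D η) :
    gradL2 h ∈ gradSpace D :=
  Submodule.le_topologicalClosure _ (Submodule.subset_span ⟨η, h, coeFn_gradL2 h⟩)

theorem gradSpace_mono {D D' : Set (Space d)} (h : D ⊆ D') : gradSpace D ≤ gradSpace D' := by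
  refine gradSpace_le (Submodule.isClosed_topologicalClosure _) fun g η hη hg => ?_
  exact Submodule.le_topologicalClosure _ (Submodule.subset_span ⟨η, hη.mono h, hg⟩)

theorem inner_eq_zero_of_gradSpace {D : Set (Space d)} {F : L2 d}
    (h : ∀ η, IsTest D η → ∫ y, inner ℝ (gradient η y) (F y) = 0) {v : L2 d}
    (hv : v ∈ gradSpace D) : inner ℝ v F = 0 := by
  have : gradSpace D ≤ (ℝ ∙ F)ᗮ := by
    refine gradSpace_le (Submodule.isClosed_orthogonal _) fun g η hη hg => ?_
    rw [Submodule.mem_orthogonal_singleton_iff_inner_left, L2.inner_def, ← h η hη]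
    refine integral_congr_ae ?_
    filter_upwards [hg] with y hy
    rw [hy]
  exact Submodule.mem_orthogonal_singleton_iff_inner_left.mp (this hv)

theorem cut_gradSpace {D E : Set (Space d)} (hE : MeasurableSet E) (hDE : D ⊆ E) {v : L2 d}
    (hv : v ∈ gradSpace D) : cut hE v = v := by
  have : gradSpace D ≤ LinearMap.ker (cut hE - ContinuousLinearMap.id ℝ (L2 d)).toLinearMap := by
    refine gradSpace_le (ContinuousLinearMap.isClosed_ker _) fun g η hη hg => ?_
    rw [LinearMap.mem_ker]
    change cut hE g - g = 0
    rw [sub_eq_zero]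
    apply Lp.ext
    filter_upwards [coeFn_cut hE g, hg] with y h1 h2
    rw [h1]
    by_cases h : y ∈ E
    · simp [h]
    · rw [indicator_of_notMem h, h2, hη.gradient_eq_zero fun h' => h (hDE h')]
  have := this hv
  rw [LinearMap.mem_ker] at this
  exact sub_eq_zero.mp this

/-! ### Curl-free fields -/

/-- Weakly curl-free vector fields in `D`. -/
def IsCurlFree (D : Set (Space d)) (k : Space d → Space d) : Prop :=
  ∀ η, IsTest D η → ∀ i j, ∫ y, k y i * pd j η y = ∫ y, k y j * pd i η y

theorem IsCurlFree.mono {D D' : Set (Space d)} {k : Space d → Space d} (h : IsCurlFree D k)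
    (hD : D' ⊆ D) : IsCurlFree D' k := fun η hη => h η (hη.mono hD)

theorem IsTest.memLp {D : Set (Space d)} {η : Space d → ℝ} (h : IsTest D η) (p : ℝ≥0∞) :
    MemLp η p (volume : Measure (Space d)) :=
  h.continuous.memLp_of_hasCompactSupport h.compact

theorem IsTest.integrable_mul {D : Set (Space d)} {η : Space d → ℝ} (h : IsTest D η)
    {k : Space d → Space d} (hk : MemLp k 2) (i : Fin d) :
    Integrable fun y => k y i * η y :=
  (MemLp.integrable_mul (p := 2) (q := 2)
    ((EuclideanSpace.proj i : Space d →L[ℝ] ℝ).comp_memLp' hk) (h.memLp 2))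

theorem IsCurlFree.sub {D : Set (Space d)} {k l : L2 d} (hk : IsCurlFree D k)
    (hl : IsCurlFree D l) : IsCurlFree D (k - l : L2 d) := by
  intro η hη i j
  have h : ∀ i j, ∫ y, (k - l : L2 d) y i * pd j η y
      = (∫ y, k y i * pd j η y) - ∫ y, l y i * pd j η y := by
    intro i j
    rw [← integral_sub ((hη.pd j).integrable_mul (Lp.memLp k) i)
      ((hη.pd j).integrable_mul (Lp.memLp l) i)]
    refine integral_congr_ae ?_
    filter_upwards [Lp.coeFn_sub k l] with y hy
    rw [hy, Pi.sub_apply, PiLp.sub_apply]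
    ring
  rw [h, h, hk η hη i j, hl η hη i j]

theorem integral_pd_mul_pd {η ζ : Space d → ℝ} (hη : IsTest univ η) (hζ : IsTest univ ζ)
    (i j : Fin d) : ∫ y, pd i η y * pd j ζ y = ∫ y, pd j η y * pd i ζ y := by
  have key : ∀ i j, ∫ y, pd i η y * pd j ζ y = -∫ y, η y * pd i (pd j ζ) y := by
    intro i j
    have := integral_mul_fderiv_eq_neg_fderiv_mul_of_integrable (μ := (volume : Measure (Space d)))
      (f := η) (g := pd j ζ) (v := EuclideanSpace.single i (1 : ℝ)) ?_ ?_ ?_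
      (fun y _ => hη.contDiff.differentiable (by simp) y)
      (fun y _ => (hζ.pd j).contDiff.differentiable (by simp) y)
    · change ∫ y, η y * pd i (pd j ζ) y = -∫ y, pd i η y * pd j ζ y at this
      rw [this, neg_neg]
    · exact (MemLp.integrable_mul (p := 2) (q := 2) ((hη.pd i).memLp 2) ((hζ.pd j).memLp 2))
    · exact (MemLp.integrable_mul (p := 2) (q := 2) (hη.memLp 2) (((hζ.pd j).pd i).memLp 2))
    · exact (MemLp.integrable_mul (p := 2) (q := 2) (hη.memLp 2) ((hζ.pd j).memLp 2))
  rw [key, key]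
  simp_rw [pd_comm hζ.contDiff i j]

/-- The curl condition is orthogonality to ∂ⱼη eᵢ - ∂ᵢη eⱼ, a square-integrable field orthogonal to
gradients of test functions; orthogonality passes to the closure. -/
theorem isCurlFree_of_gradSpace {v : L2 d} (hv : v ∈ gradSpace univ) :
    IsCurlFree univ v := by
  intro η hη i j
  set F : Space d → Space d := fun y =>
    pd j η y • EuclideanSpace.single i (1 : ℝ) - pd i η y • EuclideanSpace.single j (1 : ℝ)
  have hF : MemLp F 2 := by
    refine MemLp.sub ?_ ?_
    · exact (ContinuousLinearMap.toSpanSingleton ℝ (EuclideanSpace.single i (1 : ℝ))).comp_memLp'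
        ((hη.pd j).memLp 2)
    · exact (ContinuousLinearMap.toSpanSingleton ℝ (EuclideanSpace.single j (1 : ℝ))).comp_memLp'
        ((hη.pd i).memLp 2)
  have hFin : ∀ (w : Space d) y, inner ℝ w (F y) = w i * pd j η y - w j * pd i η y := by
    intro w y
    simp only [F, inner_sub_right, inner_smul_right, EuclideanSpace.inner_single_right]
    simp
    ring
  have h1 : inner ℝ v (hF.toLp : L2 d) = 0 := by
    refine inner_eq_zero_of_gradSpace (D := univ) (fun ζ hζ => ?_) hv
    have : ∀ᵐ y, inner ℝ (gradient ζ y) ((hF.toLp : L2 d) y) = pd i ζ y * pd j η y - pd j ζ y * pd i η y := by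
      filter_upwards [hF.coeFn_toLp] with y hy
      rw [hy, hFin, gradient_apply, gradient_apply]
    rw [integral_congr_ae this, integral_sub, integral_pd_mul_pd hζ hη, sub_self]
    · exact (MemLp.integrable_mul (p := 2) (q := 2) ((hζ.pd i).memLp 2) ((hη.pd j).memLp 2))
    · exact (MemLp.integrable_mul (p := 2) (q := 2) ((hζ.pd j).memLp 2) ((hη.pd i).memLp 2))
  rw [L2.inner_def] at h1
  have : ∀ᵐ y, inner ℝ (v y) ((hF.toLp : L2 d) y) = v y i * pd j η y - v y j * pd i η y := by
    filter_upwards [hF.coeFn_toLp] with y hy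
    rw [hy, hFin]
  rw [integral_congr_ae this, integral_sub ((hη.pd j).integrable_mul (Lp.memLp v) i)
    ((hη.pd i).integrable_mul (Lp.memLp v) j), sub_eq_zero] at h1
  exact h1

/-! ### The Lax–Milgram theorem on a closed subspace -/

theorem exists_lax_milgram {H : Type*} [NormedAddCommGroup H] [InnerProductSpace ℝ H]
    [CompleteSpace H] (V : Submodule ℝ H) (hV : IsClosed (V : Set H)) (T : H →L[ℝ] H) {α : ℝ}
    (hα : 0 < α) (hT : ∀ x, α * ‖x‖ ^ 2 ≤ inner ℝ x (T x)) (F : H) :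
    ∃ w ∈ V, (∀ v ∈ V, inner ℝ v (T w + F) = 0) ∧ ‖w‖ ≤ ‖F‖ / α := by
  have : CompleteSpace V := hV.completeSpace_coe
  set B : V →L[ℝ] V →L[ℝ] ℝ := (innerSL ℝ).bilinearComp (T ∘L V.subtypeL) V.subtypeL
  have hB : ∀ w v : V, B w v = inner ℝ (T w) (v : H) := fun w v => rfl
  have hco : IsCoercive B := ⟨α, hα, fun u => by
    rw [hB, real_inner_comm]
    have := hT u
    rw [Submodule.coe_norm]
    nlinarith⟩
  set f : V := -V.orthogonalProjectionOnto F
  set w := hco.continuousLinearEquivOfBilin.symm f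
  have hw : ∀ v ∈ V, inner ℝ v (T w + F) = 0 := by
    intro v hv
    have h1 := hco.continuousLinearEquivOfBilin_apply w ⟨v, hv⟩
    rw [ContinuousLinearEquiv.apply_symm_apply, hB] at h1
    have h2 : inner ℝ (f : V) (⟨v, hv⟩ : V) = -inner ℝ F v := by
      simp only [f, inner_neg_left, Submodule.coe_inner]
      rw [Submodule.coe_orthogonalProjectionOnto_apply, Submodule.inner_starProjection_left_eq_right,
        Submodule.starProjection_eq_self_iff.mpr hv]
    rw [h2] at h1
    rw [inner_add_right, real_inner_comm, ← h1, real_inner_comm v F]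
    ring
  refine ⟨w, w.2, hw, ?_⟩
  have h1 := hw w w.2
  rw [inner_add_right] at h1
  have h2 := hT w
  have h3 : -inner ℝ (w : H) F ≤ ‖(w : H)‖ * ‖F‖ := by
    have := abs_real_inner_le_norm (w : H) F
    rw [abs_le] at this
    linarith
  rw [le_div_iff₀ hα]
  rcases (norm_nonneg (w : H)).eq_or_lt with h0 | h0
  · rw [← h0]; simp
  · refine le_of_mul_le_mul_left ?_ h0
    nlinarith

/-! ### Interior estimates for vector fields -/

theorem MemLp.coord {X : Type*} [MeasurableSpace X] {μ : Measure X} {k : X → Space d} (hk : MemLp k 2 μ) (i : Fin d) :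
    MemLp (fun y => k y i) 2 μ :=
  (EuclideanSpace.proj i : Space d →L[ℝ] ℝ).comp_memLp' hk

/-- Testing the equation with ∂ₖη and exchanging indices through the curl condition shows that each
component solves the same constant-coefficient equation, in the very weak form required by the mean
value property. -/
theorem harmonic_component {A : Mat d} {D : Set (Space d)} {h : L2 d} (hc : IsCurlFree D h)
    (hdiv : ∀ η, IsTest D η → ∫ y, inner ℝ (gradient η y) (A.op (h y)) = 0) (k : Fin d)
    {η : Space d → ℝ} (hη : IsTest D η) :
    ∫ z, h z k * ∑ i, ∑ j, A i j * pd i (pd j η) z = 0 := by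
  have hint : ∀ k i j, Integrable fun z => h z k * pd i (pd j η) z :=
    fun k i j => ((hη.pd j).pd i).integrable_mul (Lp.memLp h) k
  have h1 : ∫ z, h z k * ∑ i, ∑ j, A i j * pd i (pd j η) z
      = ∑ i, ∑ j, A i j * ∫ z, h z k * pd j (pd i η) z := by
    simp_rw [Finset.mul_sum]
    rw [integral_finsetSum]
    · refine Finset.sum_congr rfl fun i _ => ?_
      rw [integral_finsetSum]
      · refine Finset.sum_congr rfl fun j _ => ?_
        rw [← integral_const_mul]
        congr 1
        funext z
        rw [pd_comm hη.contDiff]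
        ring
      · intro j _
        refine ((hint k i j).const_mul (A i j)).congr (Eventually.of_forall fun z => ?_)
        ring
    · intro i _
      refine integrable_finsetSum _ fun j _ => ?_
      refine ((hint k i j).const_mul (A i j)).congr (Eventually.of_forall fun z => ?_)
      ring
  have h2 := hdiv _ (hη.pd k)
  have h3 : ∫ y, inner ℝ (gradient (pd k η) y) (A.op (h y))
      = ∑ i, ∑ j, A i j * ∫ z, h z j * pd k (pd i η) z := by
    have : ∀ y, inner ℝ (gradient (pd k η) y) (A.op (h y))
        = ∑ i, ∑ j, A i j * (h y j * pd k (pd i η) y) := by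
      intro y
      simp only [PiLp.inner_apply, RCLike.inner_apply, conj_trivial, gradient_apply, Mat.op_apply,
        Finset.sum_mul]
      refine Finset.sum_congr rfl fun i _ => Finset.sum_congr rfl fun j _ => ?_
      rw [pd_comm hη.contDiff i k]
      ring
    simp_rw [this]
    rw [integral_finsetSum _ fun i _ => integrable_finsetSum _ fun j _ =>
      (hint j k i).const_mul (A i j)]
    refine Finset.sum_congr rfl fun i _ => ?_
    rw [integral_finsetSum _ fun j _ => (hint j k i).const_mul (A i j)]
    refine Finset.sum_congr rfl fun j _ => ?_
    rw [integral_const_mul]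
  rw [h1, ← h2, h3]
  refine Finset.sum_congr rfl fun i _ => Finset.sum_congr rfl fun j _ => ?_
  rw [hc _ (hη.pd i) k j]

theorem exists_interior_bound_vec (d : ℕ) {α β : ℝ} (hα : 0 < α) (hβ : 0 < β) :
    ∃ C : ℝ, 0 < C ∧ ∀ A : Mat d, IsElliptic α β A → ∀ (c : Space d) (ρ : ℝ), 0 < ρ →
      ∀ h : L2 d, IsCurlFree (Metric.ball c ρ) h →
      (∀ η, IsTest (Metric.ball c ρ) η → ∫ y, inner ℝ (gradient η y) (A.op (h y)) = 0) →
      ∀ᵐ x, x ∈ Metric.ball c (ρ / 2) →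
        ‖h x‖ ^ 2 ≤ C * (ρ ^ d)⁻¹ * ‖cut (measurableSet_ball (x := c) (ε := ρ)) h‖ ^ 2 := by
  obtain ⟨C, hC, hmain⟩ := exists_interior_bound d hα hβ
  refine ⟨C, hC, fun A hA c ρ hρ h hc hdiv => ?_⟩
  have h1 : ∀ k : Fin d, ∀ᵐ x, x ∈ Metric.ball c (ρ / 2) →
      h x k ^ 2 ≤ C * (ρ ^ d)⁻¹ * ∫ z in Metric.ball c ρ, h z k ^ 2 := fun k =>
    hmain A hA c ρ hρ (fun z => h z k) (MemLp.coord (Lp.memLp h) k)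
      fun η hη => harmonic_component hc hdiv k hη
  filter_upwards [ae_all_iff.mpr h1] with x hx hxb
  rw [norm_cut_sq]
  simp_rw [EuclideanSpace.norm_sq_eq, Real.norm_eq_abs, sq_abs]
  rw [integral_finsetSum _ fun k _ => ((MemLp.coord (Lp.memLp h) k).integrable_sq).integrableOn,
    Finset.mul_sum]
  exact Finset.sum_le_sum fun k _ => hx k hxb

/-- The source of every factor ρ^{-d} in the proof. The requirement ρ ≥ 2 puts the unit ball inside
the half ball where the pointwise bound holds. -/
theorem exists_ball_bound (d : ℕ) {α β : ℝ} (hα : 0 < α) (hβ : 0 < β) :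
    ∃ C : ℝ, 0 < C ∧ ∀ A : Mat d, IsElliptic α β A → ∀ (c : Space d) (ρ : ℝ), 2 ≤ ρ →
      ∀ h : L2 d, IsCurlFree (Metric.ball c ρ) h →
      (∀ η, IsTest (Metric.ball c ρ) η → ∫ y, inner ℝ (gradient η y) (A.op (h y)) = 0) →
        ‖cut (measurableSet_ball (x := c) (ε := 1)) h‖ ^ 2 ≤
          C * (ρ ^ d)⁻¹ * ‖cut (measurableSet_ball (x := c) (ε := ρ)) h‖ ^ 2 := by
  obtain ⟨C, hC, hmain⟩ := exists_interior_bound_vec d hα hβ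
  set ω := (volume : Measure (Space d)).real (Metric.ball 0 1)
  have hω : 0 < ω := ENNReal.toReal_pos (Metric.measure_ball_pos volume _ one_pos).ne'
    measure_ball_lt_top.ne
  refine ⟨ω * C, by positivity, fun A hA c ρ hρ h hc hdiv => ?_⟩
  have h1 := hmain A hA c ρ (by linarith) h hc hdiv
  rw [norm_cut_sq]
  set K := C * (ρ ^ d)⁻¹ * ‖cut (measurableSet_ball (x := c) (ε := ρ)) h‖ ^ 2
  have hvol : (volume : Measure (Space d)).real (Metric.ball c 1) = ω := by
    rw [measureReal_def, Measure.addHaar_ball_center]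
    rfl
  have h2 : ∫ y in Metric.ball c 1, ‖h y‖ ^ 2 ≤ ∫ y in Metric.ball c 1, K := by
    refine setIntegral_mono_ae_restrict (norm_integrable_sq h).integrableOn
      (integrableOn_const measure_ball_lt_top.ne) ?_
    refine (ae_restrict_iff' measurableSet_ball).mpr ?_
    filter_upwards [h1] with x hx hxb
    exact hx (Metric.ball_subset_ball (by linarith) hxb)
  rw [setIntegral_const, hvol, smul_eq_mul] at h2
  exact h2.trans (le_of_eq (by ring))

/-- A field that is globally square integrable, curl-free and divergence-free vanishes. -/
theorem eq_zero_of_curlFree_divFree {α β : ℝ} (hd : 1 ≤ d) (hα : 0 < α) (hβ : 0 < β) {A : Mat d}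
    (hA : IsElliptic α β A) {h : L2 d} (hc : IsCurlFree univ h)
    (hdiv : ∀ η, IsTest univ η → ∫ y, inner ℝ (gradient η y) (A.op (h y)) = 0) : h = 0 := by
  obtain ⟨C, hC, hmain⟩ := exists_interior_bound_vec d hα hβ
  -- On balls of radius n + 1 the interior bound is (n + 1)^{-d} times the fixed global norm, which
  -- tends to zero because d ≥ 1.
  have h1 : ∀ n : ℕ, ∀ᵐ x, x ∈ Metric.ball (0 : Space d) ((n + 1 : ℝ) / 2) →
      ‖h x‖ ^ 2 ≤ C * ((n + 1 : ℝ) ^ d)⁻¹ * ‖h‖ ^ 2 := by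
    intro n
    filter_upwards [hmain A hA 0 (n + 1) (by positivity) h (hc.mono (subset_univ _))
      fun η hη => hdiv η (hη.mono (subset_univ _))] with x hx hxb
    refine (hx hxb).trans ?_
    gcongr
    exact norm_cut_le _ _
  rw [Lp.eq_zero_iff_ae_eq_zero]
  filter_upwards [ae_all_iff.mpr h1] with x hx
  have hlim : Tendsto (fun n : ℕ => C * ((n + 1 : ℝ) ^ d)⁻¹ * ‖h‖ ^ 2) atTop (𝓝 0) := by
    have h3 : Tendsto (fun n : ℕ => ((n + 1 : ℝ) ^ d)) atTop atTop :=
      (tendsto_pow_atTop (by omega)).comp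
        (tendsto_atTop_add_const_right _ _ tendsto_natCast_atTop_atTop)
    have := (h3.inv_tendsto_atTop.const_mul C).mul_const (‖h‖ ^ 2)
    simpa using this
  have h4 : ‖h x‖ ^ 2 ≤ 0 := by
    refine ge_of_tendsto hlim ?_
    obtain ⟨N, hN⟩ := exists_nat_gt (2 * ‖x‖)
    filter_upwards [eventually_ge_atTop N] with n hn
    refine hx n ?_
    rw [mem_ball_zero_iff]
    have : (N : ℝ) ≤ n := by exact_mod_cast hn
    linarith
  have : ‖h x‖ = 0 := by nlinarith [norm_nonneg (h x)]
  exact norm_eq_zero.mp this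

/-- Constant matrix fields. -/
theorem IsElliptic.isBddField {α β : ℝ} {A : Mat d} (hA : IsElliptic α β A) :
    IsBddField β fun _ => A where
  measurable _ _ := measurable_const
  bound := Eventually.of_forall fun _ v => (hA v).2

/-- Subtract from G the gradient w that solves the A-equation with source G. The remainder is
curl-free, A-divergence-free and square integrable, hence zero by Liouville. This places solutions
given by weak gradients in the closed space used for Lax–Milgram. -/
theorem curlFree_mem_gradSpace {α β : ℝ} (hd : 1 ≤ d) (hα : 0 < α) (hβ : 0 < β) {A : Mat d}
    (hA : IsElliptic α β A) {G : L2 d} (hG : IsCurlFree univ G) : G ∈ gradSpace univ := by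
  obtain ⟨w, hw, hwe, -⟩ := exists_lax_milgram (gradSpace (univ : Set (Space d)))
    (Submodule.isClosed_topologicalClosure _) (mulOp hA.isBddField) hα
    (coercive_mulOp _ (Eventually.of_forall fun _ v => (hA v).1)) (-mulOp hA.isBddField G)
  have h0 : G - w = 0 := by
    refine eq_zero_of_curlFree_divFree hd hα hβ hA (hG.sub (isCurlFree_of_gradSpace hw))
      fun η hη => ?_
    have h1 := hwe _ (gradL2_mem hη)
    rw [← sub_eq_add_neg, ← map_sub, ← neg_sub G w, map_neg, inner_neg_right, neg_eq_zero,
      L2.inner_def] at h1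
    rw [← h1]
    refine integral_congr_ae ?_
    filter_upwards [coeFn_gradL2 hη, coeFn_mulOp hA.isBddField (G - w)] with y h2 h3
    rw [h2, h3]
  rw [sub_eq_zero] at h0
  rw [h0]
  exact hw

/-! ### Local perturbations of a constant matrix -/

/-- A matrix field `m` supported in `S` such that `A₁ + m` is coercive. -/
structure IsPert (α β : ℝ) (A₁ : Mat d) (S : Set (Space d)) (m : Space d → Mat d) : Prop where
  bdd : IsBddField (2 * β) m
  coercive : ∀ᵐ y, ∀ v, α * ‖v‖ ^ 2 ≤ inner ℝ v (A₁.op v + (m y).op v)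
  zero : ∀ y ∉ S, m y = 0

theorem Mat.sub_op (M N : Mat d) (v : Space d) : (M - N).op v = M.op v - N.op v := by
  simp [Mat.op]

theorem Mat.add_op (M N : Mat d) (v : Space d) : (M + N).op v = M.op v + N.op v := by
  simp [Mat.op]

theorem Mat.zero_op (v : Space d) : (0 : Mat d).op v = 0 := by simp [Mat.op]

theorem IsPert.tr {α β : ℝ} {A₁ : Mat d} {S : Set (Space d)} {m : Space d → Mat d}
    (h : IsPert α β A₁ S m) (hβ : 0 ≤ β) : IsPert α β A₁.tr S fun y => (m y).tr where
  bdd := h.bdd.tr (by positivity)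
  coercive := by
    filter_upwards [h.coercive] with y hy v
    rw [inner_add_right, ← Mat.inner_op_left, ← Mat.inner_op_left, ← inner_add_left,
      real_inner_comm]
    exact hy v
  zero y hy := by rw [h.zero y hy, Mat.tr, Matrix.transpose_zero]

theorem isPert_indicator {α β : ℝ} {A₁ : Mat d} (hA : IsElliptic α β A₁) {S : Set (Space d)}
    (hS : MeasurableSet S) {b : Space d → Mat d} (hb : ∀ i j, Measurable fun y => b y i j)
    (hbe : ∀ᵐ y, IsElliptic α β (b y)) : IsPert α β A₁ S (S.indicator fun y => b y - A₁) where
  bdd :=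
    { measurable := fun i j => by
        have : (fun y => S.indicator (fun y => b y - A₁) y i j)
            = S.indicator fun y => b y i j - A₁ i j := by
          funext y
          by_cases h : y ∈ S <;> simp [h]
        rw [this]
        exact ((hb i j).sub_const _).indicator hS
      bound := by
        filter_upwards [hbe] with y hy v
        by_cases h : y ∈ S
        · rw [indicator_of_mem h, Mat.sub_op]
          refine (norm_sub_le _ _).trans ?_
          have h1 := (hy v).2
          have h2 := (hA v).2
          linarith
        · rw [indicator_of_notMem h, Mat.zero_op]
          have h2 := (norm_nonneg _).trans (hA v).2
          simp only [norm_zero]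
          linarith }
  coercive := by
    filter_upwards [hbe] with y hy v
    by_cases h : y ∈ S
    · rw [indicator_of_mem h, Mat.sub_op]
      simpa using (hy v).1
    · rw [indicator_of_notMem h, Mat.zero_op]
      simpa using (hA v).1
  zero y hy := indicator_of_notMem hy _

/-- The constant field `e` on the unit ball around `c`, extended by zero. -/
def constBall (c e : Space d) : L2 d :=
  indicatorConstLp 2 (measurableSet_ball (x := c) (ε := 1)) measure_ball_lt_top.ne e

/-- The volume of the unit ball. -/
def ballVol (d : ℕ) : ℝ := (volume : Measure (Space d)).real (Metric.ball 0 1)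

theorem ballVol_pos : 0 < ballVol d :=
  ENNReal.toReal_pos (Metric.measure_ball_pos volume _ one_pos).ne' measure_ball_lt_top.ne

theorem volume_real_ball (c : Space d) :
    (volume : Measure (Space d)).real (Metric.ball c 1) = ballVol d := by
  rw [measureReal_def, Measure.addHaar_ball_center]
  rfl

theorem norm_constBall (c e : Space d) : ‖constBall c e‖ = Real.sqrt (ballVol d) * ‖e‖ := by
  rw [constBall, norm_indicatorConstLp (by norm_num) (by norm_num), volume_real_ball,
    Real.sqrt_eq_rpow, mul_comm]
  norm_num

section Operators

variable {α β : ℝ} {A₁ : Mat d} {S : Set (Space d)} {m : Space d → Mat d}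

/-- The operator `f ↦ (A₁ + m) f`. -/
def pertOp (hA : IsElliptic α β A₁) (hm : IsPert α β A₁ S m) : L2 d →L[ℝ] L2 d :=
  mulOp hA.isBddField + mulOp hm.bdd

theorem coercive_pertOp (hA : IsElliptic α β A₁) (hm : IsPert α β A₁ S m) (f : L2 d) :
    α * ‖f‖ ^ 2 ≤ inner ℝ f (pertOp hA hm f) := by
  rw [← real_inner_self_eq_norm_sq f, L2.inner_def, L2.inner_def, ← integral_const_mul]
  refine integral_mono_ae ((L2.integrable_inner f f).const_mul α)
    (L2.integrable_inner f (pertOp hA hm f)) ?_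
  filter_upwards [hm.coercive, coeFn_mulOp hA.isBddField f, coeFn_mulOp hm.bdd f,
    Lp.coeFn_add (mulOp hA.isBddField f) (mulOp hm.bdd f)] with y h1 h2 h3 h4
  rw [pertOp, add_apply, h4, Pi.add_apply, h2, h3, real_inner_self_eq_norm_sq]
  exact h1 _

theorem inner_pertOp (hA : IsElliptic α β A₁) (hm : IsPert α β A₁ S m) (hβ : 0 ≤ β) (f g : L2 d) :
    inner ℝ f (pertOp hA hm g) = inner ℝ (pertOp (hA.transpose hβ) (hm.tr hβ) f) g := by
  rw [pertOp, pertOp, add_apply, add_apply, inner_add_right, inner_add_left,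
    inner_mulOp _ hβ, inner_mulOp _ (by positivity)]

theorem cut_mulOp {M : ℝ} {b : Space d → Mat d} (hb : IsBddField M b) {D : Set (Space d)}
    (hD : MeasurableSet D) (f : L2 d) : cut hD (mulOp hb f) = mulOp hb (cut hD f) := by
  apply Lp.ext
  filter_upwards [coeFn_cut hD (mulOp hb f), coeFn_mulOp hb (cut hD f), coeFn_cut hD f,
    coeFn_mulOp hb f] with y h1 h2 h3 h4
  rw [h1, h2, h3]
  by_cases h : y ∈ D <;> simp [h, h4]

theorem cut_mulOp_pert (hm : IsPert α β A₁ S m) {D : Set (Space d)}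
    (hD : MeasurableSet D) (hSD : S ⊆ D) (f : L2 d) : cut hD (mulOp hm.bdd f) = mulOp hm.bdd f := by
  apply Lp.ext
  filter_upwards [coeFn_cut hD (mulOp hm.bdd f), coeFn_mulOp hm.bdd f] with y h1 h2
  rw [h1]
  by_cases h : y ∈ D
  · rw [indicator_of_mem h]
  · rw [indicator_of_notMem h, h2, hm.zero y fun h' => h (hSD h'), Mat.zero_op]

/-- The residual `A₁ H + m (H + e)` of a field `H` for the equation `∇ · (A₁ + m)(H + e) = 0`. -/
def residual (hA : IsElliptic α β A₁) (hm : IsPert α β A₁ S m) (c e : Space d) (H : L2 d) : L2 d :=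
  pertOp hA hm H + mulOp hm.bdd (constBall c e)

theorem residual_sub (hA : IsElliptic α β A₁) (hm : IsPert α β A₁ S m) (c e : Space d)
    (H G : L2 d) : residual hA hm c e H - residual hA hm c e G = pertOp hA hm (H - G) := by
  rw [residual, residual, map_sub]
  abel

/-- `H` solves the Dirichlet problem for `∇ · (A₁ + m)(H + e) = 0` in `D`. -/
structure IsLocalSol (hA : IsElliptic α β A₁) (hm : IsPert α β A₁ S m) (D : Set (Space d))
    (c e : Space d) (H : L2 d) : Prop where
  mem : H ∈ gradSpace D
  eq_zero : ∀ v ∈ gradSpace D, inner ℝ v (residual hA hm c e H) = 0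

theorem exists_localSol (hα : 0 < α) (hA : IsElliptic α β A₁) (hm : IsPert α β A₁ S m)
    (D : Set (Space d)) (c e : Space d) : ∃ H, IsLocalSol hA hm D c e H := by
  obtain ⟨w, hw, hwe, -⟩ := exists_lax_milgram (gradSpace D)
    (Submodule.isClosed_topologicalClosure _) (pertOp hA hm) hα (coercive_pertOp hA hm)
    (mulOp hm.bdd (constBall c e))
  exact ⟨w, hw, hwe⟩

/-- The source m e is confined to the unit ball, so the energy bound does not depend on the domain
D. -/
theorem IsLocalSol.norm_le (hα : 0 < α) (hβ : 0 < β) {hA : IsElliptic α β A₁}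
    {hm : IsPert α β A₁ S m} {D : Set (Space d)} {c e : Space d} {H : L2 d}
    (h : IsLocalSol hA hm D c e H) : ‖H‖ ≤ 2 * β / α * Real.sqrt (ballVol d) * ‖e‖ := by
  have h1 := h.eq_zero H h.mem
  rw [residual, inner_add_right] at h1
  have h2 := coercive_pertOp hA hm H
  have h3 := abs_real_inner_le_norm H (mulOp hm.bdd (constBall c e))
  have h4 := norm_mulOp_le hm.bdd (constBall c e)
  rw [norm_constBall] at h4
  rw [abs_le] at h3
  have h5 : ‖H‖ * ‖mulOp hm.bdd (constBall c e)‖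
      ≤ ‖H‖ * (2 * β * (Real.sqrt (ballVol d) * ‖e‖)) := by gcongr
  have h6 : α * ‖H‖ ≤ 2 * β * (Real.sqrt (ballVol d) * ‖e‖) := by
    rcases (norm_nonneg H).eq_or_lt with h0 | h0
    · rw [← h0]; simp; positivity
    · refine le_of_mul_le_mul_left ?_ h0
      nlinarith
  have : 2 * β / α * Real.sqrt (ballVol d) * ‖e‖ = 2 * β * (Real.sqrt (ballVol d) * ‖e‖) / α := by
    ring
  rw [this, le_div_iff₀ hα]
  linarith

/-- The residual omits A₁ e, whose divergence is zero, and is therefore supported in D. This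
locality makes residuals of disjoint balls decouple. -/
theorem cut_residual (hA : IsElliptic α β A₁) (hm : IsPert α β A₁ S m) {D : Set (Space d)}
    (hD : MeasurableSet D) (hSD : S ⊆ D) (c e : Space d) {H : L2 d} (hH : H ∈ gradSpace D) :
    cut hD (residual hA hm c e H) = residual hA hm c e H := by
  rw [residual, pertOp, add_apply, map_add, map_add, cut_mulOp, cut_gradSpace hD subset_rfl hH,
    cut_mulOp_pert hm hD hSD, cut_mulOp_pert hm hD hSD]

theorem cut_cut {D : Set (Space d)} (hD : MeasurableSet D) (f : L2 d) :
    cut hD (cut hD f) = cut hD f := by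
  apply Lp.ext
  filter_upwards [coeFn_cut hD (cut hD f), coeFn_cut hD f] with y h1 h2
  rw [h1]
  by_cases h : y ∈ D <;> simp [h, h2]

theorem IsCurlFree.congr_on {D : Set (Space d)} {k l : Space d → Space d} (hk : IsCurlFree D k)
    (h : ∀ᵐ y, y ∈ D → l y = k y) : IsCurlFree D l := by
  intro η hη i j
  have h1 : ∀ i j, ∫ y, l y i * pd j η y = ∫ y, k y i * pd j η y := by
    intro i j
    refine integral_congr_ae ?_
    filter_upwards [h] with y hy
    by_cases hD : y ∈ D
    · rw [hy hD]
    · rw [(hη.pd j).eq_zero hD, mul_zero, mul_zero]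
  rw [h1, h1, hk η hη i j]

end Operators

/-- The residual of a Dirichlet solution in a ball of radius `ρ` is small of order `ρ^{-d/2}` as a
functional on curl-free fields. -/
theorem exists_residual_bound (d : ℕ) {α β : ℝ} (hα : 0 < α) (hβ : 0 < β) :
    ∃ C : ℝ, 0 < C ∧ ∀ (A₁ : Mat d) (hA : IsElliptic α β A₁) (c : Space d)
      (m : Space d → Mat d) (hm : IsPert α β A₁ (Metric.ball c 1) m) (ρ : ℝ) (_ : 2 ≤ ρ)
      (e : Space d) (H : L2 d), IsLocalSol hA hm (Metric.ball c ρ) c e H →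
      ∀ k : L2 d, IsCurlFree (Metric.ball c ρ) k →
        |inner ℝ k (residual hA hm c e H)| ≤
          C * Real.sqrt (ρ ^ d)⁻¹ * ‖cut (measurableSet_ball (x := c) (ε := ρ)) k‖ * ‖e‖ := by
  obtain ⟨C, hC, hmain⟩ := exists_ball_bound d hα hβ
  set σ := Real.sqrt (ballVol d)
  refine ⟨Real.sqrt C * (1 + β / α) * (2 * β * (2 * β / α * σ + σ)), ?_,
    fun A₁ hA c m hm ρ hρ e H hH k hk => ?_⟩
  · have : 0 < σ := Real.sqrt_pos.mpr ballVol_pos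
    positivity
  set D := Metric.ball c ρ
  have hD : MeasurableSet D := measurableSet_ball
  have hB : MeasurableSet (Metric.ball c 1) := measurableSet_ball
  have hBD : Metric.ball c 1 ⊆ D := Metric.ball_subset_ball (by linarith)
  set k' := cut hD k
  have hAt := hA.transpose hβ.le
  -- Split the restricted field as k' = h + w, with w a gradient vanishing at the boundary of the
  -- ball and h a solution of the A₁ᵗ-equation inside it.
  obtain ⟨w, hw, hwe, hwn⟩ := exists_lax_milgram (gradSpace D)
    (Submodule.isClosed_topologicalClosure _) (mulOp hAt.isBddField) hα
    (coercive_mulOp _ (Eventually.of_forall fun _ v => (hAt v).1)) (-mulOp hAt.isBddField k')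
  set h := k' - w
  have hwh : ∀ v ∈ gradSpace D, inner ℝ v (mulOp hAt.isBddField h) = 0 := by
    intro v hv
    have := hwe v hv
    rw [← sub_eq_add_neg, ← map_sub, ← neg_sub k' w, map_neg, inner_neg_right, neg_eq_zero] at this
    exact this
  have hk' : IsCurlFree D k' := by
    refine hk.congr_on ?_
    filter_upwards [coeFn_cut hD k] with y hy hyD
    rw [hy, indicator_of_mem hyD]
  have hhc : IsCurlFree D h :=
    hk'.sub ((isCurlFree_of_gradSpace (gradSpace_mono (subset_univ D) hw)).mono (subset_univ D))
  have hhd : ∀ η, IsTest D η → ∫ y, inner ℝ (gradient η y) (A₁.tr.op (h y)) = 0 := by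
    intro η hη
    rw [← hwh _ (gradL2_mem hη), L2.inner_def]
    refine integral_congr_ae ?_
    filter_upwards [coeFn_gradL2 hη, coeFn_mulOp hAt.isBddField h] with y h1 h2
    rw [h1, h2]
  have hball := hmain A₁.tr hAt c ρ hρ h hhc hhd
  have hhn : ‖h‖ ≤ (1 + β / α) * ‖k'‖ := by
    have h1 := norm_mulOp_le hAt.isBddField k'
    rw [norm_neg] at hwn
    calc ‖h‖ ≤ ‖k'‖ + ‖w‖ := norm_sub_le _ _
      _ ≤ ‖k'‖ + β * ‖k'‖ / α := by
        gcongr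
        exact hwn.trans (by gcongr)
      _ = _ := by ring
  have hBn : ‖cut hB h‖ ≤ Real.sqrt C * Real.sqrt (ρ ^ d)⁻¹ * ((1 + β / α) * ‖k'‖) := by
    have h1 : ‖cut hB h‖ ^ 2 ≤ C * (ρ ^ d)⁻¹ * ‖h‖ ^ 2 := by
      refine hball.trans ?_
      gcongr
      exact norm_cut_le _ _
    have h2 : ‖cut hB h‖ ≤ Real.sqrt (C * (ρ ^ d)⁻¹) * ‖h‖ := by
      refine le_of_sq_le_sq ?_ (by positivity)
      rw [mul_pow, Real.sq_sqrt (by positivity)]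
      exact h1
    rw [Real.sqrt_mul hC.le] at h2
    exact h2.trans (by gcongr)
  set r := residual hA hm c e H
  -- The residual lives in D, and the Dirichlet equation annihilates w.
  have h1 : inner ℝ k r = inner ℝ h r := by
    have e1 : inner ℝ k r = inner ℝ k' r := by
      rw [inner_cut, cut_residual hA hm hD hBD c e hH.mem]
    rw [e1, show k' = h + w by simp [h], inner_add_left, hH.eq_zero w hw, add_zero]
  -- The A₁ part disappears since h solves the transposed equation and H is admissible as a test
  -- field. Only m(H + e) remains, which sees h in the unit ball, where it is of size ρ^{-d/2}.
  have h2 : inner ℝ h r = inner ℝ (cut hB h) (mulOp hm.bdd (H + constBall c e)) := by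
    have e1 : inner ℝ h (mulOp hA.isBddField H) = 0 := by
      rw [inner_mulOp _ hβ.le, real_inner_comm]
      exact hwh H hH.mem
    rw [inner_cut, cut_mulOp_pert hm hB subset_rfl]
    simp only [r, residual, pertOp, add_apply, inner_add_right, map_add, e1]
    ring
  rw [h1, h2]
  have h3 : ‖mulOp hm.bdd (H + constBall c e)‖ ≤ 2 * β * (2 * β / α * σ + σ) * ‖e‖ := by
    refine (norm_mulOp_le _ _).trans ?_
    have := norm_add_le H (constBall c e)
    rw [norm_constBall] at this
    have h4 := hH.norm_le hα hβ
    calc 2 * β * ‖H + constBall c e‖ ≤ 2 * β * (2 * β / α * σ * ‖e‖ + σ * ‖e‖) := by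
          gcongr
          exact this.trans (by gcongr)
      _ = _ := by ring
  calc _ ≤ ‖cut hB h‖ * ‖mulOp hm.bdd (H + constBall c e)‖ := abs_real_inner_le_norm _ _
    _ ≤ (Real.sqrt C * Real.sqrt (ρ ^ d)⁻¹ * ((1 + β / α) * ‖k'‖)) *
        (2 * β * (2 * β / α * σ + σ) * ‖e‖) := by gcongr
    _ = _ := by ring

/-- Comparison of the Dirichlet solution in a ball of radius `ρ` with the whole-space solution. -/
theorem exists_comparison (d : ℕ) {α β : ℝ} (hα : 0 < α) (hβ : 0 < β) :
    ∃ C : ℝ, 0 < C ∧ ∀ (A₁ : Mat d) (hA : IsElliptic α β A₁) (c : Space d)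
      (m : Space d → Mat d) (hm : IsPert α β A₁ (Metric.ball c 1) m) (ρ : ℝ) (_ : 2 ≤ ρ)
      (e e' : Space d) (H G : L2 d), IsLocalSol hA hm (Metric.ball c ρ) c e H →
      IsLocalSol hA hm univ c e G →
        |inner ℝ (constBall c e') (mulOp hm.bdd (H - G))| ≤ C * (ρ ^ d)⁻¹ * ‖e‖ * ‖e'‖ := by
  obtain ⟨C, hC, hmain⟩ := exists_residual_bound d hα hβ
  refine ⟨C * (C / α), by positivity, fun A₁ hA c m hm ρ hρ e e' H G hH hG => ?_⟩
  set D := Metric.ball c ρ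
  have hD : MeasurableSet D := measurableSet_ball
  have hHu : H ∈ gradSpace univ := gradSpace_mono (subset_univ D) hH.mem
  have hcf : IsCurlFree D (H - G : L2 d) :=
    (isCurlFree_of_gradSpace (Submodule.sub_mem _ hHu hG.mem)).mono (subset_univ D)
  set s := Real.sqrt (ρ ^ d)⁻¹
  have hs : s * s = (ρ ^ d)⁻¹ := Real.mul_self_sqrt (by positivity)
  have h1 : ‖H - G‖ ≤ C / α * s * ‖e‖ := by
    -- The residual of G vanishes on all gradients, so H - G is controlled by the residual of H
    -- alone: this gives the first factor ρ^{-d/2}.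
    have h2 := coercive_pertOp hA hm (H - G)
    rw [← residual_sub hA hm c e, inner_sub_right,
      hG.eq_zero _ (Submodule.sub_mem _ hHu hG.mem), sub_zero] at h2
    have h3 := (le_abs_self _).trans (hmain A₁ hA c m hm ρ hρ e H hH (H - G) hcf)
    have h4 : C * s * ‖cut hD (H - G)‖ * ‖e‖ ≤ C * s * ‖H - G‖ * ‖e‖ := by
      gcongr
      exact norm_cut_le _ _
    have h5 : α * ‖H - G‖ ≤ C * s * ‖e‖ := by
      rcases (norm_nonneg (H - G)).eq_or_lt with h0 | h0
      · rw [← h0]; simp; positivity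
      · refine le_of_mul_le_mul_left ?_ h0
        nlinarith
    have : C / α * s * ‖e‖ = C * s * ‖e‖ / α := by ring
    rw [this, le_div_iff₀ hα]
    linarith
  have hAt := hA.transpose hβ.le
  have hmt := hm.tr hβ.le
  -- The Dirichlet solution of the transposed problem with datum e' rewrites the quantity as the
  -- residual of K tested with H - G, which supplies the second factor ρ^{-d/2}.
  obtain ⟨K, hK⟩ := exists_localSol hα hAt hmt D c e'
  have h2 := hmain A₁.tr hAt c _ hmt ρ hρ e' K hK (H - G) hcf
  have h3 : inner ℝ (H - G) (residual hAt hmt c e' K)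
      = inner ℝ (constBall c e') (mulOp hm.bdd (H - G)) := by
    have e1 : inner ℝ (H - G) (pertOp hAt hmt K) = 0 := by
      rw [real_inner_comm, ← inner_pertOp hA hm hβ.le, ← residual_sub hA hm c e, inner_sub_right,
        hH.eq_zero K hK.mem, hG.eq_zero K (gradSpace_mono (subset_univ D) hK.mem), sub_zero]
    rw [residual, inner_add_right, e1, zero_add, real_inner_comm,
      inner_mulOp hm.bdd (by positivity)]
  rw [h3] at h2
  refine h2.trans ?_
  calc C * s * ‖cut hD (H - G)‖ * ‖e'‖ ≤ C * s * (C / α * s * ‖e‖) * ‖e'‖ := by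
        gcongr
        exact (norm_cut_le _ _).trans h1
    _ = C * (C / α) * (s * s) * ‖e‖ * ‖e'‖ := by ring
    _ = _ := by rw [hs]

/-! ### Restrictions to disjoint sets -/

theorem cut_union {D E : Set (Space d)} (hD : MeasurableSet D) (hE : MeasurableSet E)
    (h : Disjoint D E) (f : L2 d) : cut (hD.union hE) f = cut hD f + cut hE f := by
  apply Lp.ext
  filter_upwards [coeFn_cut (hD.union hE) f, coeFn_cut hD f, coeFn_cut hE f,
    Lp.coeFn_add (cut hD f) (cut hE f)] with y h1 h2 h3 h4
  rw [h1, h4, Pi.add_apply, h2, h3, indicator_union_of_disjoint h]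

theorem cut_congr {D E : Set (Space d)} (hD : MeasurableSet D) (hE : MeasurableSet E)
    (h : D = E) : cut hD = cut hE := by
  subst h
  rfl

theorem cut_biUnion {ι : Type*} [DecidableEq ι] (s : Finset ι) {B : ι → Set (Space d)}
    (hB : ∀ x, MeasurableSet (B x)) (hd : (s : Set ι).PairwiseDisjoint B)
    (h : MeasurableSet (⋃ x ∈ s, B x)) (f : L2 d) : cut h f = ∑ x ∈ s, cut (hB x) f := by
  induction s using Finset.induction_on with
  | empty =>
    apply Lp.ext
    filter_upwards [coeFn_cut h f, Lp.coeFn_zero (Space d) 2 (volume : Measure (Space d))]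
      with y h1 h2
    rw [h1, Finset.sum_empty, h2]
    simp
  | insert a s ha ih =>
    have hm : MeasurableSet (⋃ x ∈ s, B x) := Finset.measurableSet_biUnion _ fun x _ => hB x
    have hdis : Disjoint (B a) (⋃ x ∈ s, B x) := by
      rw [disjoint_iUnion₂_right]
      intro x hx
      exact hd (by simp) (by simp [hx]) (by rintro rfl; exact ha hx)
    have h1 : (⋃ x ∈ insert a s, B x) = B a ∪ ⋃ x ∈ s, B x := by simp
    rw [cut_congr h ((hB a).union hm) h1, cut_union _ _ hdis, Finset.sum_insert ha,
      ih (hd.subset (by simp)) hm]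
    exact hm

theorem inner_eq_zero_of_disjoint {D E : Set (Space d)} (hD : MeasurableSet D)
    (hE : MeasurableSet E) (h : Disjoint D E) {f g : L2 d} (hf : cut hD f = f) (hg : cut hE g = g) :
    inner ℝ f g = 0 := by
  rw [← hf, ← hg, L2.inner_def]
  rw [integral_congr_ae (g := fun _ => 0)]
  · simp
  · filter_upwards [coeFn_cut hD f, coeFn_cut hE g] with y h1 h2
    rw [h1, h2]
    by_cases hy : y ∈ D
    · rw [indicator_of_notMem (disjoint_left.mp h hy), inner_zero_right]
    · rw [indicator_of_notMem hy, inner_zero_left]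

theorem sum_norm_cut_sq_le {ι : Type*} (s : Finset ι) {B : ι → Set (Space d)}
    (hB : ∀ x, MeasurableSet (B x)) (hd : (s : Set ι).PairwiseDisjoint B) (f : L2 d) :
    ∑ x ∈ s, ‖cut (hB x) f‖ ^ 2 ≤ ‖f‖ ^ 2 := by
  simp_rw [norm_cut_sq]
  rw [← integral_biUnion_finset s (fun x _ => hB x) hd
    fun x _ => (norm_integrable_sq f).integrableOn, norm_sq_eq_integral]
  exact setIntegral_le_integral (norm_integrable_sq f) (Eventually.of_forall fun _ => sq_nonneg _)

/-- The constant field `e` on `Q`, extended by zero. -/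
def constOn {Q : Set (Space d)} (hQ : MeasurableSet Q) (hQv : volume Q ≠ ∞) (e : Space d) : L2 d :=
  indicatorConstLp 2 hQ hQv e

theorem coeFn_constOn {Q : Set (Space d)} (hQ : MeasurableSet Q) (hQv : volume Q ≠ ∞)
    (e : Space d) : constOn hQ hQv e =ᵐ[volume] Q.indicator fun _ => e := indicatorConstLp_coeFn

theorem coeFn_constBall (c e : Space d) :
    constBall c e =ᵐ[volume] (Metric.ball c 1).indicator fun _ => e := indicatorConstLp_coeFn

theorem integral_gradient_inner {D : Set (Space d)} {η : Space d → ℝ} (h : IsTest D η)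
    (v : Space d) : ∫ y, inner ℝ (gradient η y) v = 0 := by
  simp_rw [inner_gradient_left]
  have hc : Continuous fun y => fderiv ℝ η y v :=
    (h.contDiff.continuous_fderiv (by simp)).clm_apply continuous_const
  have hs : HasCompactSupport fun y => fderiv ℝ η y v :=
    (h.compact.fderiv ℝ).comp_left (g := fun L : Space d →L[ℝ] ℝ => L v) (by simp)
  have := integral_mul_fderiv_eq_neg_fderiv_mul_of_integrable (μ := (volume : Measure (Space d)))
    (f := fun _ => (1 : ℝ)) (g := η) (v := v) (by simp)
    (by simpa using hc.integrable_of_hasCompactSupport hs)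
    (by simpa using h.continuous.integrable_of_hasCompactSupport h.compact)
    (fun y _ => differentiableAt_const _)
    (fun y _ => h.contDiff.differentiable (by simp) y)
  simpa using this

theorem inner_constOn_eq_zero {Q : Set (Space d)} (hQ : MeasurableSet Q) (hQv : volume Q ≠ ∞)
    {M : ℝ} {A : Mat d} (hA : IsBddField M fun _ => A) (e : Space d) {v : L2 d}
    (hv : v ∈ gradSpace Q) : inner ℝ v (mulOp hA (constOn hQ hQv e)) = 0 := by
  refine inner_eq_zero_of_gradSpace (fun η hη => ?_) hv
  rw [← integral_gradient_inner hη (A.op e)]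
  refine integral_congr_ae ?_
  filter_upwards [coeFn_mulOp hA (constOn hQ hQv e), coeFn_constOn hQ hQv e] with y h1 h2
  rw [h1, h2]
  by_cases h : y ∈ Q
  · rw [indicator_of_mem h]
  · rw [hη.gradient_eq_zero h, inner_zero_left, inner_zero_left]

theorem norm_cut_constOn_sq {Q Z : Set (Space d)} (hQ : MeasurableSet Q) (hQv : volume Q ≠ ∞)
    (hZ : MeasurableSet Z) (hZQ : Z ⊆ Q) (e : Space d) :
    ‖cut hZ (constOn hQ hQv e)‖ ^ 2 = volume.real Z * ‖e‖ ^ 2 := by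
  rw [norm_cut_sq]
  have : ∀ᵐ y, y ∈ Z → ‖constOn hQ hQv e y‖ ^ 2 = ‖e‖ ^ 2 := by
    filter_upwards [coeFn_constOn hQ hQv e] with y hy hyZ
    rw [hy, indicator_of_mem (hZQ hyZ)]
  rw [setIntegral_congr_ae hZ this, setIntegral_const, smul_eq_mul]

/-! ### The ansatz built from well-separated inclusions. -/

section Decomposition

variable {α β : ℝ} {A₁ : Mat d} {S Q Z : Set (Space d)} {m : Space d → Mat d}
  {mx : Space d → Space d → Mat d}

/-- A finite family of well-separated inclusions in a domain `Q`; the remaining inclusions in `Q`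
are in `Z`. -/
structure IsGoodFamily (S Q Z : Set (Space d)) (s : Finset (Space d)) (ρ : Space d → ℝ) : Prop where
  radius : ∀ x ∈ s, 2 ≤ ρ x
  subset : ∀ x ∈ s, Metric.ball x (ρ x) ⊆ Q
  disjoint : (s : Set (Space d)).PairwiseDisjoint fun x => Metric.ball x (ρ x)
  inter : ∀ x ∈ s, S ∩ Metric.ball x (ρ x) = Metric.ball x 1
  rest : Z = (S ∩ Q) \ ⋃ x ∈ s, Metric.ball x 1

theorem IsGoodFamily.ball_subset {s : Finset (Space d)} {ρ : Space d → ℝ}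
    (h : IsGoodFamily S Q Z s ρ) {x : Space d} (hx : x ∈ s) :
    Metric.ball x 1 ⊆ Metric.ball x (ρ x) :=
  Metric.ball_subset_ball (by linarith [h.radius x hx])

theorem IsGoodFamily.disjoint_rest {s : Finset (Space d)} {ρ : Space d → ℝ}
    (h : IsGoodFamily S Q Z s ρ) {x : Space d} (hx : x ∈ s) :
    Disjoint Z (Metric.ball x (ρ x)) := by
  rw [disjoint_left]
  intro y hy hyx
  rw [h.rest] at hy
  have : y ∈ Metric.ball x 1 := by
    rw [← h.inter x hx]
    exact ⟨hy.1.1, hyx⟩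
  exact hy.2 (mem_iUnion₂.mpr ⟨x, hx, this⟩)

theorem mulOp_eq_mulOp {M M' : ℝ} {b b' : Space d → Mat d} (hb : IsBddField M b)
    (hb' : IsBddField M' b') {f g : L2 d} (h : ∀ᵐ y, (b y).op (f y) = (b' y).op (g y)) :
    mulOp hb f = mulOp hb' g := by
  apply Lp.ext
  filter_upwards [h, coeFn_mulOp hb f, coeFn_mulOp hb' g] with y h1 h2 h3
  rw [h2, h3, h1]

theorem mulOp_constOn_eq_constBall (hmx : ∀ x, IsPert α β A₁ (Metric.ball x 1) (mx x))
    (hQ : MeasurableSet Q) (hQv : volume Q ≠ ∞) {x : Space d} (hx : Metric.ball x 1 ⊆ Q)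
    (e : Space d) : mulOp (hmx x).bdd (constOn hQ hQv e) = mulOp (hmx x).bdd (constBall x e) := by
  refine mulOp_eq_mulOp _ _ ?_
  filter_upwards [coeFn_constOn hQ hQv e, coeFn_constBall x e] with y h1 h2
  rw [h1, h2]
  by_cases h : y ∈ Metric.ball x 1
  · rw [indicator_of_mem h, indicator_of_mem (hx h)]
  · rw [(hmx x).zero y h, Mat.zero_op, Mat.zero_op]

/-- Each H x vanishes outside its own ball, where x is the only inclusion, so the fields do not
interact. The first term is divergence-free in Q, and the deviation from an exact solution consists
of the single-inclusion residuals and the uncorrected inclusions in Z. -/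
theorem pertOp_sum_add (hA : IsElliptic α β A₁) (hm : IsPert α β A₁ S m)
    (hmx : ∀ x, IsPert α β A₁ (Metric.ball x 1) (mx x))
    {s : Finset (Space d)} {ρ : Space d → ℝ} (hg : IsGoodFamily S Q Z s ρ)
    (hmm : ∀ x ∈ s, ∀ y ∈ Metric.ball x 1, mx x y = m y)
    (hQ : MeasurableSet Q) (hQv : volume Q ≠ ∞) (hZ : MeasurableSet Z) (e : Space d)
    {H : Space d → L2 d} (hH : ∀ x ∈ s, H x ∈ gradSpace (Metric.ball x (ρ x))) :
    pertOp hA hm (∑ x ∈ s, H x + constOn hQ hQv e) =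
      mulOp hA.isBddField (constOn hQ hQv e) + ∑ x ∈ s, residual hA (hmx x) x e (H x) +
        mulOp hm.bdd (cut hZ (constOn hQ hQv e)) := by
  classical
  set E := constOn hQ hQv e
  set O : Set (Space d) := ⋃ x ∈ s, Metric.ball x 1
  have hO : MeasurableSet O := Finset.measurableSet_biUnion _ fun x _ => measurableSet_ball
  have h1 : ∀ x ∈ s, mulOp hm.bdd (H x) = mulOp (hmx x).bdd (H x) := by
    intro x hx
    refine mulOp_eq_mulOp _ _ ?_
    have hcut := cut_gradSpace measurableSet_ball subset_rfl (hH x hx)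
    have h2 := coeFn_cut (measurableSet_ball (x := x) (ε := ρ x)) (H x)
    rw [hcut] at h2
    filter_upwards [h2] with y hy
    by_cases hyb : y ∈ Metric.ball x 1
    · rw [hmm x hx y hyb]
    · by_cases hyr : y ∈ Metric.ball x (ρ x)
      · have : y ∉ S := fun hS => hyb (by rw [← hg.inter x hx]; exact ⟨hS, hyr⟩)
        rw [hm.zero y this, (hmx x).zero y hyb]
      · rw [hy, indicator_of_notMem hyr, map_zero, map_zero]
  -- Within Q the perturbation is supported in the disjoint union of the good inclusions and Z, and
  -- outside Q the constant field vanishes.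
  have h2 : mulOp hm.bdd E = mulOp hm.bdd (cut hO E) + mulOp hm.bdd (cut hZ E) := by
    have hdis : Disjoint O Z := by
      rw [hg.rest]
      exact disjoint_sdiff_right
    rw [← map_add, ← cut_union hO hZ hdis]
    refine mulOp_eq_mulOp _ _ ?_
    filter_upwards [coeFn_cut (hO.union hZ) E, coeFn_constOn hQ hQv e] with y hy hyE
    rw [hy]
    by_cases h : y ∈ O ∪ Z
    · rw [indicator_of_mem h]
    · rw [indicator_of_notMem h]
      by_cases hS : y ∈ S
      · have hyQ : y ∉ Q := by
          intro hyQ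
          refine h (or_iff_not_imp_left.mpr fun hO' => ?_)
          rw [hg.rest]
          exact ⟨⟨hS, hyQ⟩, hO'⟩
        rw [hyE, indicator_of_notMem hyQ]
      · rw [hm.zero y hS, Mat.zero_op, Mat.zero_op]
  have h3 : mulOp hm.bdd (cut hO E) = ∑ x ∈ s, mulOp (hmx x).bdd (constBall x e) := by
    rw [cut_biUnion s (fun x => measurableSet_ball (x := x) (ε := 1)) ?_ hO, map_sum]
    · refine Finset.sum_congr rfl fun x hx => mulOp_eq_mulOp _ _ ?_
      filter_upwards [coeFn_cut (measurableSet_ball (x := x) (ε := 1)) E, coeFn_constBall x e,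
        coeFn_constOn hQ hQv e] with y h1 h2 h3
      rw [h1, h2]
      by_cases h : y ∈ Metric.ball x 1
      · rw [indicator_of_mem h, indicator_of_mem h, h3,
          indicator_of_mem (hg.subset x hx (hg.ball_subset hx h)), hmm x hx y h]
      · rw [indicator_of_notMem h, indicator_of_notMem h, map_zero, map_zero]
    · exact hg.disjoint.mono_on fun x hx => hg.ball_subset hx
  simp only [pertOp, residual, add_apply, map_add, map_sum, Finset.sum_add_distrib]
  rw [h2, h3, Finset.sum_congr rfl h1]
  abel

end Decomposition

/-! ### The deterministic error estimate -/

/-- Cauchy–Schwarz over x, combined with disjointness of the balls, which bounds the sum of the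
local energies of W by its total energy. -/
theorem IsGoodFamily.abs_sum_inner_residual_le {α β : ℝ} {A₁ : Mat d} {S Q Z : Set (Space d)}
    {mx : Space d → Space d → Mat d} {C : ℝ} (hC : 0 ≤ C)
    (hA : IsElliptic α β A₁) (hmx : ∀ x, IsPert α β A₁ (Metric.ball x 1) (mx x))
    {s : Finset (Space d)} {ρ : Space d → ℝ} (hg : IsGoodFamily S Q Z s ρ) {e : Space d}
    (he : ‖e‖ ≤ 1) {H : Space d → L2 d} {W : L2 d}
    (hb : ∀ x ∈ s, |inner ℝ W (residual hA (hmx x) x e (H x))| ≤ C * Real.sqrt (ρ x ^ d)⁻¹ *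
      ‖cut (measurableSet_ball (x := x) (ε := ρ x)) W‖ * ‖e‖) :
    |∑ x ∈ s, inner ℝ W (residual hA (hmx x) x e (H x))| ≤
      C * Real.sqrt (∑ x ∈ s, (ρ x ^ d)⁻¹) * ‖W‖ := by
  have hpos : ∀ x ∈ s, 0 ≤ (ρ x ^ d)⁻¹ := by
    intro x hx
    have := hg.radius x hx
    positivity
  calc |∑ x ∈ s, inner ℝ W (residual hA (hmx x) x e (H x))|
      ≤ ∑ x ∈ s, |inner ℝ W (residual hA (hmx x) x e (H x))| := Finset.abs_sum_le_sum_abs _ _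
    _ ≤ ∑ x ∈ s, C * (Real.sqrt (ρ x ^ d)⁻¹ *
          ‖cut (measurableSet_ball (x := x) (ε := ρ x)) W‖) := by
        refine Finset.sum_le_sum fun x hx => (hb x hx).trans ?_
        rw [mul_assoc C]
        exact mul_le_of_le_one_right (by positivity) he
    _ = C * ∑ x ∈ s, Real.sqrt (ρ x ^ d)⁻¹ *
          ‖cut (measurableSet_ball (x := x) (ε := ρ x)) W‖ := by rw [Finset.mul_sum]
    _ ≤ C * (Real.sqrt (∑ x ∈ s, (ρ x ^ d)⁻¹) * ‖W‖) := by
        gcongr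
        refine le_of_sq_le_sq ?_ (by positivity)
        refine (Finset.sum_mul_sq_le_sq_mul_sq _ _ _).trans ?_
        rw [mul_pow, Real.sq_sqrt (Finset.sum_nonneg hpos)]
        refine mul_le_mul (le_of_eq (Finset.sum_congr rfl fun x hx => Real.sq_sqrt (hpos x hx)))
          (sum_norm_cut_sq_le s (fun x => measurableSet_ball (x := x) (ε := ρ x)) hg.disjoint W)
          (Finset.sum_nonneg fun _ _ => sq_nonneg _) (Finset.sum_nonneg hpos)
    _ = _ := by ring

/-- The error of the first-order expansion in a bounded domain, for a fixed configuration. -/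
theorem exists_error_bound (d : ℕ) {α β : ℝ} (hα : 0 < α) (hβ : 0 < β) :
    ∃ C C₂ : ℝ, 0 < C ∧ 0 < C₂ ∧ ∀ (A₁ : Mat d) (hA : IsElliptic α β A₁) (S Q Z : Set (Space d))
      (m : Space d → Mat d) (hm : IsPert α β A₁ S m) (mx : Space d → Space d → Mat d)
      (hmx : ∀ x, IsPert α β A₁ (Metric.ball x 1) (mx x)) (hQ : MeasurableSet Q)
      (hQv : volume Q ≠ ∞) (_ : MeasurableSet Z) (s : Finset (Space d)) (ρ : Space d → ℝ),
      IsGoodFamily S Q Z s ρ → (∀ x ∈ s, ∀ y ∈ Metric.ball x 1, mx x y = m y) →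
      ∀ (e e' : Space d), ‖e‖ ≤ 1 → ‖e'‖ ≤ 1 → ∀ U : L2 d, IsCurlFree Q U →
      (∀ v ∈ gradSpace Q, inner ℝ v (pertOp hA hm (U + constOn hQ hQv e)) = 0) →
      ∀ G : Space d → L2 d, (∀ x ∈ s, IsLocalSol hA (hmx x) univ x e (G x)) →
      |inner ℝ (constOn hQ hQv e') (pertOp hA hm (U + constOn hQ hQv e))
        - inner ℝ (constOn hQ hQv e') (mulOp hA.isBddField (U + constOn hQ hQv e))
        - ∑ x ∈ s, inner ℝ (constBall x e') (mulOp (hmx x).bdd (G x + constBall x e))| ≤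
      C * (∑ x ∈ s, (ρ x ^ d)⁻¹ + volume.real Z)
        + C₂ * (inner ℝ U (pertOp hA hm (U + constOn hQ hQv e))
          - inner ℝ U (mulOp hA.isBddField (constOn hQ hQv e))) := by
  obtain ⟨C, hC, hres⟩ := exists_residual_bound d hα hβ
  obtain ⟨C', hC', hcomp⟩ := exists_comparison d hα hβ
  set K := C + 2 * β
  have hK : 0 < K := by positivity
  refine ⟨K + K ^ 2 / α ^ 2 * K + C' + 2 * β, 2 * K / α, by positivity, by positivity, ?_⟩
  intro A₁ hA S Q Z m hm mx hmx hQ hQv hZ s ρ hg hmm e e' he he' U hU hdiv G hG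
  have hAt := hA.transpose hβ.le
  have hmt := hm.tr hβ.le
  have hmxt := fun x => (hmx x).tr hβ.le
  choose H hH using fun x => exists_localSol hα hA (hmx x) (Metric.ball x (ρ x)) x e
  -- Dual ansatz: Dirichlet solutions with transposed coefficients, in the same balls, for the
  -- direction e' in which the flux is measured.
  choose J hJ using fun x => exists_localSol hα hAt (hmxt x) (Metric.ball x (ρ x)) x e'
  have hHQ : ∀ x ∈ s, H x ∈ gradSpace Q := fun x hx => gradSpace_mono (hg.subset x hx) (hH x).mem
  have hJQ : ∀ x ∈ s, J x ∈ gradSpace Q := fun x hx => gradSpace_mono (hg.subset x hx) (hJ x).mem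
  set E := constOn hQ hQv e
  set E' := constOn hQ hQv e'
  set Φ := ∑ x ∈ s, H x
  set Ψ := ∑ x ∈ s, J x
  have hΦ : Φ ∈ gradSpace Q := Submodule.sum_mem _ hHQ
  have hΨ : Ψ ∈ gradSpace Q := Submodule.sum_mem _ hJQ
  set W := U - Φ with hW
  have hWc : ∀ x ∈ s, IsCurlFree (Metric.ball x (ρ x)) W := fun x hx =>
    (hU.mono (hg.subset x hx)).sub ((isCurlFree_of_gradSpace
      (gradSpace_mono (subset_univ Q) hΦ)).mono (subset_univ _))
  have hpos : ∀ x ∈ s, 0 ≤ (ρ x ^ d)⁻¹ := by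
    intro x hx
    have := hg.radius x hx
    positivity
  set N := ∑ x ∈ s, (ρ x ^ d)⁻¹
  have hN : 0 ≤ N := Finset.sum_nonneg hpos
  set z := volume.real Z
  have hz : 0 ≤ z := measureReal_nonneg
  have hZQ : Z ⊆ Q := by
    rw [hg.rest]
    exact sdiff_subset.trans inter_subset_right
  -- Up to constants, ε is the size of all the residuals as functionals of W; the final error is of
  -- order ε².
  set ε := Real.sqrt (N + z)
  have hε : ε ^ 2 = N + z := Real.sq_sqrt (by positivity)
  have hε0 : 0 ≤ ε := Real.sqrt_nonneg _
  have hNε : Real.sqrt N ≤ ε := Real.sqrt_le_sqrt (by linarith)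
  have hcutE : ∀ f : Space d, ‖f‖ ≤ 1 → ‖cut hZ (constOn hQ hQv f)‖ ≤ ε := by
    intro f hf
    refine le_of_sq_le_sq ?_ hε0
    rw [norm_cut_constOn_sq hQ hQv hZ hZQ, hε]
    have : ‖f‖ ^ 2 ≤ 1 := pow_le_one₀ (norm_nonneg _) hf
    nlinarith
  -- Since U need not belong to `gradSpace Q`, it cannot be used as a test field. T records what is
  -- left; it need not be small for one realization but has mean zero.
  set T := inner ℝ U (pertOp hA hm (U + E)) - inner ℝ U (mulOp hA.isBddField E)
  -- the energy estimate
  have hE1 : |∑ x ∈ s, inner ℝ W (residual hA (hmx x) x e (H x))| ≤ C * ε * ‖W‖ := by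
    refine (hg.abs_sum_inner_residual_le hC.le hA hmx he fun x hx =>
      hres A₁ hA x (mx x) (hmx x) (ρ x) (hg.radius x hx) e (H x) (hH x) W (hWc x hx)).trans ?_
    gcongr
  have hE2 : |∑ x ∈ s, inner ℝ W (residual hAt (hmxt x) x e' (J x))| ≤ C * ε * ‖W‖ := by
    refine (hg.abs_sum_inner_residual_le hC.le hAt hmxt he' fun x hx =>
      hres A₁.tr hAt x _ (hmxt x) (ρ x) (hg.radius x hx) e' (J x) (hJ x) W (hWc x hx)).trans ?_
    gcongr
  have hE3 : |inner ℝ W (mulOp hm.bdd (cut hZ E))| ≤ 2 * β * ε * ‖W‖ := by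
    refine (abs_real_inner_le_norm _ _).trans ?_
    have := (norm_mulOp_le hm.bdd (cut hZ E)).trans
      (mul_le_mul_of_nonneg_left (hcutE e he) (by positivity))
    calc _ ≤ ‖W‖ * (2 * β * ε) := by gcongr
      _ = _ := by ring
  have hE4 : |inner ℝ W (mulOp hmt.bdd (cut hZ E'))| ≤ 2 * β * ε * ‖W‖ := by
    refine (abs_real_inner_le_norm _ _).trans ?_
    have := (norm_mulOp_le hmt.bdd (cut hZ E')).trans
      (mul_le_mul_of_nonneg_left (hcutE e' he') (by positivity))
    calc _ ≤ ‖W‖ * (2 * β * ε) := by gcongr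
      _ = _ := by ring
  -- Coercivity at W, with the flux of W written as the flux of U + E minus that of Φ + E. The field
  -- Φ is admissible, so only U contributes to T.
  have henergy : α * ‖W‖ ^ 2 ≤ T + K * ε * ‖W‖ := by
    have h1 := coercive_pertOp hA hm W
    have h2 : pertOp hA hm W = pertOp hA hm (U + E) - pertOp hA hm (Φ + E) := by
      rw [← map_sub, hW]
      congr 1
      abel
    have h3 : inner ℝ W (pertOp hA hm (U + E)) = inner ℝ U (pertOp hA hm (U + E)) := by
      rw [hW, inner_sub_left, hdiv Φ hΦ, sub_zero]
    have h4 : inner ℝ W (mulOp hA.isBddField E) = inner ℝ U (mulOp hA.isBddField E) := by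
      rw [hW, inner_sub_left, inner_constOn_eq_zero hQ hQv hA.isBddField e hΦ, sub_zero]
    rw [h2, inner_sub_right, h3, pertOp_sum_add hA hm hmx hg hmm hQ hQv hZ e fun x _ => (hH x).mem,
      inner_add_right, inner_add_right, inner_sum, h4] at h1
    rw [abs_le] at hE1 hE3
    simp only [K]
    have : T = inner ℝ U (pertOp hA hm (U + E)) - inner ℝ U (mulOp hA.isBddField E) := rfl
    linarith [hE1.1, hE3.1]
  -- the dual representation of the flux
  have hmid : inner ℝ E' (pertOp hA hm (U + E)) =
      inner ℝ E' (mulOp hA.isBddField (U + E)) +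
      ∑ x ∈ s, inner ℝ (residual hAt (hmxt x) x e' (J x)) (U + E) +
      inner ℝ (mulOp hmt.bdd (cut hZ E')) (U + E) := by
    have h1 : inner ℝ E' (pertOp hA hm (U + E)) = inner ℝ (Ψ + E') (pertOp hA hm (U + E)) := by
      rw [inner_add_left, hdiv Ψ hΨ, zero_add]
    have hmmt : ∀ x ∈ s, ∀ y ∈ Metric.ball x 1, (mx x y).tr = (m y).tr := fun x hx y hy => by
      rw [hmm x hx y hy]
    rw [h1, inner_pertOp hA hm hβ.le,
      pertOp_sum_add hAt hmt hmxt hg hmmt hQ hQv hZ e' fun x _ => (hJ x).mem,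
      inner_add_left, inner_add_left, sum_inner, inner_mulOp hA.isBddField hβ.le]
  -- On the diagonal this is the dual equation tested with H x; off the diagonal the supports are
  -- disjoint. Hence U may be replaced by W in front of the dual residuals.
  have hoff : ∀ x ∈ s, ∀ y ∈ s, inner ℝ (residual hAt (hmxt x) x e' (J x)) (H y) = 0 := by
    intro x hx y hy
    by_cases hxy : x = y
    · subst hxy
      rw [real_inner_comm]
      exact (hJ x).eq_zero _ (hH x).mem
    · exact inner_eq_zero_of_disjoint measurableSet_ball measurableSet_ball
        (hg.disjoint hx hy hxy)
        (cut_residual hAt (hmxt x) measurableSet_ball (hg.ball_subset hx) x e' (hJ x).mem)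
        (cut_gradSpace measurableSet_ball subset_rfl (hH y).mem)
  have hresU : ∀ x ∈ s, inner ℝ (residual hAt (hmxt x) x e' (J x)) U
      = inner ℝ W (residual hAt (hmxt x) x e' (J x)) := by
    intro x hx
    rw [real_inner_comm _ W, hW, inner_sub_right, inner_sum, Finset.sum_eq_zero (hoff x hx), sub_zero]
  -- Reciprocity: testing the equation of H x with J x and that of J x with H x exchanges the two
  -- sources and turns the dual quantity into the polarization computed with H x.
  have hresE : ∀ x ∈ s, inner ℝ (residual hAt (hmxt x) x e' (J x)) E
      = inner ℝ (constBall x e') (mulOp (hmx x).bdd (H x + constBall x e)) := by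
    intro x hx
    have hb := mulOp_constOn_eq_constBall hmx hQ hQv
      ((hg.ball_subset hx).trans (hg.subset x hx)) e
    have h1 : inner ℝ (pertOp hAt (hmxt x) (J x)) E
        = inner ℝ (J x) (mulOp (hmx x).bdd (constBall x e)) := by
      rw [← inner_pertOp hA (hmx x) hβ.le, pertOp, add_apply, inner_add_right,
        inner_constOn_eq_zero hQ hQv hA.isBddField e (hJQ x hx), zero_add, hb]
    have h2 := (hH x).eq_zero (J x) (hJ x).mem
    have h3 := (hJ x).eq_zero (H x) (hH x).mem
    rw [residual, inner_add_right] at h2 h3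
    rw [inner_pertOp hA (hmx x) hβ.le, real_inner_comm] at h2
    have h4 : ∀ f, inner ℝ (constBall x e') (mulOp (hmx x).bdd f)
        = inner ℝ f (mulOp (hmxt x).bdd (constBall x e')) := fun f => by
      rw [inner_mulOp (hmx x).bdd (by positivity), real_inner_comm]
    have h5 : inner ℝ (mulOp (hmxt x).bdd (constBall x e')) E
        = inner ℝ (constBall x e') (mulOp (hmx x).bdd (constBall x e)) := by
      rw [← hb, h4, real_inner_comm]
    rw [residual, inner_add_left, h1, h5, map_add, inner_add_right, h4 (H x)]
    linarith
  have hZU : inner ℝ (mulOp hmt.bdd (cut hZ E')) U = inner ℝ W (mulOp hmt.bdd (cut hZ E')) := by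
    have h1 : ∀ x ∈ s, inner ℝ (mulOp hmt.bdd (cut hZ E')) (H x) = 0 := fun x hx =>
      inner_eq_zero_of_disjoint hZ measurableSet_ball (hg.disjoint_rest hx)
        (by rw [cut_mulOp, cut_cut]) (cut_gradSpace measurableSet_ball subset_rfl (hH x).mem)
    rw [real_inner_comm _ W, hW, inner_sub_right, inner_sum, Finset.sum_eq_zero h1, sub_zero]
  have hZE : |inner ℝ (mulOp hmt.bdd (cut hZ E')) E| ≤ 2 * β * (N + z) := by
    have h1 : inner ℝ (mulOp hmt.bdd (cut hZ E')) E
        = inner ℝ (mulOp hmt.bdd (cut hZ E')) (cut hZ E) := by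
      rw [← inner_cut, cut_mulOp, cut_cut]
    rw [h1, ← hε]
    refine (abs_real_inner_le_norm _ _).trans ?_
    have h2 := (norm_mulOp_le hmt.bdd (cut hZ E')).trans
      (mul_le_mul_of_nonneg_left (hcutE e' he') (by positivity))
    calc _ ≤ (2 * β * ε) * ε := by
          gcongr
          exact hcutE e he
      _ = _ := by ring
  have hcmp : |∑ x ∈ s, inner ℝ (constBall x e') (mulOp (hmx x).bdd (H x - G x))| ≤ C' * N := by
    refine (Finset.abs_sum_le_sum_abs _ _).trans ?_
    rw [Finset.mul_sum]
    refine Finset.sum_le_sum fun x hx => ?_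
    have := hpos x hx
    refine (hcomp A₁ hA x (mx x) (hmx x) (ρ x) (hg.radius x hx) e e' (H x) (G x) (hH x)
      (hG x hx)).trans ?_
    calc C' * (ρ x ^ d)⁻¹ * ‖e‖ * ‖e'‖ ≤ C' * (ρ x ^ d)⁻¹ * 1 * 1 := by gcongr
      _ = _ := by ring
  -- Every remaining term is of second order: W, itself controlled by ε and T, against a functional
  -- of size ε; or the truncation error of H against G; or a product over Z.
  have hfinal : inner ℝ E' (pertOp hA hm (U + E)) - inner ℝ E' (mulOp hA.isBddField (U + E))
      - ∑ x ∈ s, inner ℝ (constBall x e') (mulOp (hmx x).bdd (G x + constBall x e)) =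
      ∑ x ∈ s, inner ℝ W (residual hAt (hmxt x) x e' (J x)) +
      ∑ x ∈ s, inner ℝ (constBall x e') (mulOp (hmx x).bdd (H x - G x)) +
      inner ℝ W (mulOp hmt.bdd (cut hZ E')) + inner ℝ (mulOp hmt.bdd (cut hZ E')) E := by
    rw [hmid, inner_add_right (mulOp hmt.bdd (cut hZ E')), hZU]
    have h1 : ∑ x ∈ s, inner ℝ (residual hAt (hmxt x) x e' (J x)) (U + E) =
        ∑ x ∈ s, inner ℝ W (residual hAt (hmxt x) x e' (J x)) +
        ∑ x ∈ s, inner ℝ (constBall x e') (mulOp (hmx x).bdd (H x + constBall x e)) := by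
      rw [← Finset.sum_add_distrib]
      refine Finset.sum_congr rfl fun x hx => ?_
      rw [inner_add_right, hresU x hx, hresE x hx]
    have h2 : ∑ x ∈ s, inner ℝ (constBall x e') (mulOp (hmx x).bdd (H x - G x)) =
        ∑ x ∈ s, inner ℝ (constBall x e') (mulOp (hmx x).bdd (H x + constBall x e)) -
        ∑ x ∈ s, inner ℝ (constBall x e') (mulOp (hmx x).bdd (G x + constBall x e)) := by
      rw [← Finset.sum_sub_distrib]
      refine Finset.sum_congr rfl fun x _ => ?_
      rw [← inner_sub_right, ← map_sub]
      congr 2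
      abel
    rw [h1, h2]
    ring
  rw [hfinal]
  have hsum : |∑ x ∈ s, inner ℝ W (residual hAt (hmxt x) x e' (J x)) +
      ∑ x ∈ s, inner ℝ (constBall x e') (mulOp (hmx x).bdd (H x - G x)) +
      inner ℝ W (mulOp hmt.bdd (cut hZ E')) + inner ℝ (mulOp hmt.bdd (cut hZ E')) E|
      ≤ K * ε * ‖W‖ + C' * N + 2 * β * (N + z) := by
    refine (abs_add_le _ _).trans ?_
    have h1 := abs_add_le (∑ x ∈ s, inner ℝ W (residual hAt (hmxt x) x e' (J x)) +
      ∑ x ∈ s, inner ℝ (constBall x e') (mulOp (hmx x).bdd (H x - G x)))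
      (inner ℝ W (mulOp hmt.bdd (cut hZ E')))
    have h2 := abs_add_le (∑ x ∈ s, inner ℝ W (residual hAt (hmxt x) x e' (J x)))
      (∑ x ∈ s, inner ℝ (constBall x e') (mulOp (hmx x).bdd (H x - G x)))
    simp only [K]
    linarith
  refine hsum.trans ?_
  -- absorb `‖W‖` by the energy estimate
  have hW2 : ‖W‖ ^ 2 ≤ 2 / α * T + K ^ 2 / α ^ 2 * (N + z) := by
    rw [← hε]
    have h1 : K * ε * ‖W‖ ≤ α / 2 * ‖W‖ ^ 2 + K ^ 2 * ε ^ 2 / (2 * α) := by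
      have h0 : 0 ≤ (α * ‖W‖ - K * ε) ^ 2 / (2 * α) := by positivity
      have h00 : (α * ‖W‖ - K * ε) ^ 2 / (2 * α) =
          α / 2 * ‖W‖ ^ 2 + K ^ 2 * ε ^ 2 / (2 * α) - K * ε * ‖W‖ := by
        field_simp
        ring
      linarith
    have h2 : α / 2 * ‖W‖ ^ 2 ≤ T + K ^ 2 * ε ^ 2 / (2 * α) := by linarith
    have h3 : 2 / α * T + K ^ 2 / α ^ 2 * ε ^ 2 = (T + K ^ 2 * ε ^ 2 / (2 * α)) / (α / 2) := by
      field_simp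
    rw [h3, le_div_iff₀ (by positivity)]
    linarith
  have hεW : K * ε * ‖W‖ ≤ K * (N + z) + K * ‖W‖ ^ 2 := by
    rw [← hε]
    nlinarith [sq_nonneg (ε - ‖W‖), mul_nonneg hε0 (norm_nonneg W)]
  have hKW : K * ‖W‖ ^ 2 ≤ K * (2 / α * T + K ^ 2 / α ^ 2 * (N + z)) := by gcongr
  have hCN : C' * N ≤ C' * (N + z) := by
    gcongr
    linarith
  calc K * ε * ‖W‖ + C' * N + 2 * β * (N + z)
      ≤ (K * (N + z) + K * (2 / α * T + K ^ 2 / α ^ 2 * (N + z))) + C' * (N + z)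
          + 2 * β * (N + z) := by linarith
    _ = _ := by ring

/-! ### Measurability on the space of point sets -/

namespace PointSet

theorem lintegral_toMeasure (P : PointSet d) (f : Space d → ℝ≥0∞) :
    ∫⁻ x, f x ∂P.toMeasure = ∑' x : P.carrier, f x := by
  rw [toMeasure, lintegral_sum_measure]
  simp

theorem toMeasure_apply (P : PointSet d) {E : Set (Space d)} (hE : MeasurableSet E) :
    P.toMeasure E = ∑' x : P.carrier, E.indicator 1 (x : Space d) := by
  rw [← lintegral_indicator_one hE, lintegral_toMeasure]

theorem toMeasure_lt_top (P : PointSet d) {E : Set (Space d)} (hE : MeasurableSet E)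
    (hb : Bornology.IsBounded E) : P.toMeasure E < ∞ := by
  rw [toMeasure_apply P hE]
  have hfin : {x : P.carrier | (x : Space d) ∈ E}.Finite := by
    refine Set.Finite.of_finite_image (f := Subtype.val) ((P.finite_inter E hb).subset ?_)
      Subtype.val_injective.injOn
    rintro _ ⟨x, hx, rfl⟩
    exact ⟨x.2, hx⟩
  rw [tsum_eq_sum (s := hfin.toFinset)]
  · refine ENNReal.sum_lt_top.mpr fun x _ => ?_
    by_cases h : (x : Space d) ∈ E <;> simp [h]
  · intro x hx
    rw [Set.Finite.mem_toFinset] at hx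
    exact indicator_of_notMem (s := E) hx (1 : Space d → ℝ≥0∞)

theorem toMeasure_eq_zero_iff (P : PointSet d) {E : Set (Space d)} (hE : MeasurableSet E) :
    P.toMeasure E = 0 ↔ ∀ x ∈ P.carrier, x ∉ E := by
  rw [toMeasure_apply P hE, ENNReal.tsum_eq_zero]
  constructor
  · intro h x hx hxE
    have := h ⟨x, hx⟩
    simp [hxE] at this
  · intro h x
    exact indicator_of_notMem (h x x.2) _

theorem measurable_toMeasure : Measurable (toMeasure (d := d)) := comap_measurable _

/-- The point measure as a kernel. -/
def pointKernel (d : ℕ) : Kernel (PointSet d) (Space d) := ⟨toMeasure, measurable_toMeasure⟩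

/-- The shells `n ≤ |x| < n + 1`. -/
def shell (d : ℕ) (n : ℕ) : Set (Space d) := {x | ⌊‖x‖⌋₊ = n}

theorem measurableSet_shell (n : ℕ) : MeasurableSet (shell d n) :=
  (Nat.measurable_floor.comp measurable_norm) (measurableSet_singleton n)

theorem isBounded_shell (n : ℕ) : Bornology.IsBounded (shell d n) := by
  refine (Metric.isBounded_ball (x := (0 : Space d)) (r := n + 1)).subset fun x hx => ?_
  rw [mem_ball_zero_iff]
  have : ⌊‖x‖⌋₊ = n := hx
  have := Nat.lt_floor_add_one ‖x‖
  simp_all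

/-- A point measure has no bound uniform in P, even on bounded sets. Splitting space into shells and
the point sets by their count on each shell gives kernels with uniformly bounded mass. The
s-finiteness yields measurability of sums with parameters, in particular of pair counts. -/
instance : IsSFiniteKernel (pointKernel d) := by
  classical
  have hmeas : ∀ n k : ℕ, MeasurableSet {P : PointSet d | ⌊(P.toMeasure (shell d n)).toReal⌋₊ = k} := by
    intro n k
    exact (Nat.measurable_floor.comp ((Measure.measurable_coe (measurableSet_shell n)).comp
      measurable_toMeasure).ennreal_toReal) (measurableSet_singleton k)
  let K : ℕ → ℕ → Kernel (PointSet d) (Space d) := fun n k =>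
    Kernel.piecewise (hmeas n k) ((pointKernel d).restrict (measurableSet_shell n)) 0
  have hK : ∀ n k, IsFiniteKernel (K n k) := by
    intro n k
    refine ⟨⟨k + 1, by finiteness, fun P => ?_⟩⟩
    rw [Kernel.piecewise_apply]
    split_ifs with h
    · rw [Kernel.restrict_apply, Measure.restrict_apply_univ]
      change P.toMeasure (shell d n) ≤ _
      have h1 : ⌊(P.toMeasure (shell d n)).toReal⌋₊ = k := h
      have h2 := Nat.lt_floor_add_one (P.toMeasure (shell d n)).toReal
      rw [h1] at h2
      rw [← ENNReal.ofReal_toReal (P.toMeasure_lt_top (measurableSet_shell n)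
        (isBounded_shell n)).ne]
      refine (ENNReal.ofReal_le_ofReal h2.le).trans ?_
      rw [ENNReal.ofReal_add (by positivity) (by positivity)]
      simp
    · simp
  have hsum : pointKernel d = Kernel.sum fun n => Kernel.sum fun k => K n k := by
    ext P : 1
    rw [Kernel.sum_apply]
    have h1 : ∀ n, Kernel.sum (fun k => K n k) P = P.toMeasure.restrict (shell d n) := by
      intro n
      ext E hE
      rw [Kernel.sum_apply, Measure.sum_apply _ hE,
        tsum_eq_single ⌊(P.toMeasure (shell d n)).toReal⌋₊]
      · rw [Kernel.piecewise_apply, if_pos (by rfl), Kernel.restrict_apply]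
        rfl
      · intro k hk
        rw [Kernel.piecewise_apply, if_neg (fun h => hk h.symm)]
        simp
    simp_rw [h1]
    rw [← Measure.restrict_iUnion _ measurableSet_shell]
    · have : ⋃ n, shell d n = univ := by
        ext x
        simp [shell]
      rw [this, Measure.restrict_univ]
      rfl
    · intro i j hij
      rw [Function.onFun, disjoint_left]
      intro x hx hx'
      exact hij (hx.symm.trans hx')
  rw [hsum]
  have : ∀ n, IsSFiniteKernel (Kernel.sum fun k => K n k) := fun n =>
    inferInstance
  infer_instance

theorem measurable_lintegral {X : Type*} [MeasurableSpace X] {p : X → PointSet d}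
    (hp : Measurable p) {f : X → Space d → ℝ≥0∞} (hf : Measurable (Function.uncurry f)) :
    Measurable fun a => ∫⁻ x, f a x ∂(p a).toMeasure :=
  hf.lintegral_kernel_prod_right (κ := (pointKernel d).comap p hp)

theorem mem_vadd {z x : Space d} {P : PointSet d} :
    x ∈ (z +ᵥ P).carrier ↔ x - z ∈ P.carrier := Iff.rfl

theorem toMeasure_vadd (z : Space d) (P : PointSet d) {E : Set (Space d)} (hE : MeasurableSet E) :
    (z +ᵥ P).toMeasure E = ∫⁻ x, E.indicator 1 (x + z) ∂P.toMeasure := by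
  rw [toMeasure_apply _ hE, lintegral_toMeasure]
  let e : P.carrier ≃ (z +ᵥ P).carrier :=
    { toFun := fun x => ⟨x + z, by rw [mem_vadd]; simp⟩
      invFun := fun x => ⟨x - z, mem_vadd.mp x.2⟩
      left_inv := fun x => by simp
      right_inv := fun x => by simp }
  exact (e.tsum_eq fun x : (z +ᵥ P).carrier => E.indicator (1 : Space d → ℝ≥0∞) (x : Space d)).symm

instance : MeasurableVAdd₂ (Space d) (PointSet d) where
  measurable_vadd := by
    refine measurable_comap_iff.mpr (Measure.measurable_of_measurable_coe _ fun E hE => ?_)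
    change Measurable fun a : Space d × PointSet d => (a.1 +ᵥ a.2).toMeasure E
    simp_rw [toMeasure_vadd _ _ hE]
    refine measurable_lintegral measurable_snd ?_
    exact (measurable_one.indicator hE).comp
      (measurable_snd.add (measurable_fst.comp measurable_fst))

theorem mem_inclusions {P : PointSet d} {y : Space d} :
    y ∈ P.inclusions ↔ ∃ x ∈ P.carrier, dist y x < 1 := by
  simp [inclusions]

theorem mem_inclusions_vadd {P : PointSet d} {y z : Space d} :
    y ∈ (z +ᵥ P).inclusions ↔ y - z ∈ P.inclusions := by
  rw [mem_inclusions, mem_inclusions]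
  constructor
  · rintro ⟨x, hx, h⟩
    refine ⟨x - z, mem_vadd.mp hx, by simpa using h⟩
  · rintro ⟨x, hx, h⟩
    refine ⟨x + z, by rw [mem_vadd]; simpa using hx, ?_⟩
    rw [dist_eq_norm] at h ⊢
    convert h using 2
    abel

theorem isOpen_inclusions (P : PointSet d) : IsOpen P.inclusions :=
  isOpen_biUnion fun _ _ => Metric.isOpen_ball

theorem measurableSet_zero_mem_inclusions :
    MeasurableSet {P : PointSet d | (0 : Space d) ∈ P.inclusions} := by
  have : {P : PointSet d | (0 : Space d) ∈ P.inclusions}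
      = {P | P.toMeasure (Metric.ball 0 1) ≠ 0} := by
    ext P
    rw [mem_ofPred_eq, mem_ofPred_eq, Ne, toMeasure_eq_zero_iff _ measurableSet_ball, mem_inclusions]
    simp [dist_comm]
  rw [this]
  exact ((Measure.measurable_coe measurableSet_ball).comp measurable_toMeasure)
    (measurableSet_singleton 0).compl

theorem pairSum_eq_lintegral (P : PointSet d) (ζ : Space d × Space d → ℝ≥0∞) :
    P.pairSum ζ = ∫⁻ x, ∫⁻ y, {p : Space d × Space d | p.1 ≠ p.2}.indicator ζ (x, y)
      ∂P.toMeasure ∂P.toMeasure := by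
  simp_rw [lintegral_toMeasure]
  rw [← ENNReal.tsum_prod (f := fun x y : P.carrier =>
    {p : Space d × Space d | p.1 ≠ p.2}.indicator ζ ((x : Space d), (y : Space d)))]
  refine (tsum_subtype {p : P.carrier × P.carrier | p.1 ≠ p.2}
    (fun p => ζ ((p.1 : Space d), (p.2 : Space d)))).trans ?_
  refine tsum_congr fun p => ?_
  by_cases h : p.1 = p.2
  · simp [indicator, h]
  · have : (p.1 : Space d) ≠ p.2 := fun h' => h (Subtype.ext h')
    simp [indicator, h, this]

theorem measurable_pairSum {ζ : Space d × Space d → ℝ≥0∞} (hζ : Measurable ζ) :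
    Measurable fun P : PointSet d => P.pairSum ζ := by
  simp_rw [pairSum_eq_lintegral]
  have hs : MeasurableSet {p : Space d × Space d | p.1 ≠ p.2} :=
    (measurableSet_eq_fun measurable_fst measurable_snd).compl
  refine measurable_lintegral measurable_id ?_
  refine measurable_lintegral (p := fun a : PointSet d × Space d => a.1) measurable_fst ?_
  exact (hζ.indicator hs).comp
    ((measurable_snd.comp measurable_fst).prodMk measurable_snd)

end PointSet

/-! ### Stationary fields -/

section Environment

instance {X Y : Type*} [MeasurableSpace X] [MeasurableSpace Y] [AddAction (Space d) X]
    [AddAction (Space d) Y] [MeasurableVAdd₂ (Space d) X] [MeasurableVAdd₂ (Space d) Y] :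
    MeasurableVAdd₂ (Space d) (X × Y) where
  measurable_vadd :=
    (measurable_fst.vadd (measurable_fst.comp measurable_snd)).prodMk
      (measurable_fst.vadd (measurable_snd.comp measurable_snd))

instance {X Y : Type*} [MeasurableSpace X] [MeasurableSpace Y] [AddAction (Space d) X]
    [AddAction (Space d) Y] [MeasurableVAdd₂ (Space d) X] [MeasurableVAdd₂ (Space d) Y]
    (μ : Measure X) (ν : Measure Y) [SFinite μ] [SFinite ν] [VAddInvariantMeasure (Space d) X μ]
    [VAddInvariantMeasure (Space d) Y ν] :
    VAddInvariantMeasure (Space d) (X × Y) (μ.prod ν) where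
  measure_preimage_vadd z _ hs :=
    ((measurePreserving_vadd z μ).prod (measurePreserving_vadd z ν)).measure_preimage
      hs.nullMeasurableSet

variable {X : Type*} [MeasurableSpace X] [AddAction (Space d) X] [MeasurableVAdd₂ (Space d) X]
  {μ : Measure X} [IsProbabilityMeasure μ] [VAddInvariantMeasure (Space d) X μ]

-- A stationary field is a function of the environment composed with this shear. Measurability, null
-- sets and integrability therefore pass from the environment to the product with space.
variable (μ) in
theorem measurePreserving_shear :
    MeasurePreserving (fun p : X × Space d => ((-p.2) +ᵥ p.1, p.2)) (μ.prod volume)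
      (μ.prod volume) := by
  have h : MeasurePreserving (fun p : Space d × X => (p.1, (-p.1) +ᵥ p.2))
      ((volume : Measure (Space d)).prod μ) (volume.prod μ) := by
    refine MeasurePreserving.skew_product (f := id) (MeasurePreserving.id _)
      (g := fun (y : Space d) (ω : X) => (-y) +ᵥ ω) ?_ (Eventually.of_forall fun y => ?_)
    · exact (measurable_fst.neg).vadd measurable_snd
    · exact (measurePreserving_vadd (-y) μ).map_eq
  exact (Measure.measurePreserving_swap.comp h).comp Measure.measurePreserving_swap

theorem aestronglyMeasurable_field {F : Type*} [TopologicalSpace F] {f : X → F}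
    (hf : AEStronglyMeasurable f μ) :
    AEStronglyMeasurable (Function.uncurry (field (d := d) f)) (μ.prod volume) :=
  (hf.comp_fst (ν := volume)).comp_measurePreserving (measurePreserving_shear μ)

theorem ae_field {p : X → Prop} (h : ∀ᵐ ω ∂μ, p ω) :
    ∀ᵐ ω ∂μ, ∀ᵐ y : Space d, p ((-y) +ᵥ ω) := by
  have h1 : ∀ᵐ q ∂(μ.prod (volume : Measure (Space d))), p q.1 :=
    Measure.quasiMeasurePreserving_fst.ae h
  exact Measure.ae_ae_of_ae_prod ((measurePreserving_shear μ).quasiMeasurePreserving.ae h1)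

theorem integrable_mul_field {w : Space d → ℝ} (hw : Integrable w) {F : X → ℝ}
    (hF : Integrable F μ) :
    Integrable (fun p : X × Space d => w p.2 * field F p.1 p.2) (μ.prod volume) := by
  have h := (measurePreserving_shear μ).integrable_comp_of_integrable (hF.mul_prod hw)
  refine h.congr (Eventually.of_forall fun p => ?_)
  exact mul_comm _ _

theorem integral_mul_field {w : Space d → ℝ} (hw : Integrable w) {F : X → ℝ}
    (hF : Integrable F μ) :
    ∫ ω, (∫ y, w y * field F ω y) ∂μ = (∫ y, w y) * ∫ ω, F ω ∂μ := by
  rw [integral_integral (f := fun ω y => w y * field F ω y) (integrable_mul_field hw hF),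
    integral_prod_symm _ (integrable_mul_field hw hF), ← integral_mul_const]
  refine integral_congr_ae (Eventually.of_forall fun y => ?_)
  simp only [field]
  rw [integral_const_mul]
  congr 1
  exact (measurePreserving_vadd (-y) μ).integral_comp
    (MeasurableEquiv.vadd (-y) : X ≃ᵐ X).measurableEmbedding F

theorem integrable_field_mul {w : Space d → ℝ} (hw : Integrable w) {f h : X → ℝ}
    (hf : MemLp f 2 μ) (hh : MemLp h 2 μ) :
    Integrable (fun p : X × Space d => w p.2 * (field f p.1 p.2 * h p.1)) (μ.prod volume) := by
  have h1 := integrable_mul_field hw hf.integrable_sq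
  have h2 := hh.integrable_sq.mul_prod hw
  have hm : AEStronglyMeasurable (fun p : X × Space d => w p.2 * (field f p.1 p.2 * h p.1))
      (μ.prod volume) :=
    hw.aestronglyMeasurable.comp_snd.mul ((aestronglyMeasurable_field hf.aestronglyMeasurable).mul
      hh.aestronglyMeasurable.comp_fst)
  refine (h1.norm.add h2.norm).mono' hm (Eventually.of_forall fun p => ?_)
  simp only [field, Pi.add_apply, norm_mul, Real.norm_eq_abs, abs_pow]
  nlinarith [abs_nonneg (w p.2), mul_nonneg (abs_nonneg (w p.2))
    (sq_nonneg (|f ((-p.2) +ᵥ p.1)| - |h p.1|)), mul_nonneg (abs_nonneg (w p.2))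
    (sq_nonneg (|f ((-p.2) +ᵥ p.1)| + |h p.1|))]

theorem integral_field_mul_comm {w : Space d → ℝ} (hw : Integrable w) {f h : X → ℝ}
    (hf : MemLp f 2 μ) (hh : MemLp h 2 μ) :
    ∫ y, w y * ∫ ω, field f ω y * h ω ∂μ = ∫ ω, (∫ y, w y * field f ω y) * h ω ∂μ := by
  have key := integrable_field_mul hw hf hh
  calc ∫ y, w y * ∫ ω, field f ω y * h ω ∂μ
      = ∫ y, ∫ ω, w y * (field f ω y * h ω) ∂μ := by simp_rw [integral_const_mul]
    _ = ∫ ω, ∫ y, w y * (field f ω y * h ω) ∂volume ∂μ := by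
        rw [integral_integral_swap]
        exact key.swap
    _ = _ := by
        refine integral_congr_ae (Eventually.of_forall fun ω => ?_)
        simp only
        rw [← integral_mul_const]
        simp_rw [mul_assoc]

theorem integrable_mul_integral_field_mul {w : Space d → ℝ} (hw : Integrable w) {f h : X → ℝ}
    (hf : MemLp f 2 μ) (hh : MemLp h 2 μ) :
    Integrable fun y => w y * ∫ ω, field f ω y * h ω ∂μ := by
  have := (integrable_field_mul hw hf hh).integral_prod_right
  simpa only [integral_const_mul] using this

theorem integral_field_mul_swap (f h : X → ℝ) (y : Space d) :
    ∫ ω, field f ω y * h ω ∂μ = ∫ ω, field h ω (-y) * f ω ∂μ := by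
  rw [← (measurePreserving_vadd y μ).integral_comp
    (MeasurableEquiv.vadd y : X ≃ᵐ X).measurableEmbedding (fun ω => field f ω y * h ω)]
  simp [field, mul_comm]

end Environment

/-! ### Orthogonality of stationary gradients and solenoidal fields -/

theorem IsTest.comp_sub_left {η : Space d → ℝ} (h : IsTest univ η) (x : Space d) :
    IsTest univ fun y => η (x - y) where
  contDiff := h.contDiff.comp (contDiff_const.sub contDiff_id)
  compact := h.compact.comp_homeomorph (Homeomorph.subLeft x)
  subset := subset_univ _

theorem IsTest.pd_comp_sub_left {η : Space d → ℝ} (h : IsTest univ η) (i : Fin d)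
    (x y : Space d) : DiluteHomogenization.pd i (fun y => η (x - y)) y
      = -DiluteHomogenization.pd i η (x - y) := by
  have h1 : HasFDerivAt η (fderiv ℝ η (x - y)) (x - y) :=
    (h.contDiff.differentiable (by simp) _).hasFDerivAt
  have h2 : HasFDerivAt (fun y : Space d => x - y) (-ContinuousLinearMap.id ℝ (Space d)) y :=
    (hasFDerivAt_id y).const_sub x
  have h3 : HasFDerivAt (fun y => η (x - y)) _ y := h1.comp y h2
  simp [DiluteHomogenization.pd, h3.fderiv]

/-- Mollify: the derivatives of the convolution fall on the bump and vanish by hypothesis, so each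
mollification is constant. Continuity of c lets the mollification parameter tend to zero at any two
points. -/
theorem eq_of_integral_pd_mul_eq_zero {c : Space d → ℝ} (hc : Continuous c)
    (h : ∀ η, IsTest univ η → ∀ j, ∫ y, pd j η y * c y = 0) (x y : Space d) : c x = c y := by
  let φ : ℕ → ContDiffBump (0 : Space d) := fun n =>
    ⟨1 / (n + 2), 1 / (n + 1), by positivity, by gcongr; norm_num⟩
  have hφ : Tendsto (fun n => (φ n).rOut) atTop (𝓝 0) := tendsto_one_div_add_atTop_nhds_zero_nat
  let L : ℝ →L[ℝ] ℝ →L[ℝ] ℝ := ContinuousLinearMap.lsmul ℝ ℝ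
  have key : ∀ n, convolution ((φ n).normed volume) c L volume x
      = convolution ((φ n).normed volume) c L volume y := by
    intro n
    have hs : HasCompactSupport ((φ n).normed volume) := (φ n).hasCompactSupport_normed
    have hcd : ContDiff ℝ (⊤ : ℕ∞) ((φ n).normed volume) := (φ n).contDiff_normed
    have hd := fun z => hs.hasFDerivAt_convolution_left L (hcd.of_le (by norm_cast))
      (hc.locallyIntegrable (μ := volume)) z
    have hzero : ∀ z, fderiv ℝ (convolution ((φ n).normed volume) c L volume) z = 0 := by
      intro z
      rw [(hd z).fderiv]
      refine ContinuousLinearMap.coe_injective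
        ((EuclideanSpace.basisFun (Fin d) ℝ).toBasis.ext fun j => ?_)
      simp only [OrthonormalBasis.coe_toBasis, EuclideanSpace.basisFun_apply,
        ContinuousLinearMap.coe_coe, zero_apply]
      have hlc := hc.locallyIntegrable (μ := (volume : Measure (Space d)))
      rw [← convolution_flip, ContinuousLinearMap.precompL, ContinuousLinearMap.flip_flip,
        convolution_precompR_apply L.flip hlc (hs.fderiv ℝ)
          (hcd.continuous_fderiv (by simp)), convolution_def]
      have ht : IsTest univ ((φ n).normed (volume : Measure (Space d))) :=
        ⟨hcd, hs, subset_univ _⟩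
      have h1 := h _ (ht.comp_sub_left z) j
      simp_rw [ht.pd_comp_sub_left] at h1
      have h2 : ∫ t, pd j ((φ n).normed volume) (z - t) * c t = 0 := by
        rw [← neg_eq_zero, ← integral_neg, ← h1]
        simp only [neg_mul]
      exact h2
    exact is_const_of_fderiv_eq_zero (𝕜 := ℝ) (fun z => (hd z).differentiableAt) hzero x y
  have t1 := ContDiffBump.convolution_tendsto_right_of_continuous (μ := volume) hφ hc x
  have t2 := ContDiffBump.convolution_tendsto_right_of_continuous (μ := volume) hφ hc y
  refine tendsto_nhds_unique t1 (t2.congr fun n => (key n).symm)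

/-! #### Strong continuity of translations -/

theorem continuous_translate_L2 (v : L2 d) :
    Continuous fun z : Space d => Lp.compMeasurePreserving (fun y : Space d => y + z)
      (measurePreserving_add_right volume z) v := by
  let g : C(Space d, C(Space d, Space d)) :=
    (ContinuousMap.mk (fun a : Space d × Space d => a.2 + a.1) (by fun_prop)).curry
  exact continuous_const.compMeasurePreservingLp g.continuous
    (fun z => measurePreserving_add_right volume z) (by simp)

/-- Realizations are only locally square integrable. Cutting to a set containing the ball of radius
2 does not alter increments by |z| < 1 over the unit ball and gives access to continuity of
translations in L². -/
theorem setIntegral_translate_sub_le {u : Space d → Space d} {D : Set (Space d)}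
    (hu : MemLp (D.indicator u) 2 volume)
    {z : Space d} (hz : ‖z‖ < 1) (hball : Metric.ball 0 2 ⊆ D) :
    ∫ y in Metric.ball (0 : Space d) 1, ‖u (y + z) - u y‖ ^ 2
      ≤ ‖Lp.compMeasurePreserving (fun y : Space d => y + z)
        (measurePreserving_add_right volume z) hu.toLp - hu.toLp‖ ^ 2 := by
  set T := Lp.compMeasurePreserving (fun y : Space d => y + z)
        (measurePreserving_add_right volume z) hu.toLp with hT
  rw [norm_sq_eq_integral]
  have h1 : T =ᵐ[volume] fun y => D.indicator u (y + z) :=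
    (Lp.coeFn_compMeasurePreserving _ _).trans
      ((measurePreserving_add_right volume z).quasiMeasurePreserving.ae_eq_comp hu.coeFn_toLp)
  have h2 : ∀ᵐ y ∂(volume.restrict (Metric.ball (0 : Space d) 1)),
      ‖u (y + z) - u y‖ ^ 2 = ‖(T - hu.toLp : L2 d) y‖ ^ 2 := by
    rw [ae_restrict_iff' measurableSet_ball]
    filter_upwards [h1, hu.coeFn_toLp, Lp.coeFn_sub T hu.toLp] with y h1 h2 h3 hy
    rw [mem_ball_zero_iff] at hy
    rw [h3, Pi.sub_apply, h1, h2, indicator_of_mem, indicator_of_mem]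
    · exact hball (by rw [mem_ball_zero_iff]; linarith)
    · exact hball (by rw [mem_ball_zero_iff]; linarith [norm_add_le y z])
  rw [integral_congr_ae h2]
  exact setIntegral_le_integral (norm_integrable_sq _) (Eventually.of_forall fun y => by positivity)

section

variable {X : Type*} [MeasurableSpace X] [AddAction (Space d) X] [MeasurableVAdd₂ (Space d) X]
  {μ : Measure X}

variable (μ) in
/-- The unitary translation `f ↦ f((-z) + ·)` on square-integrable random vectors. -/
def shift [VAddInvariantMeasure (Space d) X μ] (z : Space d) :
    Lp (Space d) 2 μ →ₗᵢ[ℝ] Lp (Space d) 2 μ :=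
  Lp.compMeasurePreservingₗᵢ ℝ (fun ω => (-z) +ᵥ ω) (measurePreserving_vadd (-z) μ)

theorem coeFn_shift [VAddInvariantMeasure (Space d) X μ] (z : Space d) (f : Lp (Space d) 2 μ) :
    shift μ z f =ᵐ[μ] fun ω => f ((-z) +ᵥ ω) :=
  Lp.coeFn_compMeasurePreserving f (measurePreserving_vadd (-z) μ)

theorem shift_shift [VAddInvariantMeasure (Space d) X μ] (y z : Space d) (f : Lp (Space d) 2 μ) :
    shift μ y (shift μ z f) = shift μ (y + z) f := by
  refine Lp.ext ?_
  filter_upwards [coeFn_shift y (shift μ z f), coeFn_shift (y + z) f,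
    (measurePreserving_vadd (-y) μ).quasiMeasurePreserving.ae (coeFn_shift z f)] with ω h1 h2 h3
  rw [h1, h2, h3, vadd_vadd, neg_add_rev]

theorem Lp_norm_sq_eq_integral {X : Type*} [MeasurableSpace X] {μ : Measure X}
    (f : Lp (Space d) 2 μ) : ‖f‖ ^ 2 = ∫ ω, ‖f ω‖ ^ 2 ∂μ := by
  rw [← real_inner_self_eq_norm_sq, L2.inner_def]
  simp_rw [real_inner_self_eq_norm_sq]

theorem MemLp.integrable_norm_sq {E : Type*} [NormedAddCommGroup E] {f : X → E}
    (hf : MemLp f 2 μ) : Integrable (fun ω => ‖f ω‖ ^ 2) μ :=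
  (memLp_two_iff_integrable_sq_norm hf.1).mp hf

variable [IsProbabilityMeasure μ] [VAddInvariantMeasure (Space d) X μ]

theorem integrable_indicator_one {D : Set (Space d)} (hD : MeasurableSet D) (hv : volume D ≠ ∞) :
    Integrable (D.indicator (1 : Space d → ℝ)) :=
  (integrable_indicator_iff hD).mpr (integrableOn_const hv)

theorem memLp_indicator_field {E : Type*} [NormedAddCommGroup E] {f : X → E} (hf : MemLp f 2 μ)
    {D : Set (Space d)} (hD : MeasurableSet D) (hv : volume D ≠ ∞) :
    ∀ᵐ ω ∂μ, MemLp (D.indicator (field f ω)) 2 volume := by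
  have h1 := (integrable_mul_field (integrable_indicator_one hD hv)
    (MemLp.integrable_norm_sq hf)).prod_right_ae
  have h2 := (aestronglyMeasurable_field (d := d) hf.aestronglyMeasurable).prodMk_left
  filter_upwards [h1, h2] with ω h1 h2
  have h3 : AEStronglyMeasurable (field f ω) volume := h2
  rw [memLp_two_iff_integrable_sq_norm (h3.indicator hD)]
  refine h1.congr (Eventually.of_forall fun y => ?_)
  by_cases hy : y ∈ D <;> simp [hy, field]

theorem integral_indicator_mul_field {F : X → ℝ} (hF : Integrable F μ) {D : Set (Space d)}
    (hD : MeasurableSet D) (hv : volume D ≠ ∞) :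
    ∫ ω, (∫ y in D, field F ω y) ∂μ = volume.real D * ∫ ω, F ω ∂μ := by
  have := integral_mul_field (integrable_indicator_one hD hv) hF
  rw [integral_indicator_one hD] at this
  rw [← this]
  refine integral_congr_ae (Eventually.of_forall fun ω => ?_)
  simp only
  rw [← integral_indicator hD]
  refine integral_congr_ae (Eventually.of_forall fun y => ?_)
  by_cases hy : y ∈ D <;> simp [hy]

theorem integrable_setIntegral_field {F : X → ℝ} (hF : Integrable F μ) {D : Set (Space d)}
    (hD : MeasurableSet D) (hv : volume D ≠ ∞) :
    Integrable (fun ω => ∫ y in D, field F ω y) μ := by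
  have := (integrable_mul_field (integrable_indicator_one hD hv) hF).integral_prod_left
  refine this.congr (Eventually.of_forall fun ω => ?_)
  simp only
  rw [← integral_indicator hD]
  refine integral_congr_ae (Eventually.of_forall fun y => ?_)
  by_cases hy : y ∈ D <;> simp [hy]

/-- By stationarity the increment in the environment, multiplied by the volume of the unit ball, is
the expectation of the spatial increment over that ball. This tends to zero for almost every
realization. -/
theorem tendsto_shift (f : Lp (Space d) 2 μ) : Tendsto (fun z => shift μ z f) (𝓝 0) (𝓝 f) := by
  have hv : 0 < volume.real (Metric.ball (0 : Space d) 1) :=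
    ENNReal.toReal_pos (Metric.measure_ball_pos _ _ one_pos).ne' measure_ball_lt_top.ne
  have hf := Lp.memLp f
  have hmeas : ∀ z : Space d, Integrable (fun ω => ‖f ((-z) +ᵥ ω) - f ω‖ ^ 2) μ := fun z =>
    MemLp.integrable_norm_sq ((hf.comp_measurePreserving (measurePreserving_vadd (-z) μ)).sub hf)
  have hΦ : Tendsto (fun z : Space d => ∫ ω, (∫ y in Metric.ball (0 : Space d) 1,
      ‖field f ω (y + z) - field f ω y‖ ^ 2) ∂μ) (𝓝 0) (𝓝 (∫ _ω : X, (0 : ℝ) ∂μ)) := by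
    have hmem := memLp_indicator_field (d := d) hf (D := Metric.ball 0 2) measurableSet_ball
      measure_ball_lt_top.ne
    have hball : ∀ᶠ z : Space d in 𝓝 0, ‖z‖ < 1 := by
      filter_upwards [Metric.ball_mem_nhds (0 : Space d) one_pos] with z hz
      rwa [mem_ball_zero_iff] at hz
    -- The bound is (2 ‖u‖)² for the realization u cut to the ball of radius 2, integrable by
    -- stationarity.
    refine tendsto_integral_filter_of_dominated_convergence
      (fun ω => 4 * ∫ y in Metric.ball (0 : Space d) 2, field (fun ω => ‖f ω‖ ^ 2) ω y) ?_ ?_ ?_ ?_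
    · refine Eventually.of_forall fun z => ?_
      have := (integrable_setIntegral_field (hmeas z) (D := Metric.ball (0 : Space d) 1)
        measurableSet_ball measure_ball_lt_top.ne).aestronglyMeasurable
      simpa only [field, vadd_vadd, ← neg_add_rev] using this
    · filter_upwards [hball] with z hz
      filter_upwards [hmem] with ω hω
      rw [Real.norm_of_nonneg (by positivity)]
      refine (setIntegral_translate_sub_le hω hz subset_rfl).trans ?_
      have h1 : ‖Lp.compMeasurePreserving (fun y : Space d => y + z)
        (measurePreserving_add_right volume z) hω.toLp - hω.toLp‖ ≤ 2 * ‖hω.toLp‖ := by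
        refine (norm_sub_le _ _).trans ?_
        rw [Lp.norm_compMeasurePreserving]
        linarith
      have h2 : ‖hω.toLp‖ ^ 2 = ∫ y in Metric.ball (0 : Space d) 2,
          field (fun ω => ‖f ω‖ ^ 2) ω y := by
        rw [norm_sq_eq_integral, ← integral_indicator measurableSet_ball]
        refine integral_congr_ae ?_
        filter_upwards [hω.coeFn_toLp] with y hy
        rw [hy]
        by_cases h : y ∈ Metric.ball (0 : Space d) 2 <;> simp [h, field]
      rw [← h2]
      calc _ ≤ (2 * ‖hω.toLp‖) ^ 2 := by gcongr
        _ = _ := by ring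
    · exact (integrable_setIntegral_field (MemLp.integrable_norm_sq hf) measurableSet_ball
        measure_ball_lt_top.ne).const_mul 4
    · filter_upwards [hmem] with ω hω
      have h1 := ((continuous_translate_L2 hω.toLp).sub
        (continuous_const (y := hω.toLp))).norm.pow 2
      have h3 : Lp.compMeasurePreserving (fun y : Space d => y + 0)
        (measurePreserving_add_right volume 0) hω.toLp = hω.toLp := by
        refine Lp.ext ?_
        filter_upwards [Lp.coeFn_compMeasurePreserving hω.toLp
          (measurePreserving_add_right volume (0 : Space d))] with y hy
        rw [hy]
        simp
      have h4 : ‖Lp.compMeasurePreserving (fun y : Space d => y + 0)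
        (measurePreserving_add_right volume 0) hω.toLp - hω.toLp‖ ^ 2 = 0 := by
        rw [h3]
        simp
      have h2 := (h1.tendsto 0).mono_right (le_of_eq (congrArg 𝓝 h4))
      refine squeeze_zero' (Eventually.of_forall fun z => by positivity) ?_ h2
      filter_upwards [hball] with z hz
      exact setIntegral_translate_sub_le hω hz subset_rfl
  have heq : ∀ z : Space d, ∫ ω, (∫ y in Metric.ball (0 : Space d) 1,
      ‖field f ω (y + z) - field f ω y‖ ^ 2) ∂μ
      = volume.real (Metric.ball (0 : Space d) 1) * ‖shift μ z f - f‖ ^ 2 := by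
    intro z
    have h1 := integral_indicator_mul_field (hmeas z) (D := Metric.ball (0 : Space d) 1)
        measurableSet_ball measure_ball_lt_top.ne
    have h2 : ‖shift μ z f - f‖ ^ 2 = ∫ ω, ‖f ((-z) +ᵥ ω) - f ω‖ ^ 2 ∂μ := by
      rw [Lp_norm_sq_eq_integral]
      refine integral_congr_ae ?_
      filter_upwards [Lp.coeFn_sub (shift μ z f) f, coeFn_shift z f] with ω h1 h2
      rw [h1, Pi.sub_apply, h2]
    rw [h2, ← h1]
    simp only [field, vadd_vadd, ← neg_add_rev]
  simp_rw [heq, integral_zero] at hΦ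
  have h4 := hΦ.const_mul (volume.real (Metric.ball (0 : Space d) 1))⁻¹
  simp only [← mul_assoc, inv_mul_cancel₀ hv.ne', one_mul, mul_zero] at h4
  have h5 := h4.sqrt
  simp only [Real.sqrt_zero, Real.sqrt_sq (norm_nonneg _)] at h5
  exact tendsto_iff_norm_sub_tendsto_zero.mpr h5

theorem continuous_shift (f : Lp (Space d) 2 μ) : Continuous fun z => shift μ z f := by
  rw [continuous_iff_continuousAt]
  intro z
  have h1 : Tendsto (fun y : Space d => y - z) (𝓝 z) (𝓝 0) := by
    have : Continuous fun y : Space d => y - z := by fun_prop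
    simpa using this.tendsto z
  have h2 := ((shift μ z).continuous.tendsto f).comp ((tendsto_shift f).comp h1)
  refine h2.congr fun y => ?_
  simp [shift_shift]

end

/-! #### Invariant vectors and the orthogonality relation -/

section

variable {X : Type*} [MeasurableSpace X] {μ : Measure X} [IsProbabilityMeasure μ]

/-- The conditional expectation of h given f vanishes, and f can be pulled out of it. -/
theorem integral_mul_eq_zero_of_comap {f h : X → ℝ} (hf : Measurable f) (hh : Integrable h μ)
    (hfh : Integrable (f * h) μ) (hzero : ∀ E, MeasurableSet E → ∫ ω in f ⁻¹' E, h ω ∂μ = 0) :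
    ∫ ω, f ω * h ω ∂μ = 0 := by
  have hm : MeasurableSpace.comap f inferInstance ≤ ‹MeasurableSpace X› := hf.comap_le
  have hfm : StronglyMeasurable[MeasurableSpace.comap f inferInstance] f :=
    (comap_measurable f).stronglyMeasurable
  have h1 : (0 : X → ℝ) =ᵐ[μ] μ[h|MeasurableSpace.comap f inferInstance] := by
    refine ae_eq_condExp_of_forall_setIntegral_eq hm hh (fun s _ _ => integrableOn_zero) ?_
      aestronglyMeasurable_zero
    rintro _ ⟨E, hE, rfl⟩ _
    simp [hzero E hE]
  have h2 := condExp_mul_of_stronglyMeasurable_left hfm hfh hh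
  rw [← integral_condExp (f := fun ω => f ω * h ω) hm]
  refine integral_eq_zero_of_ae ?_
  filter_upwards [h1, h2] with ω h1 h2
  refine Eq.trans h2 ?_
  rw [Pi.mul_apply, ← h1]
  simp

variable [AddAction (Space d) X] [MeasurableVAdd₂ (Space d) X] [VAddInvariantMeasure (Space d) X μ]

/-- The events defined by a component of an invariant vector are invariant up to null sets, so the
vanishing conditional mean of g applies to each of them. -/
theorem inner_eq_zero_of_shift_eq {g : X → Space d} (hg : MemLp g 2 μ)
    (hmean : ∀ I : Set X, MeasurableSet I →
      (∀ z : Space d, (fun ω => z +ᵥ ω) ⁻¹' I =ᵐ[μ] I) → ∫ ω in I, g ω ∂μ = 0)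
    {m : Lp (Space d) 2 μ} (hm : ∀ z, shift μ z m = m) : inner ℝ m hg.toLp = 0 := by
  have h1 : inner ℝ m hg.toLp = ∫ ω, ∑ i, m ω i * g ω i ∂μ := by
    rw [L2.inner_def]
    refine integral_congr_ae ?_
    filter_upwards [hg.coeFn_toLp] with ω hω
    rw [hω]
    simp [PiLp.inner_apply, mul_comm]
  have hint : ∀ i, Integrable (fun ω => m ω i * g ω i) μ := fun i =>
    MemLp.integrable_mul (p := 2) (q := 2) (MemLp.coord (Lp.memLp m) i) (MemLp.coord hg i)
  rw [h1, integral_finsetSum _ fun i _ => hint i]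
  refine Finset.sum_eq_zero fun i _ => ?_
  have hmeas : Measurable fun ω => m ω i :=
    (EuclideanSpace.proj i : Space d →L[ℝ] ℝ).continuous.measurable.comp
      (Lp.stronglyMeasurable m).measurable
  refine integral_mul_eq_zero_of_comap hmeas ((MemLp.coord hg i).integrable (by norm_num))
    (hint i) fun E hE => ?_
  have h2 := hmean _ (hmeas hE) fun z => ?_
  · have h3 := (EuclideanSpace.proj i : Space d →L[ℝ] ℝ).integral_comp_comm
      (hg.integrable (by norm_num)).integrableOn (μ := μ.restrict ((fun ω => m ω i) ⁻¹' E))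
    rw [h2] at h3
    simpa using h3
  · have h3 := coeFn_shift (-z) m
    rw [hm, neg_neg] at h3
    filter_upwards [h3] with ω hω
    refine propext ?_
    change m (z +ᵥ ω) i ∈ E ↔ m ω i ∈ E
    rw [hω]

/-- Mean ergodic theorem by minimal norm. The element m of least norm in the closed convex hull of
the orbit satisfies ‖m‖² ≤ (m, w) for every w in the hull. Taking w to be a translate of m makes m
invariant, hence orthogonal to g; taking w = g gives m = 0. -/
theorem zero_mem_closure_convexHull_shift {g : X → Space d} (hg : MemLp g 2 μ)
    (hmean : ∀ I : Set X, MeasurableSet I →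
      (∀ z : Space d, (fun ω => z +ᵥ ω) ⁻¹' I =ᵐ[μ] I) → ∫ ω in I, g ω ∂μ = 0) :
    0 ∈ closure (convexHull ℝ (range fun z => shift μ z hg.toLp)) := by
  set K := closure (convexHull ℝ (range fun z => shift μ z hg.toLp)) with hK
  have hsub : range (fun z => shift μ z hg.toLp) ⊆ K :=
    (subset_convexHull ℝ _).trans subset_closure
  have hconv : Convex ℝ K := (convex_convexHull ℝ _).closure
  have hmem : shift μ 0 hg.toLp ∈ K := hsub ⟨0, rfl⟩
  obtain ⟨m, hmK, hm⟩ := exists_norm_eq_iInf_of_complete_convex ⟨_, hmem⟩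
    isClosed_closure.isComplete hconv 0
  have hle : ∀ w ∈ K, ‖m‖ ^ 2 ≤ inner ℝ m w := by
    intro w hw
    have := (norm_eq_iInf_iff_real_inner_le_zero hconv hmK).mp hm w hw
    rw [zero_sub, inner_neg_left, inner_sub_right, real_inner_self_eq_norm_sq] at this
    linarith
  have hinv : ∀ z, MapsTo (shift μ z) K K := by
    intro z
    refine MapsTo.closure ?_ (shift μ z).continuous
    rw [mapsTo_iff_image_subset]
    have h1 := (shift μ z).toLinearMap.image_convexHull (range fun z => shift μ z hg.toLp)
    refine h1.subset.trans (convexHull_mono ?_)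
    rintro _ ⟨_, ⟨y, rfl⟩, rfl⟩
    exact ⟨z + y, (shift_shift z y _).symm⟩
  have hfix : ∀ z, shift μ z m = m := by
    intro z
    have h1 := hle _ (hinv z hmK)
    have h2 : ‖shift μ z m - m‖ ^ 2 ≤ 0 := by
      rw [norm_sub_sq_real, LinearIsometry.norm_map, real_inner_comm]
      linarith
    have h3 : ‖shift μ z m - m‖ = 0 := by nlinarith [norm_nonneg (shift μ z m - m)]
    exact sub_eq_zero.mp (norm_eq_zero.mp h3)
  have h0 : inner ℝ m (shift μ 0 hg.toLp) = 0 := by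
    rw [← hfix 0, LinearIsometry.inner_map_map]
    exact inner_eq_zero_of_shift_eq hg hmean hfix
  have h1 := hle _ hmem
  rw [h0] at h1
  have h2 : ‖m‖ = 0 := by nlinarith [norm_nonneg m]
  rwa [← norm_eq_zero.mp h2]

/-- The correlation c(y) = 𝔼[g(y) · q(0)] has zero distributional gradient. Curl-freeness of g
exchanges the index of the derivative with that of the component, stationarity moves the translation
from g to q, and the resulting divergence of q vanishes. -/
theorem integral_pd_mul_correlation {g q : X → Space d} (hg : MemLp g 2 μ) (hq : MemLp q 2 μ)
    (hcurl : ∀ᵐ ω ∂μ, IsCurlFree univ (field g ω))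
    (hdiv : ∀ᵐ ω ∂μ, ∀ η, IsTest univ η → ∫ y, inner ℝ (gradient η y) (field q ω y) = 0)
    {η : Space d → ℝ} (hη : IsTest univ η) (j : Fin d) :
    ∫ y, pd j η y * ∑ i, ∫ ω, field (fun ω => g ω i) ω y * q ω i ∂μ = 0 := by
  have hw : ∀ i, Integrable (pd i η) := fun i => memLp_one_iff_integrable.mp ((hη.pd i).memLp 1)
  set η' : Space d → ℝ := fun y => η (0 - y)
  have hη' : IsTest univ η' := hη.comp_sub_left 0
  have hw' : ∀ i, Integrable (pd i η') := fun i =>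
    memLp_one_iff_integrable.mp ((hη'.pd i).memLp 1)
  have step : ∀ i, ∫ y, pd j η y * ∫ ω, field (fun ω => g ω i) ω y * q ω i ∂μ
      = - ∫ ω, (∫ y, pd i η' y * field (fun ω => q ω i) ω y) * g ω j ∂μ := by
    intro i
    calc ∫ y, pd j η y * ∫ ω, field (fun ω => g ω i) ω y * q ω i ∂μ
        = ∫ ω, (∫ y, pd j η y * field (fun ω => g ω i) ω y) * q ω i ∂μ :=
          integral_field_mul_comm (hw j) (MemLp.coord hg i) (MemLp.coord hq i)
      _ = ∫ ω, (∫ y, pd i η y * field (fun ω => g ω j) ω y) * q ω i ∂μ := by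
          refine integral_congr_ae ?_
          filter_upwards [hcurl] with ω hω
          have := hω η hη i j
          simp_rw [mul_comm (pd _ η _)]
          exact congrArg (· * q ω i) this
      _ = ∫ y, pd i η y * ∫ ω, field (fun ω => g ω j) ω y * q ω i ∂μ :=
          (integral_field_mul_comm (hw i) (MemLp.coord hg j) (MemLp.coord hq i)).symm
      _ = ∫ y, pd i η y * ∫ ω, field (fun ω => q ω i) ω (-y) * g ω j ∂μ := by
          simp_rw [integral_field_mul_swap (fun ω => g ω j)]
      _ = ∫ y, pd i η (-y) * ∫ ω, field (fun ω => q ω i) ω y * g ω j ∂μ := by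
          rw [← integral_neg_eq_self]
          simp only [neg_neg]
      _ = - ∫ y, pd i η' y * ∫ ω, field (fun ω => q ω i) ω y * g ω j ∂μ := by
          rw [← integral_neg]
          refine integral_congr_ae (Eventually.of_forall fun y => ?_)
          have : pd i η' y = -pd i η (0 - y) := hη.pd_comp_sub_left i 0 y
          simp only [this, zero_sub, neg_mul, neg_neg]
      _ = _ := by
          rw [integral_field_mul_comm (hw' i) (MemLp.coord hq i) (MemLp.coord hg j)]
  simp_rw [Finset.mul_sum]
  rw [integral_finsetSum _ fun i _ => integrable_mul_integral_field_mul (hw j)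
    (MemLp.coord hg i) (MemLp.coord hq i)]
  simp_rw [step]
  rw [Finset.sum_neg_distrib, neg_eq_zero, ← integral_finsetSum]
  · refine integral_eq_zero_of_ae ?_
    have hint : ∀ᵐ ω ∂μ, ∀ i, Integrable fun y => pd i η' y * field (fun ω => q ω i) ω y :=
      ae_all_iff.mpr fun i => (integrable_mul_field (hw' i)
        ((MemLp.coord hq i).integrable (by norm_num))).prod_right_ae
    filter_upwards [hdiv, hint] with ω h1 h2
    rw [← Finset.sum_mul, ← integral_finsetSum _ fun i _ => h2 i]
    have h3 := h1 η' hη'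
    have h4 : ∀ y, inner ℝ (gradient η' y) (field q ω y)
        = ∑ i, pd i η' y * field (fun ω => q ω i) ω y := by
      intro y
      simp only [PiLp.inner_apply, gradient_apply, field, RCLike.inner_apply, conj_trivial,
        mul_comm]
    simp_rw [h4] at h3
    rw [h3, zero_mul]
    rfl
  · intro i _
    have := (integrable_field_mul (hw' i) (MemLp.coord hq i) (MemLp.coord hg j)).integral_prod_left
    simpa only [← mul_assoc, integral_mul_const] using this

/-- A stationary gradient field with vanishing conditional mean is orthogonal to every stationary
divergence-free field. -/
theorem integral_inner_eq_zero {g q : X → Space d} (hg : MemLp g 2 μ) (hq : MemLp q 2 μ)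
    (hmean : ∀ I : Set X, MeasurableSet I →
      (∀ z : Space d, (fun ω => z +ᵥ ω) ⁻¹' I =ᵐ[μ] I) → ∫ ω in I, g ω ∂μ = 0)
    (hcurl : ∀ᵐ ω ∂μ, IsCurlFree univ (field g ω))
    (hdiv : ∀ᵐ ω ∂μ, ∀ η, IsTest univ η → ∫ y, inner ℝ (gradient η y) (field q ω y) = 0) :
    ∫ ω, inner ℝ (g ω) (q ω) ∂μ = 0 := by
  set c : Space d → ℝ := fun y => inner ℝ (shift μ y hg.toLp) hq.toLp with hc
  have hcont : Continuous c := (continuous_shift _).inner continuous_const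
  have hshift : ∀ y, c y = ∫ ω, inner ℝ (field g ω y) (q ω) ∂μ := by
    intro y
    simp only [hc, L2.inner_def]
    refine integral_congr_ae ?_
    filter_upwards [hq.coeFn_toLp, coeFn_shift y hg.toLp,
      (measurePreserving_vadd (-y) μ).quasiMeasurePreserving.ae hg.coeFn_toLp] with ω h1 h2 h3
    rw [h1, h2, h3]
    rfl
  have hsum : ∀ y, c y = ∑ i, ∫ ω, field (fun ω => g ω i) ω y * q ω i ∂μ := by
    intro y
    rw [hshift, ← integral_finsetSum]
    · refine integral_congr_ae (Eventually.of_forall fun ω => ?_)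
      simp [PiLp.inner_apply, field, mul_comm]
    · intro i _
      exact MemLp.integrable_mul (p := 2) (q := 2)
        ((MemLp.coord hg i).comp_measurePreserving (measurePreserving_vadd (-y) μ))
        (MemLp.coord hq i)
  have hconst := eq_of_integral_pd_mul_eq_zero hcont fun η hη j => by
    simp_rw [hsum]
    exact integral_pd_mul_correlation hg hq hcurl hdiv hη j
  -- Since c is constant, the whole orbit of g lies in a closed hyperplane. This contains the closed
  -- convex hull, hence 0, so that c(0) = 0.
  have hset : closure (convexHull ℝ (range fun z => shift μ z hg.toLp))
      ⊆ {v | inner ℝ v hq.toLp = c 0} := by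
    refine closure_minimal (convexHull_min ?_ ?_) (isClosed_eq (by fun_prop) continuous_const)
    · rintro _ ⟨z, rfl⟩
      exact hconst z 0
    · intro v hv w hw a b _ _ hab
      change inner ℝ (a • v + b • w) hq.toLp = c 0
      have hv' : inner ℝ v hq.toLp = c 0 := hv
      have hw' : inner ℝ w hq.toLp = c 0 := hw
      rw [inner_add_left, real_inner_smul_left, real_inner_smul_left, hv', hw', ← add_mul, hab,
        one_mul]
  have h0 : inner ℝ (0 : Lp (Space d) 2 μ) hq.toLp = c 0 :=
    hset (zero_mem_closure_convexHull_shift hg hmean)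
  rw [inner_zero_left, hshift] at h0
  simpa [field] using h0.symm

end

/-! ### Counting close pairs of points -/

theorem measurableSet_cube (r : ℝ) (z : Space d) : MeasurableSet (cube r z) := by
  have : cube r z = ⋂ i, {x : Space d | z i - r / 2 ≤ x i ∧ x i < z i + r / 2} := by
    ext x
    simp [cube]
  rw [this]
  refine MeasurableSet.iInter fun i => ?_
  have hx : Measurable fun x : Space d => x i := by fun_prop
  exact (measurableSet_le measurable_const hx).inter (measurableSet_lt hx measurable_const)

theorem volume_cube {r : ℝ} (hr : 0 ≤ r) (z : Space d) :
    volume (cube r z) = ENNReal.ofReal (r ^ d) := by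
  have h1 : cube r z = (WithLp.ofLp : Space d → Fin d → ℝ) ⁻¹'
      (univ.pi fun i => Ico (z i - r / 2) (z i + r / 2)) := by
    ext x
    simp [cube]
  rw [h1, (PiLp.volume_preserving_ofLp (Fin d)).measure_preimage
    (MeasurableSet.univ_pi fun i => measurableSet_Ico).nullMeasurableSet, Real.volume_pi_Ico]
  simp only [add_sub_sub_cancel, add_halves, Finset.prod_const, Finset.card_univ, Fintype.card_fin]
  rw [ENNReal.ofReal_pow hr]

theorem cube_subset_iUnion_cube {ℓ L : ℝ} (hℓ : 0 < ℓ) {M : ℕ} (hM : L ≤ M * ℓ) (z : Space d) :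
    cube L z ⊆ ⋃ n : Fin d → Fin M,
      cube ℓ (WithLp.toLp 2 fun i => z i - L / 2 + ℓ / 2 + (n i : ℕ) * ℓ) := by
  intro x hx
  have ht : ∀ i, 0 ≤ (x i - z i + L / 2) / ℓ := fun i =>
    div_nonneg (by linarith [(hx i).1]) hℓ.le
  have hlt : ∀ i, (x i - z i + L / 2) / ℓ < M := fun i => by
    rw [div_lt_iff₀ hℓ]
    linarith [(hx i).2]
  refine mem_iUnion.mpr ⟨fun i => ⟨⌊(x i - z i + L / 2) / ℓ⌋₊, (Nat.floor_lt (ht i)).mpr (hlt i)⟩,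
    fun i => ?_⟩
  have h1 := Nat.floor_le (ht i)
  have h2 := Nat.lt_floor_add_one ((x i - z i + L / 2) / ℓ)
  rw [le_div_iff₀ hℓ] at h1
  rw [div_lt_iff₀ hℓ] at h2
  constructor <;> simp only <;> linarith

/-- Pairs at distance less than `r` in the maximum norm, the first point being in the centred cube
of sidelength `N`. -/
def nearPairs (d : ℕ) (N r : ℝ) : Set (Space d × Space d) :=
  {p | p.1 ∈ cube N 0 ∧ ∀ i, |p.1 i - p.2 i| < r}

theorem measurableSet_nearPairs (N r : ℝ) : MeasurableSet (nearPairs d N r) := by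
  have : nearPairs d N r = (Prod.fst ⁻¹' cube N 0) ∩
      ⋂ i, {p : Space d × Space d | |p.1 i - p.2 i| < r} := by
    ext p
    simp [nearPairs]
  rw [this]
  refine (measurable_fst (measurableSet_cube N 0)).inter (MeasurableSet.iInter fun i => ?_)
  have h : Continuous fun p : Space d × Space d => |p.1 i - p.2 i| := by fun_prop
  exact measurableSet_lt h.measurable measurable_const

namespace PointSet

theorem pairSum_mono (P : PointSet d) {ζ ξ : Space d × Space d → ℝ≥0∞} (h : ζ ≤ ξ) :
    P.pairSum ζ ≤ P.pairSum ξ :=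
  ENNReal.tsum_le_tsum fun _ => h _

theorem pairSum_finsetSum (P : PointSet d) {ι : Type*} (s : Finset ι)
    (ζ : ι → Space d × Space d → ℝ≥0∞) :
    P.pairSum (∑ i ∈ s, ζ i) = ∑ i ∈ s, P.pairSum (ζ i) := by
  simp only [pairSum, Finset.sum_apply]
  exact Summable.tsum_finsetSum fun i _ => ENNReal.summable

theorem separation_le (P : PointSet d) {x y : Space d} (hx : x ∈ P.carrier) (hy : y ∈ P.carrier)
    (h : x ≠ y) : P.separation ≤ edist (WithLp.ofLp x) (WithLp.ofLp y) := by
  rw [separation]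
  exact iInf₂_le_of_le x hx (iInf₂_le_of_le y hy (iInf_le _ h))

end PointSet

theorem lintegral_pairSum_le_of_cover {ℙ : Measure (PointSet d)} {ι : Type*} [Fintype ι]
    {E : Set (Space d × Space d)} {A : ι → Set (Space d × Space d)}
    (hA : ∀ i, MeasurableSet (A i)) (hE : E ⊆ ⋃ i, A i) {b : ℝ≥0∞}
    (hb : ∀ i, ∫⁻ P, P.pairSum ((A i).indicator 1) ∂ℙ ≤ b) :
    ∫⁻ P, P.pairSum (E.indicator 1) ∂ℙ ≤ Fintype.card ι * b := by
  have h1 : ∀ P : PointSet d, P.pairSum (E.indicator 1)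
      ≤ ∑ i, P.pairSum ((A i).indicator 1) := by
    intro P
    rw [← PointSet.pairSum_finsetSum]
    refine P.pairSum_mono fun p => ?_
    by_cases hp : p ∈ E
    · obtain ⟨i, hi⟩ := mem_iUnion.mp (hE hp)
      rw [indicator_of_mem hp, Finset.sum_apply]
      refine le_trans ?_ (Finset.single_le_sum (fun _ _ => zero_le) (Finset.mem_univ i))
      rw [indicator_of_mem hi]
    · rw [indicator_of_notMem hp]
      exact zero_le
  calc ∫⁻ P, P.pairSum (E.indicator 1) ∂ℙ
      ≤ ∫⁻ P, ∑ i, P.pairSum ((A i).indicator 1) ∂ℙ := lintegral_mono h1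
    _ = ∑ i, ∫⁻ P, P.pairSum ((A i).indicator 1) ∂ℙ :=
        lintegral_finsetSum _ fun i _ =>
          PointSet.measurable_pairSum (measurable_one.indicator (hA i))
    _ ≤ ∑ _i : ι, b := Finset.sum_le_sum fun i _ => hb i
    _ = _ := by simp

theorem lintegral_nearPairs_eq_zero {ℙ : Measure (PointSet d)} {r : ℝ} (hr : 0 < r) (N : ℝ)
    (h : ENNReal.ofReal r ≤ minimalLength ℙ) :
    ∫⁻ P, P.pairSum ((nearPairs d N r).indicator 1) ∂ℙ = 0 := by
  rw [lintegral_eq_zero_iff (PointSet.measurable_pairSum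
    (measurable_one.indicator (measurableSet_nearPairs N r)))]
  filter_upwards [ae_essInf_le (f := PointSet.separation) (μ := ℙ)] with P hP
  refine ENNReal.tsum_eq_zero.mpr ?_
  rintro ⟨⟨⟨x, hx⟩, ⟨y, hy⟩⟩, hxy⟩
  refine indicator_of_notMem (fun hmem => ?_) _
  have hne : x ≠ y := fun h => hxy (Subtype.ext h)
  have h1 := (h.trans hP).trans (P.separation_le hx hy hne)
  rw [edist_dist, ENNReal.ofReal_le_ofReal_iff dist_nonneg] at h1
  have h2 : dist (WithLp.ofLp x) (WithLp.ofLp y) < r := by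
    rw [dist_pi_lt_iff hr]
    exact fun i => hmem.2 i
  linarith

theorem lintegral_nearPairs_le_of_density {ℙ : Measure (PointSet d)}
    {f : Space d × Space d → ℝ≥0∞} (hf : IsTwoPointDensity ℙ f) {Λ : ℝ≥0∞}
    (hΛ : essSup f volume ≤ Λ) {N r : ℝ} (hN : 0 ≤ N) (hr : 0 ≤ r) :
    ∫⁻ P, P.pairSum ((nearPairs d N r).indicator 1) ∂ℙ
      ≤ Λ * ENNReal.ofReal (N ^ d * (2 * r) ^ d) := by
  rw [hf.2 _ (measurable_one.indicator (measurableSet_nearPairs N r))]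
  have h1 : ∀ᵐ p ∂(volume : Measure (Space d × Space d)),
      (nearPairs d N r).indicator 1 p * f p ≤ (nearPairs d N r).indicator (fun _ => Λ) p := by
    filter_upwards [ENNReal.ae_le_essSup (μ := (volume : Measure (Space d × Space d))) f]
      with p hp
    by_cases h : p ∈ nearPairs d N r
    · simpa [h] using hp.trans hΛ
    · simp [h]
  refine (lintegral_mono_ae h1).trans ?_
  rw [lintegral_indicator_const (measurableSet_nearPairs N r)]
  gcongr
  rw [Measure.volume_eq_prod, Measure.prod_apply (measurableSet_nearPairs N r)]
  have h2 : ∀ x : Space d, volume (Prod.mk x ⁻¹' nearPairs d N r)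
      ≤ (cube N 0).indicator (fun _ => ENNReal.ofReal ((2 * r) ^ d)) x := by
    intro x
    by_cases hx : x ∈ cube N 0
    · rw [indicator_of_mem hx, ← volume_cube (by positivity) x]
      refine measure_mono fun y hy i => ?_
      have := abs_lt.mp (hy.2 i)
      simp only at this
      constructor <;> linarith
    · rw [indicator_of_notMem hx, nonpos_iff_eq_zero]
      have : Prod.mk x ⁻¹' nearPairs d N r = ∅ := by
        ext y
        simp [nearPairs, hx]
      rw [this, measure_empty]
  refine (lintegral_mono h2).trans ?_
  rw [lintegral_indicator_const (measurableSet_cube N 0), volume_cube hN,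
    ENNReal.ofReal_mul (by positivity), mul_comm]

/-- Below the minimal length there are no pairs. If ℓ = 0, the two-point density is integrated. If 0
< ℓ < r, the pairs are covered by products of cubes of side ℓ, each with expected count at most Λ
ℓ^{2d}. A strictly larger Λ is used because for ℓ = 0 the intensity is written as an infimum over
densities. -/
theorem lintegral_nearPairs_le {ℙ : Measure (PointSet d)} {Λ : ℝ≥0∞}
    (hΛ : secondIntensity ℙ < Λ) {N r : ℝ} (hN : 0 < N) (hr : 0 < r) :
    ∫⁻ P, P.pairSum ((nearPairs d N r).indicator 1) ∂ℙ
      ≤ Λ * ENNReal.ofReal ((N + r) ^ d * (4 * r) ^ d) := by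
  rcases le_or_gt (ENNReal.ofReal r) (minimalLength ℙ) with h | h
  · rw [lintegral_nearPairs_eq_zero hr N h]
    exact zero_le
  rcases eq_or_ne (minimalLength ℙ) 0 with h0 | h0
  · rw [secondIntensity, if_pos h0] at hΛ
    simp only [iInf_lt_iff] at hΛ
    obtain ⟨f, hf, hlt⟩ := hΛ
    refine (lintegral_nearPairs_le_of_density hf hlt.le hN.le hr.le).trans ?_
    gcongr <;> linarith
  · rw [secondIntensity, if_neg h0] at hΛ
    have htop : minimalLength ℙ ≠ ∞ := (h.trans ENNReal.ofReal_lt_top).ne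
    set ℓ : ℝ := (minimalLength ℙ).toReal with hℓ
    have hℓ0 : 0 < ℓ := ENNReal.toReal_pos h0 htop
    have hℓeq : minimalLength ℙ = ENNReal.ofReal ℓ := (ENNReal.ofReal_toReal htop).symm
    have hℓr : ℓ < r := by
      rw [hℓeq] at h
      exact (ENNReal.ofReal_lt_ofReal_iff hr).mp h
    have hpair : ∀ z₁ z₂ : Space d, ∫⁻ P, P.pairSum ((cube ℓ z₁ ×ˢ cube ℓ z₂).indicator 1) ∂ℙ
        ≤ Λ * (ENNReal.ofReal (ℓ ^ d) * ENNReal.ofReal (ℓ ^ d)) := by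
      intro z₁ z₂
      have h1 : (minimalLength ℙ)⁻¹ ^ d * (minimalLength ℙ)⁻¹ ^ d *
        ∫⁻ P, P.pairSum ((cube ℓ z₁ ×ˢ cube ℓ z₂).indicator 1) ∂ℙ ≤ Λ :=
        (le_iSup₂ (f := fun z₁ z₂ => (minimalLength ℙ)⁻¹ ^ d * (minimalLength ℙ)⁻¹ ^ d *
          ∫⁻ P, P.pairSum ((cube ℓ z₁ ×ˢ cube ℓ z₂).indicator 1) ∂ℙ) z₁ z₂).trans hΛ.le
      rw [← ENNReal.inv_pow, ← ENNReal.mul_inv (by simp [h0]) (by simp [h0]), mul_comm,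
        ← div_eq_mul_inv] at h1
      rw [ENNReal.ofReal_pow hℓ0.le, ← hℓeq]
      refine (ENNReal.div_le_iff ?_ ?_).mp h1
      · exact mul_ne_zero (pow_ne_zero _ h0) (pow_ne_zero _ h0)
      · exact ENNReal.mul_ne_top (ENNReal.pow_ne_top htop) (ENNReal.pow_ne_top htop)
    -- M₁ cubes per direction cover the large cube. Around each of them M₂ per direction cover all
    -- partners, which lie in a cube of side ℓ + 2r. Rounding up costs at most ℓ < r, whence M₁ℓ ≤ N
    -- + r and M₂ℓ ≤ 4r.
    let M₁ : ℕ := ⌈N / ℓ⌉₊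
    let M₂ : ℕ := ⌈(ℓ + 2 * r) / ℓ⌉₊
    have hM₁ : N ≤ M₁ * ℓ := by
      rw [← div_le_iff₀ hℓ0]
      exact Nat.le_ceil _
    have hM₂ : ℓ + 2 * r ≤ M₂ * ℓ := by
      rw [← div_le_iff₀ hℓ0]
      exact Nat.le_ceil _
    have hM₁' : M₁ * ℓ ≤ N + r := by
      have h2 : (M₁ : ℝ) < N / ℓ + 1 := Nat.ceil_lt_add_one (by positivity)
      calc (M₁ : ℝ) * ℓ ≤ (N / ℓ + 1) * ℓ := by gcongr
        _ = N + ℓ := by field_simp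
        _ ≤ N + r := by linarith
    have hM₂' : M₂ * ℓ ≤ 4 * r := by
      have h2 : (M₂ : ℝ) < (ℓ + 2 * r) / ℓ + 1 := Nat.ceil_lt_add_one (by positivity)
      calc (M₂ : ℝ) * ℓ ≤ ((ℓ + 2 * r) / ℓ + 1) * ℓ := by gcongr
        _ = ℓ + 2 * r + ℓ := by field_simp
        _ ≤ 4 * r := by linarith
    let Z₁ : (Fin d → Fin M₁) → Space d := fun n =>
      WithLp.toLp 2 fun i => (0 : Space d) i - N / 2 + ℓ / 2 + (n i : ℕ) * ℓ
    let Z₂ : Space d → (Fin d → Fin M₂) → Space d := fun z n =>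
      WithLp.toLp 2 fun i => z i - (ℓ + 2 * r) / 2 + ℓ / 2 + (n i : ℕ) * ℓ
    have hcover : nearPairs d N r ⊆ ⋃ k : (Fin d → Fin M₁) × (Fin d → Fin M₂),
        cube ℓ (Z₁ k.1) ×ˢ cube ℓ (Z₂ (Z₁ k.1) k.2) := by
      rintro ⟨x, y⟩ ⟨hx, hxy⟩
      obtain ⟨n₁, hn₁⟩ := mem_iUnion.mp (cube_subset_iUnion_cube hℓ0 hM₁ 0 hx)
      have hy : y ∈ cube (ℓ + 2 * r) (Z₁ n₁) := by
        intro i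
        have h2 := abs_lt.mp (hxy i)
        have h3 := hn₁ i
        simp only at h2 h3
        constructor <;> simp only [Z₁] <;> linarith
      obtain ⟨n₂, hn₂⟩ := mem_iUnion.mp (cube_subset_iUnion_cube hℓ0 hM₂ (Z₁ n₁) hy)
      exact mem_iUnion.mpr ⟨(n₁, n₂), hn₁, hn₂⟩
    refine (lintegral_pairSum_le_of_cover
      (fun k => (measurableSet_cube _ _).prod (measurableSet_cube _ _)) hcover
      fun k => hpair _ _).trans ?_
    rw [mul_left_comm]
    gcongr
    simp only [Fintype.card_prod, Fintype.card_pi, Fintype.card_fin, Finset.prod_const,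
      Finset.card_univ]
    rw [← ENNReal.ofReal_mul (by positivity), ← ENNReal.ofReal_natCast,
      ← ENNReal.ofReal_mul (by positivity)]
    refine ENNReal.ofReal_le_ofReal ?_
    push_cast
    calc ((M₁ : ℝ) ^ d * (M₂ : ℝ) ^ d) * (ℓ ^ d * ℓ ^ d)
        = (M₁ * ℓ) ^ d * (M₂ * ℓ) ^ d := by rw [mul_pow, mul_pow]; ring
      _ ≤ _ := by gcongr

/-! ### Well-separated inclusions of a point set -/

theorem abs_apply_sub_le_dist (x y : Space d) (i : Fin d) : |x i - y i| ≤ dist x y := by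
  rw [dist_eq_norm, ← Real.norm_eq_abs]
  exact PiLp.norm_apply_le (x - y) i

theorem volume_real_cube {r : ℝ} (hr : 0 ≤ r) (z : Space d) : volume.real (cube r z) = r ^ d := by
  rw [measureReal_def, volume_cube hr, ENNReal.toReal_ofReal (by positivity)]

theorem cube_subset_cube {r s : ℝ} (h : r ≤ s) (z : Space d) : cube r z ⊆ cube s z :=
  fun _ hx i => ⟨by linarith [(hx i).1], by linarith [(hx i).2]⟩

theorem isBounded_cube (r : ℝ) (z : Space d) : Bornology.IsBounded (cube r z) := by
  rcases le_or_gt r 0 with hr | hr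
  · rcases isEmpty_or_nonempty (Fin d) with h | ⟨⟨i⟩⟩
    · have : Subsingleton (Space d) := ⟨fun a b => PiLp.ext fun i => h.elim i⟩
      exact (Set.subsingleton_of_subsingleton (s := cube r z)).finite.isBounded
    · refine Bornology.isBounded_empty.subset fun x hx => ?_
      have := hx i
      linarith [this.1, this.2]
  · have h1 : Bornology.IsBounded (Metric.closedBall (WithLp.ofLp z) r) := Metric.isBounded_closedBall
    have h2 := (PiLp.antilipschitzWith_ofLp 2 (fun _ : Fin d => ℝ)).isBounded_preimage h1
    refine h2.subset fun x hx => ?_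
    rw [mem_preimage, Metric.mem_closedBall, dist_pi_le_iff hr.le]
    intro i
    rw [Real.dist_eq, abs_le]
    constructor <;> linarith [(hx i).1, (hx i).2]

namespace PointSet

/-- `x` has a neighbour at distance less than `r` in the maximum norm. -/
def HasNeighbour (P : PointSet d) (r : ℝ) (x : Space d) : Prop :=
  ∃ y ∈ P.carrier, x ≠ y ∧ ∀ i, |x i - y i| < r

/-- The number of ordered pairs of points with distance less than `r`, the first one being in the
centred cube of sidelength `N`. -/
def pairCount (P : PointSet d) (N r : ℝ) : ℝ≥0∞ := P.pairSum ((nearPairs d N r).indicator 1)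

theorem card_le_pairCount (P : PointSet d) {N r : ℝ} {t : Finset (Space d)}
    (ht : ∀ x ∈ t, x ∈ P.carrier ∧ x ∈ cube N 0 ∧ P.HasNeighbour r x)
    (hfin : P.pairCount N r ≠ ∞) : (t.card : ℝ) ≤ (P.pairCount N r).toReal := by
  choose! y hy using fun x hx => (ht x hx).2.2
  let f : t → {p : P.carrier × P.carrier // p.1 ≠ p.2} := fun x =>
    ⟨(⟨x, (ht x x.2).1⟩, ⟨y x, (hy x x.2).1⟩), fun h => (hy x x.2).2.1 (congrArg Subtype.val h)⟩
  have hf : Function.Injective f := by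
    intro a b hab
    have := congrArg (fun p : {p : P.carrier × P.carrier // p.1 ≠ p.2} => (p.1.1 : Space d)) hab
    exact Subtype.ext this
  have h1 := ENNReal.tsum_comp_le_tsum_of_injective hf fun p =>
    (nearPairs d N r).indicator (1 : Space d × Space d → ℝ≥0∞) ((p.1.1 : Space d), (p.1.2 : Space d))
  have h2 : ∀ x : t, (nearPairs d N r).indicator (1 : Space d × Space d → ℝ≥0∞)
      (((f x).1.1 : Space d), ((f x).1.2 : Space d)) = 1 := fun x =>
    indicator_of_mem (show _ ∈ nearPairs d N r from ⟨(ht x x.2).2.1, (hy x x.2).2.2⟩) _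
  simp only [h2] at h1
  have h3 : (t.card : ℝ≥0∞) ≤ P.pairCount N r := by
    refine le_trans ?_ h1
    simp
  exact (ENNReal.ofReal_le_iff_le_toReal hfin).mp (by simpa using h3)

open scoped Classical in
/-- The largest `k ≤ K` such that `x` has no neighbour at distance less than `2 ^ (k + 1)`. -/
def level (P : PointSet d) (K : ℕ) (x : Space d) : ℕ :=
  Nat.findGreatest (fun k => ¬P.HasNeighbour (2 ^ (k + 1)) x) K

theorem level_spec {P : PointSet d} {K : ℕ} (hK : 1 ≤ K) {x : Space d}
    (hx : ¬P.HasNeighbour 4 x) :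
    1 ≤ P.level K x ∧ P.level K x ≤ K ∧ ¬P.HasNeighbour (2 ^ (P.level K x + 1)) x := by
  classical
  have h1 : ¬P.HasNeighbour (2 ^ (1 + 1)) x := by
    norm_num
    exact hx
  refine ⟨Nat.le_findGreatest hK h1, Nat.findGreatest_le K, ?_⟩
  exact Nat.findGreatest_spec (P := fun k => ¬P.HasNeighbour (2 ^ (k + 1)) x) hK h1

theorem hasNeighbour_of_level_lt {P : PointSet d} {K : ℕ} {x : Space d} (h : P.level K x < K) :
    P.HasNeighbour (2 ^ (P.level K x + 2)) x := by
  classical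
  have := Nat.findGreatest_is_greatest (P := fun k => ¬P.HasNeighbour (2 ^ (k + 1)) x)
    (Nat.lt_succ_self (P.level K x)) h
  simpa [add_assoc] using this

-- A level k below the cap is maximal because of a neighbour within 2^{k+2}, so the weight occurs in
-- the sum; otherwise the level is K. This replaces a sum over points by pair counts, one for each
-- dyadic scale.
open scoped Classical in
theorem inv_pow_level_le {P : PointSet d} {K : ℕ} (hK : 1 ≤ K) {x : Space d}
    (hx : ¬P.HasNeighbour 4 x) :
    (((2 : ℝ) ^ P.level K x) ^ d)⁻¹ ≤ (((2 : ℝ) ^ K) ^ d)⁻¹ +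
      ∑ k ∈ Finset.Ico 1 K, (((2 : ℝ) ^ k) ^ d)⁻¹ *
        if P.HasNeighbour (2 ^ (k + 2)) x then 1 else 0 := by
  have hnn : ∀ k ∈ Finset.Ico 1 K, 0 ≤ (((2 : ℝ) ^ k) ^ d)⁻¹ *
      if P.HasNeighbour (2 ^ (k + 2)) x then 1 else 0 := by
    intro k _
    split_ifs <;> positivity
  obtain ⟨h1, h2, -⟩ := level_spec hK hx
  rcases h2.lt_or_eq with h | h
  · have h3 := Finset.single_le_sum hnn (Finset.mem_Ico.mpr ⟨h1, h⟩)
    rw [if_pos (hasNeighbour_of_level_lt h), mul_one] at h3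
    have : (0 : ℝ) ≤ (((2 : ℝ) ^ K) ^ d)⁻¹ := by positivity
    linarith
  · rw [h]
    linarith [Finset.sum_nonneg hnn]

theorem lt_dist_of_not_hasNeighbour {P : PointSet d} {r : ℝ} {x y : Space d}
    (h : ¬P.HasNeighbour r x) (hy : y ∈ P.carrier) (hne : x ≠ y) : r ≤ dist x y := by
  by_contra! hlt
  exact h ⟨y, hy, hne, fun i => (abs_apply_sub_le_dist x y i).trans_lt hlt⟩

/-- The well-separated points of `P` in the centred cube of sidelength `N`. -/
def goodPoints (P : PointSet d) (K : ℕ) (N : ℝ) : Set (Space d) :=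
  {x | x ∈ P.carrier ∧ ¬P.HasNeighbour 4 x ∧ Metric.ball x (2 ^ P.level K x) ⊆ cube N 0}

theorem goodPoints_finite (P : PointSet d) (K : ℕ) (N : ℝ) : (P.goodPoints K N).Finite :=
  (P.finite_inter (cube N 0) (isBounded_cube N 0)).subset fun _ hx =>
    ⟨hx.1, hx.2.2 (Metric.mem_ball_self (by positivity))⟩

/-- The inclusions in the cube that do not belong to well-separated points. -/
def badRegion (P : PointSet d) (K : ℕ) (N : ℝ) : Set (Space d) :=
  (P.inclusions ∩ cube N 0) \ ⋃ x ∈ (P.goodPoints_finite K N).toFinset, Metric.ball x 1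

/-- With no neighbour within 2^{l+1}, the radius 2^l is at most half the distance to any other
point, which gives disjointness. Level at least 1 makes 2^l + 1 ≤ 2^{l+1}, so other inclusions miss
the ball. The maximum norm is dominated by the Euclidean one. -/
theorem isGoodFamily_goodPoints (P : PointSet d) {K : ℕ} (hK : 1 ≤ K) (N : ℝ) :
    IsGoodFamily P.inclusions (cube N 0) (P.badRegion K N) (P.goodPoints_finite K N).toFinset
      fun x => 2 ^ P.level K x where
  radius x hx := by
    rw [Set.Finite.mem_toFinset] at hx
    calc (2 : ℝ) = 2 ^ 1 := by norm_num
      _ ≤ _ := pow_le_pow_right₀ (by norm_num) (level_spec hK hx.2.1).1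
  subset x hx := by
    rw [Set.Finite.mem_toFinset] at hx
    exact hx.2.2
  disjoint := by
    intro x hx y hy hne
    rw [Finset.mem_coe, Set.Finite.mem_toFinset] at hx hy
    have h1 := lt_dist_of_not_hasNeighbour (level_spec hK hx.2.1).2.2 hy.1 hne
    have h2 := lt_dist_of_not_hasNeighbour (level_spec hK hy.2.1).2.2 hx.1 hne.symm
    rw [dist_comm] at h2
    rw [pow_succ] at h1 h2
    exact Metric.ball_disjoint_ball (by linarith)
  inter x hx := by
    rw [Set.Finite.mem_toFinset] at hx
    have hl := level_spec hK hx.2.1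
    have h2 : (2 : ℝ) ≤ 2 ^ P.level K x := by
      calc (2 : ℝ) = 2 ^ 1 := by norm_num
        _ ≤ _ := pow_le_pow_right₀ (by norm_num) hl.1
    refine Subset.antisymm ?_ fun z hz => ⟨mem_biUnion hx.1 hz,
      Metric.ball_subset_ball (by linarith) hz⟩
    rintro z ⟨hz, hzx⟩
    obtain ⟨y, hy, hzy⟩ := mem_inclusions.mp hz
    rcases eq_or_ne x y with rfl | hne
    · exact hzy
    · exfalso
      have h1 := lt_dist_of_not_hasNeighbour hl.2.2 hy hne
      rw [Metric.mem_ball, dist_comm] at hzx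
      rw [pow_succ] at h1
      linarith [dist_triangle x z y]
  rest := rfl

theorem measurableSet_badRegion (P : PointSet d) (K : ℕ) (N : ℝ) :
    MeasurableSet (P.badRegion K N) :=
  (P.isOpen_inclusions.measurableSet.inter (measurableSet_cube N 0)).diff
    (Finset.measurableSet_biUnion _ fun _ _ => measurableSet_ball)

end PointSet

theorem IsGoodFamily.card_mul_le {S Q Z : Set (Space d)} {s : Finset (Space d)} {ρ : Space d → ℝ}
    (h : IsGoodFamily S Q Z s ρ) (hQv : volume Q ≠ ∞) :
    s.card * ballVol d ≤ volume.real Q := by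
  have h1 : (s : Set (Space d)).PairwiseDisjoint fun x => Metric.ball x 1 := fun x hx y hy hne =>
    (h.disjoint hx hy hne).mono (h.ball_subset hx) (h.ball_subset hy)
  have h2 := measureReal_biUnion_finset (μ := (volume : Measure (Space d))) h1
    (fun _ _ => measurableSet_ball) (fun _ _ => measure_ball_lt_top.ne)
  simp only [volume_real_ball, Finset.sum_const, nsmul_eq_mul] at h2
  rw [← h2]
  refine measureReal_mono (iUnion₂_subset fun x hx => (h.ball_subset hx).trans (h.subset x hx)) hQv

namespace PointSet

/-- A bad inclusion has a neighbour within 4, or its separation ball leaves the cube. In the second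
case each of its points is within 2^K + 1 of the boundary, so the side shrinks by twice that amount.
In the first case the centre lies at distance less than 1 from the cube, whence the side N + 2. -/
theorem badRegion_subset (P : PointSet d) {K : ℕ} (hK : 1 ≤ K) (N : ℝ) :
    P.badRegion K N ⊆ (cube N 0 \ cube (N - (2 ^ (K + 1) + 2)) 0) ∪
      ⋃ x ∈ {x | x ∈ P.carrier ∩ cube (N + 2) 0 ∧ P.HasNeighbour 4 x}, Metric.ball x 1 := by
  rintro z ⟨⟨hz, hzQ⟩, hzs⟩
  obtain ⟨x, hx, hzx⟩ := mem_inclusions.mp hz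
  have hcoord : ∀ i, |z i - x i| < 1 := fun i => (abs_apply_sub_le_dist z x i).trans_lt hzx
  by_cases hn : P.HasNeighbour 4 x
  · right
    refine mem_biUnion (x := x) ⟨⟨hx, fun i => ?_⟩, hn⟩ hzx
    have h1 := abs_lt.mp (hcoord i)
    have h2 := hzQ i
    simp only [PiLp.zero_apply] at h2 ⊢
    constructor <;> linarith
  · left
    refine ⟨hzQ, fun hzin => hzs ?_⟩
    refine mem_biUnion (x := x) ?_ hzx
    rw [Finset.mem_coe, Set.Finite.mem_toFinset]
    refine ⟨hx, hn, fun w hw i => ?_⟩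
    have hl := level_spec hK hn
    have h1 := abs_lt.mp (hcoord i)
    have h2 := hzin i
    have h3 := abs_lt.mp ((abs_apply_sub_le_dist w x i).trans_lt (Metric.mem_ball.mp hw))
    have h4 : (2 : ℝ) ^ P.level K x ≤ 2 ^ K := pow_le_pow_right₀ (by norm_num) hl.2.1
    simp only [PiLp.zero_apply, pow_succ] at h2 ⊢
    constructor <;> linarith

theorem volume_real_badRegion_le (P : PointSet d) {K : ℕ} (hK : 1 ≤ K) {N : ℝ}
    (hN : 2 ^ (K + 1) + 2 ≤ N) (hfin : P.pairCount (N + 2) 4 ≠ ∞) :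
    volume.real (P.badRegion K N) ≤ (N ^ d - (N - (2 ^ (K + 1) + 2)) ^ d)
      + ballVol d * (P.pairCount (N + 2) 4).toReal := by
  have hpos : (0 : ℝ) < 2 ^ (K + 1) + 2 := by positivity
  have htfin : {x | x ∈ P.carrier ∩ cube (N + 2) 0 ∧ P.HasNeighbour 4 x}.Finite :=
    (P.finite_inter _ (isBounded_cube (N + 2) 0)).subset fun _ hx => hx.1
  have hcard := P.card_le_pairCount (N := N + 2) (r := 4) (t := htfin.toFinset)
    (fun x hx => by
      rw [Set.Finite.mem_toFinset] at hx
      exact ⟨hx.1.1, hx.1.2, hx.2⟩) hfin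
  have h1 : volume.real (cube N 0 \ cube (N - (2 ^ (K + 1) + 2)) (0 : Space d))
      = N ^ d - (N - (2 ^ (K + 1) + 2)) ^ d := by
    rw [measureReal_sdiff (cube_subset_cube (by linarith) 0) (measurableSet_cube _ _)
      (by rw [volume_cube (by linarith)]; exact ENNReal.ofReal_ne_top),
      volume_real_cube (by linarith), volume_real_cube (by linarith)]
  have h2 : volume.real (⋃ x ∈ htfin.toFinset, Metric.ball x 1)
      ≤ htfin.toFinset.card * ballVol d := by
    refine (measureReal_biUnion_finset_le _ _).trans (le_of_eq ?_)
    simp [volume_real_ball]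
  have hsub := P.badRegion_subset hK N
  have hU : (⋃ x ∈ {x | x ∈ P.carrier ∩ cube (N + 2) 0 ∧ P.HasNeighbour 4 x}, Metric.ball x 1)
      = ⋃ x ∈ htfin.toFinset, Metric.ball x 1 := by
    simp only [Set.Finite.mem_toFinset]
  rw [hU] at hsub
  have hv1 : volume (cube N 0 \ cube (N - (2 ^ (K + 1) + 2)) (0 : Space d)) ≠ ∞ := by
    refine ((measure_mono sdiff_subset).trans_lt ?_).ne
    rw [volume_cube (by linarith)]
    exact ENNReal.ofReal_lt_top
  have hv2 : volume (⋃ x ∈ htfin.toFinset, Metric.ball x 1) ≠ ∞ :=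
    ((measure_biUnion_finset_le _ _).trans_lt
      (ENNReal.sum_lt_top.mpr fun _ _ => measure_ball_lt_top)).ne
  calc volume.real (P.badRegion K N)
      ≤ volume.real ((cube N 0 \ cube (N - (2 ^ (K + 1) + 2)) (0 : Space d)) ∪
          ⋃ x ∈ htfin.toFinset, Metric.ball x 1) :=
        measureReal_mono hsub (measure_union_ne_top hv1 hv2)
    _ ≤ _ := measureReal_union_le _ _
    _ ≤ _ := by
        rw [h1]
        have := mul_le_mul_of_nonneg_right hcard (ballVol_pos (d := d)).le
        linarith

/-- The term 2^{-Kd} is paid once per good point, and a packing of disjoint unit balls bounds their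
number without using the intensity of the process. -/
theorem sum_inv_pow_level_le (P : PointSet d) {K : ℕ} (hK : 1 ≤ K) {N : ℝ} (hN : 0 ≤ N)
    (hfin : ∀ k ∈ Finset.Ico 1 K, P.pairCount N (2 ^ (k + 2)) ≠ ∞) :
    ∑ x ∈ (P.goodPoints_finite K N).toFinset, (((2 : ℝ) ^ P.level K x) ^ d)⁻¹
      ≤ (ballVol d)⁻¹ * N ^ d * ((2 ^ K) ^ d)⁻¹ +
        ∑ k ∈ Finset.Ico 1 K, ((2 ^ k) ^ d)⁻¹ * (P.pairCount N (2 ^ (k + 2))).toReal := by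
  classical
  set s := (P.goodPoints_finite K N).toFinset with hs
  have hmem : ∀ x ∈ s, x ∈ P.goodPoints K N := fun x hx => (Set.Finite.mem_toFinset _).mp hx
  have h1 : ∑ x ∈ s, (((2 : ℝ) ^ P.level K x) ^ d)⁻¹ ≤ ∑ x ∈ s, ((((2 : ℝ) ^ K) ^ d)⁻¹ +
      ∑ k ∈ Finset.Ico 1 K, (((2 : ℝ) ^ k) ^ d)⁻¹ *
        if P.HasNeighbour (2 ^ (k + 2)) x then 1 else 0) :=
    Finset.sum_le_sum fun x hx => inv_pow_level_le hK (hmem x hx).2.1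
  refine h1.trans ?_
  rw [Finset.sum_add_distrib, Finset.sum_comm]
  refine add_le_add ?_ (Finset.sum_le_sum fun k hk => ?_)
  · have h2 := (P.isGoodFamily_goodPoints hK N).card_mul_le
      (by rw [volume_cube hN]; exact ENNReal.ofReal_ne_top)
    rw [volume_real_cube hN, ← le_div_iff₀ ballVol_pos] at h2
    rw [Finset.sum_const, nsmul_eq_mul]
    have : (ballVol d)⁻¹ * N ^ d = N ^ d / ballVol d := by ring
    rw [this]
    gcongr
  · rw [← Finset.mul_sum]
    gcongr
    rw [Finset.sum_boole]
    refine P.card_le_pairCount (fun x hx => ?_) (hfin k hk)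
    rw [Finset.mem_filter] at hx
    have := hmem x hx.1
    exact ⟨this.1, this.2.2 (Metric.mem_ball_self (by positivity)), hx.2⟩

end PointSet

/-! #### Expected size of the geometric error -/

theorem pairCount_expectation {ℙ : Measure (PointSet d)} {Λ : ℝ} (hΛ0 : 0 ≤ Λ)
    (hΛ : secondIntensity ℙ < ENNReal.ofReal Λ) {N r : ℝ} (hN : 0 < N) (hr : 0 < r) :
    (∀ᵐ P ∂ℙ, P.pairCount N r ≠ ∞) ∧ Integrable (fun P => (P.pairCount N r).toReal) ℙ ∧
      ∫ P, (P.pairCount N r).toReal ∂ℙ ≤ Λ * ((N + r) ^ d * (4 * r) ^ d) := by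
  have h1 : ∫⁻ P, P.pairCount N r ∂ℙ ≤ ENNReal.ofReal (Λ * ((N + r) ^ d * (4 * r) ^ d)) := by
    rw [ENNReal.ofReal_mul hΛ0]
    exact lintegral_nearPairs_le hΛ hN hr
  have hmeas : Measurable fun P : PointSet d => P.pairCount N r :=
    PointSet.measurable_pairSum (measurable_one.indicator (measurableSet_nearPairs N r))
  have hfin : ∫⁻ P, P.pairCount N r ∂ℙ ≠ ∞ := (h1.trans_lt ENNReal.ofReal_lt_top).ne
  have hae := ae_lt_top hmeas hfin
  refine ⟨hae.mono fun P h => h.ne, integrable_toReal_of_lintegral_ne_top hmeas.aemeasurable hfin, ?_⟩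
  rw [integral_toReal hmeas.aemeasurable hae]
  exact ENNReal.toReal_le_of_le_ofReal (by positivity) h1

/-- A measurable bound for the total weight of well-separated inclusions and the volume of the
others. -/
def geometricError (K : ℕ) (N : ℝ) (P : PointSet d) : ℝ :=
  ((ballVol d)⁻¹ * N ^ d * ((2 ^ K) ^ d)⁻¹ +
    ∑ k ∈ Finset.Ico 1 K, ((2 ^ k) ^ d)⁻¹ * (P.pairCount N (2 ^ (k + 2))).toReal) +
  ((N ^ d - (N - (2 ^ (K + 1) + 2)) ^ d) + ballVol d * (P.pairCount (N + 2) 4).toReal)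

theorem ae_le_geometricError {ℙ : Measure (PointSet d)} {Λ : ℝ} (hΛ0 : 0 ≤ Λ)
    (hΛ : secondIntensity ℙ < ENNReal.ofReal Λ) {K : ℕ} (hK : 1 ≤ K) {N : ℝ}
    (hN : 2 ^ (K + 1) + 2 ≤ N) : ∀ᵐ P ∂ℙ,
      ∑ x ∈ (P.goodPoints_finite K N).toFinset, (((2 : ℝ) ^ P.level K x) ^ d)⁻¹
        + volume.real (P.badRegion K N) ≤ geometricError K N P := by
  have hN0 : 0 < N := lt_of_lt_of_le (by positivity) hN
  have h1 : ∀ᵐ P ∂ℙ, ∀ k ∈ Finset.Ico 1 K, P.pairCount N (2 ^ (k + 2)) ≠ ∞ :=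
    (Finset.eventually_all _).mpr fun k _ =>
      (pairCount_expectation hΛ0 hΛ hN0 (r := 2 ^ (k + 2)) (by positivity)).1
  filter_upwards [h1, (pairCount_expectation hΛ0 hΛ (N := N + 2) (r := 4) (by linarith)
    (by norm_num)).1] with P h1 h2
  exact add_le_add (P.sum_inv_pow_level_le hK hN0.le h1) (P.volume_real_badRegion_le hK hN h2)

theorem integrable_geometricError {ℙ : Measure (PointSet d)} [IsProbabilityMeasure ℙ] {Λ : ℝ}
    (hΛ0 : 0 ≤ Λ) (hΛ : secondIntensity ℙ < ENNReal.ofReal Λ) (K : ℕ) {N : ℝ} (hN : 0 < N) :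
    Integrable (geometricError (d := d) K N) ℙ := by
  refine Integrable.add (Integrable.add (integrable_const _) (integrable_finsetSum _ fun k _ => ?_))
    (Integrable.add (integrable_const _) ?_)
  · exact ((pairCount_expectation hΛ0 hΛ hN (by positivity)).2.1).const_mul _
  · exact ((pairCount_expectation hΛ0 hΛ (by linarith) (by norm_num)).2.1).const_mul _

/-- The origin of the logarithm: the expected number of pairs at scale 2^k grows like 2^{kd} and is
weighted by 2^{-kd}, so each scale costs the same Λ 16^d per volume and the sum over scales gives
the factor K. -/
theorem integral_geometricError_le {ℙ : Measure (PointSet d)} [IsProbabilityMeasure ℙ] {Λ : ℝ}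
    (hΛ0 : 0 ≤ Λ) (hΛ : secondIntensity ℙ < ENNReal.ofReal Λ) (K : ℕ) {N : ℝ} (hN : 0 < N) :
    ∫ P, geometricError K N P ∂ℙ ≤
      ((ballVol d)⁻¹ * N ^ d * ((2 ^ K) ^ d)⁻¹ + K * (Λ * 16 ^ d * (N + 2 ^ (K + 1)) ^ d)) +
      ((N ^ d - (N - (2 ^ (K + 1) + 2)) ^ d) + ballVol d * (Λ * ((N + 6) ^ d * 16 ^ d))) := by
  have hp := fun k : ℕ => pairCount_expectation hΛ0 hΛ hN (r := 2 ^ (k + 2)) (by positivity)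
  have hq := pairCount_expectation hΛ0 hΛ (N := N + 2) (r := 4) (by linarith) (by norm_num)
  have hi1 : Integrable (fun P : PointSet d => ∑ k ∈ Finset.Ico 1 K, (((2 : ℝ) ^ k) ^ d)⁻¹ *
      (P.pairCount N (2 ^ (k + 2))).toReal) ℙ :=
    integrable_finsetSum _ fun k _ => (hp k).2.1.const_mul _
  have hi2 : Integrable (fun P : PointSet d => (ballVol d)⁻¹ * N ^ d * ((2 ^ K) ^ d)⁻¹ +
      ∑ k ∈ Finset.Ico 1 K, (((2 : ℝ) ^ k) ^ d)⁻¹ * (P.pairCount N (2 ^ (k + 2))).toReal) ℙ :=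
    (integrable_const _).add hi1
  have hi3 : Integrable (fun P : PointSet d => (N ^ d - (N - (2 ^ (K + 1) + 2)) ^ d) +
      ballVol d * (P.pairCount (N + 2) 4).toReal) ℙ :=
    (integrable_const _).add (hq.2.1.const_mul _)
  unfold geometricError
  rw [integral_add hi2 hi3, integral_add (integrable_const _) hi1,
    integral_add (integrable_const _) (hq.2.1.const_mul _),
    integral_finsetSum _ fun k _ => (hp k).2.1.const_mul _]
  simp only [integral_const_mul, integral_const, probReal_univ, one_smul]
  refine add_le_add (add_le_add le_rfl ?_) (add_le_add le_rfl ?_)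
  · have hterm : ∀ k ∈ Finset.Ico 1 K, (((2 : ℝ) ^ k) ^ d)⁻¹ *
        ∫ P, (P.pairCount N (2 ^ (k + 2))).toReal ∂ℙ ≤ Λ * 16 ^ d * (N + 2 ^ (K + 1)) ^ d := by
      intro k hk
      have hkK : (2 : ℝ) ^ (k + 2) ≤ 2 ^ (K + 1) :=
        pow_le_pow_right₀ (by norm_num) (by have := (Finset.mem_Ico.mp hk).2; omega)
      have h2 : (4 * (2 : ℝ) ^ (k + 2)) ^ d = 16 ^ d * (2 ^ k) ^ d := by
        rw [← mul_pow]
        congr 1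
        ring
      calc (((2 : ℝ) ^ k) ^ d)⁻¹ * ∫ P, (P.pairCount N (2 ^ (k + 2))).toReal ∂ℙ
          ≤ (((2 : ℝ) ^ k) ^ d)⁻¹ * (Λ * ((N + 2 ^ (k + 2)) ^ d * (4 * 2 ^ (k + 2)) ^ d)) := by
            gcongr
            exact (hp k).2.2
        _ = Λ * 16 ^ d * (N + 2 ^ (k + 2)) ^ d := by
            rw [h2]
            field_simp
        _ ≤ _ := by gcongr
    refine (Finset.sum_le_sum hterm).trans ?_
    rw [Finset.sum_const, nsmul_eq_mul, Nat.card_Ico]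
    gcongr
    omega
  · refine mul_le_mul_of_nonneg_left ?_ (ballVol_pos (d := d)).le
    have := hq.2.2
    norm_num [add_assoc] at this
    exact this

/-- The geometric error per unit volume in the limit of large cubes. -/
theorem tendsto_geometricError_bound (Λ : ℝ) (K : ℕ) :
    Tendsto (fun N : ℝ => (((ballVol d)⁻¹ * N ^ d * ((2 ^ K) ^ d)⁻¹ +
        K * (Λ * 16 ^ d * (N + 2 ^ (K + 1)) ^ d)) +
      ((N ^ d - (N - (2 ^ (K + 1) + 2)) ^ d) + ballVol d * (Λ * ((N + 6) ^ d * 16 ^ d)))) / N ^ d)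
      atTop (𝓝 ((ballVol d)⁻¹ * ((2 ^ K) ^ d)⁻¹ + Λ * 16 ^ d * (K + ballVol d))) := by
  have hr : ∀ a : ℝ, Tendsto (fun N : ℝ => ((N + a) / N) ^ d) atTop (𝓝 1) := by
    intro a
    have h1 : Tendsto (fun N : ℝ => 1 + a / N) atTop (𝓝 (1 + 0)) :=
      tendsto_const_nhds.add (tendsto_const_nhds.div_atTop tendsto_id)
    have h2 := h1.pow d
    simp only [add_zero, one_pow] at h2
    refine h2.congr' ?_
    filter_upwards [eventually_gt_atTop 0] with N hN
    congr 1
    field_simp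
  have hlim := ((tendsto_const_nhds (x := (ballVol d)⁻¹ * (((2 : ℝ) ^ K) ^ d)⁻¹)).add
    ((hr (2 ^ (K + 1))).const_mul (K * (Λ * 16 ^ d)))).add
    (((tendsto_const_nhds (x := (1 : ℝ))).sub (hr (-(2 ^ (K + 1) + 2)))).add
      ((hr 6).const_mul (ballVol d * (Λ * 16 ^ d))))
  have heq : (ballVol d)⁻¹ * (((2 : ℝ) ^ K) ^ d)⁻¹ + K * (Λ * 16 ^ d) * 1
      + (1 - 1 + ballVol d * (Λ * 16 ^ d) * 1)
      = (ballVol d)⁻¹ * ((2 ^ K) ^ d)⁻¹ + Λ * 16 ^ d * (K + ballVol d) := by ring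
  rw [heq] at hlim
  refine hlim.congr' ?_
  filter_upwards [eventually_gt_atTop 0] with N hN
  have hNd : N ^ d ≠ 0 := (pow_pos hN d).ne'
  simp only [div_pow, ← sub_eq_add_neg]
  field_simp

/-! ### Weak gradients and the single-inclusion problem -/

theorem IsL2loc.locallyIntegrable {F : Type*} [NormedAddCommGroup F] {u : Space d → F}
    (hu : IsL2loc u) : LocallyIntegrable u := by
  intro x
  refine ⟨Metric.ball 0 (‖x‖ + 1), Metric.isOpen_ball.mem_nhds (by simp), ?_⟩
  have : IsFiniteMeasure (volume.restrict (Metric.ball (0 : Space d) (‖x‖ + 1))) :=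
    ⟨by simpa using measure_ball_lt_top⟩
  exact (hu (‖x‖ + 1)).integrable (by norm_num)

theorem HasWeakGradient.isCurlFree {u : Space d → ℝ} {G : Space d → Space d}
    (h : HasWeakGradient u G) : IsCurlFree univ G := by
  intro η hη i j
  have key : ∀ i j, ∫ y, G y i * pd j η y = -∫ y, u y * pd i (pd j η) y := by
    intro i j
    have hj := hη.pd j
    have h1 := h.integral_eq (pd j η) hj.contDiff hj.compact
    have h2 : Integrable fun y => u y • gradient (pd j η) y :=
      h.l2loc.locallyIntegrable.integrable_smul_right_of_hasCompactSupport
        hj.gradient_continuous hj.gradient_hasCompactSupport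
    have h3 : Integrable fun y => pd j η y • G y :=
      h.l2loc_grad.locallyIntegrable.integrable_smul_left_of_hasCompactSupport
        hj.continuous hj.compact
    have h4 := congrArg (EuclideanSpace.proj i : Space d →L[ℝ] ℝ) h1
    rw [map_neg, ← ContinuousLinearMap.integral_comp_comm _ h2,
      ← ContinuousLinearMap.integral_comp_comm _ h3] at h4
    simp only [PiLp.proj_apply, PiLp.smul_apply, smul_eq_mul, gradient_apply] at h4
    rw [h4, neg_neg]
    simp_rw [mul_comm]
  rw [key, key]
  simp_rw [pd_comm hη.contDiff i j]

theorem IsTest.comp_add_right {η : Space d → ℝ} (h : IsTest univ η) (x : Space d) :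
    IsTest univ fun y => η (y + x) where
  contDiff := h.contDiff.comp (contDiff_id.add contDiff_const)
  compact := h.compact.comp_homeomorph (Homeomorph.addRight x)
  subset := subset_univ _

theorem gradient_comp_add_right (η : Space d → ℝ) (x y : Space d) :
    gradient (fun y => η (y + x)) y = gradient η (y + x) := by
  simp [gradient, fderiv_comp_add_right]

theorem pd_comp_add_right (η : Space d → ℝ) (i : Fin d) (x y : Space d) :
    pd i (fun y => η (y + x)) y = pd i η (y + x) := by
  simp [pd, fderiv_comp_add_right]

theorem IsCurlFree.comp_sub_right {k : Space d → Space d} (h : IsCurlFree univ k) (x : Space d) :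
    IsCurlFree univ fun y => k (y - x) := by
  intro η hη i j
  have key : ∀ i j, ∫ y, k (y - x) i * pd j η y
      = ∫ y, k y i * pd j (fun y => η (y + x)) y := by
    intro i j
    rw [← integral_add_right_eq_self _ x]
    simp only [add_sub_cancel_right, pd_comp_add_right]
  rw [key, key]
  exact h _ (hη.comp_add_right x) i j

theorem MemLp.comp_sub_right {G : Space d → Space d} (hG : MemLp G 2 volume) (x : Space d) :
    MemLp (fun y => G (y - x)) 2 volume :=
  hG.comp_measurePreserving (measurePreserving_sub_right volume x)

section

variable {α β : ℝ} {A₁ : Mat d} {b : Space d → Mat d} {x e : Space d}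

/-- The polarization of the inclusion at the origin. -/
def polarization (A₁ : Mat d) (b : Space d → Mat d) (e e' : Space d) (G : Space d → Space d) : ℝ :=
  ∫ y in Metric.ball (0 : Space d) 1, inner ℝ e' ((b y - A₁).op (G y + e))

theorem integrable_gradient_inner {η : Space d → ℝ} (h : IsTest univ η) (F : L2 d) :
    Integrable fun y => inner ℝ (gradient η y) (F y) := by
  have h1 := L2.integrable_inner (𝕜 := ℝ) (h.memLp_gradient 2).toLp F
  refine h1.congr ?_
  filter_upwards [(h.memLp_gradient 2).coeFn_toLp] with y hy
  rw [hy]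

/-- The flux of G + e differs from the residual by the constant A₁ e, which integrates to zero
against gradients. Membership in the gradient space is the Liouville argument of
`curlFree_mem_gradSpace`. -/
theorem isLocalSol_of_divFree (hd : 1 ≤ d) (hα : 0 < α) (hβ : 0 < β) (hA : IsElliptic α β A₁)
    (hm : IsPert α β A₁ (Metric.ball x 1) ((Metric.ball x 1).indicator fun y => b y - A₁))
    {u : Space d → ℝ} {G : Space d → Space d} (hu : HasWeakGradient u G) (hG : MemLp G 2 volume)
    (hdiv : IsDivFree (twoPhase A₁ (Metric.ball 0 1) fun y => b (y + x)) fun y => G y + e) :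
    IsLocalSol hA hm univ x e (MemLp.comp_sub_right hG x).toLp := by
  set Gx := (MemLp.comp_sub_right hG x).toLp
  have hGx : Gx =ᵐ[volume] fun y => G (y - x) := (MemLp.comp_sub_right hG x).coeFn_toLp
  refine ⟨curlFree_mem_gradSpace hd hα hβ hA
    ((hu.isCurlFree.comp_sub_right x).congr_on (hGx.mono fun y hy _ => hy)), fun v hv => ?_⟩
  refine inner_eq_zero_of_gradSpace (fun η hη => ?_) hv
  have hη' := hη.comp_add_right x
  have h1 := hdiv _ hη'.contDiff hη'.compact
  rw [← integral_sub_right_eq_self _ x] at h1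
  have h2 : ∀ᵐ y, inner ℝ (gradient η y) (residual hA hm x e Gx y)
      = inner ℝ (gradient (fun y => η (y + x)) (y - x))
        ((twoPhase A₁ (Metric.ball 0 1) (fun y => b (y + x)) (y - x)).op (G (y - x) + e))
        - inner ℝ (gradient η y) (A₁.op e) := by
    filter_upwards [hGx, Lp.coeFn_add (pertOp hA hm Gx) (mulOp hm.bdd (constBall x e)),
      Lp.coeFn_add (mulOp hA.isBddField Gx) (mulOp hm.bdd Gx), coeFn_mulOp hA.isBddField Gx,
      coeFn_mulOp hm.bdd Gx, coeFn_mulOp hm.bdd (constBall x e), coeFn_constBall x e]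
      with y h1 h2 h3 h4 h5 h6 h7
    rw [residual, h2, Pi.add_apply, pertOp, add_apply, h3, Pi.add_apply, h4, h5, h6, h7, h1,
      gradient_comp_add_right, sub_add_cancel, ← inner_sub_right, twoPhase, Mat.add_op]
    have hball : y - x ∈ Metric.ball (0 : Space d) 1 ↔ y ∈ Metric.ball x 1 := by
      rw [mem_ball_zero_iff, Metric.mem_ball, dist_eq_norm]
    by_cases hy : y ∈ Metric.ball x 1
    · rw [indicator_of_mem hy, indicator_of_mem hy, indicator_of_mem (hball.mpr hy),
        sub_add_cancel, map_add, map_add]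
      congr 1
      abel
    · rw [indicator_of_notMem hy, indicator_of_notMem hy, indicator_of_notMem (mt hball.mp hy),
        Mat.zero_op, Mat.zero_op, Mat.zero_op, map_add]
      congr 1
      abel
  have h3 : Integrable fun y => inner ℝ (gradient η y) (residual hA hm x e Gx y) :=
    integrable_gradient_inner hη _
  have h4 : Integrable fun y => inner ℝ (gradient η y) (A₁.op e) :=
    ((memLp_one_iff_integrable.mp (hη.memLp_gradient 1)).inner_const _)
  have h5 := h3.add h4
  have h6 : ∫ y, (inner ℝ (gradient η y) (residual hA hm x e Gx y)
      + inner ℝ (gradient η y) (A₁.op e)) = 0 := by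
    rw [← h1]
    refine integral_congr_ae ?_
    filter_upwards [h2] with y hy
    rw [hy]
    ring
  rw [integral_add h3 h4, integral_gradient_inner hη, add_zero] at h6
  exact h6

theorem inner_constBall_mulOp
    (hm : IsPert α β A₁ (Metric.ball x 1) ((Metric.ball x 1).indicator fun y => b y - A₁))
    {G : Space d → Space d} (hG : MemLp G 2 volume) (e' : Space d) :
    inner ℝ (constBall x e')
        (mulOp hm.bdd ((MemLp.comp_sub_right hG x).toLp + constBall x e))
      = polarization A₁ (fun y => b (y + x)) e e' G := by
  set Gx := (MemLp.comp_sub_right hG x).toLp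
  have hGx : Gx =ᵐ[volume] fun y => G (y - x) := (MemLp.comp_sub_right hG x).coeFn_toLp
  rw [L2.inner_def, polarization, ← integral_indicator measurableSet_ball,
    ← integral_sub_right_eq_self ((Metric.ball (0 : Space d) 1).indicator _) x]
  refine integral_congr_ae ?_
  filter_upwards [hGx, Lp.coeFn_add Gx (constBall x e), coeFn_mulOp hm.bdd (Gx + constBall x e),
    coeFn_constBall x e, coeFn_constBall x e'] with y h1 h2 h3 h4 h5
  rw [h3, h2, Pi.add_apply, h4, h5, h1]
  have hball : y - x ∈ Metric.ball (0 : Space d) 1 ↔ y ∈ Metric.ball x 1 := by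
    rw [mem_ball_zero_iff, Metric.mem_ball, dist_eq_norm]
  by_cases hy : y ∈ Metric.ball x 1
  · rw [indicator_of_mem hy, indicator_of_mem hy, indicator_of_mem hy,
      indicator_of_mem (hball.mpr hy), sub_add_cancel]
  · rw [indicator_of_notMem hy, indicator_of_notMem (mt hball.mp hy), inner_zero_left]

theorem abs_polarization_le (hα : 0 < α) (hβ : 0 < β) (hA : IsElliptic α β A₁)
    (hm : IsPert α β A₁ (Metric.ball x 1) ((Metric.ball x 1).indicator fun y => b y - A₁))
    {G : Space d → Space d} (hG : MemLp G 2 volume)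
    (hsol : IsLocalSol hA hm univ x e (MemLp.comp_sub_right hG x).toLp) (e' : Space d) :
    |polarization A₁ (fun y => b (y + x)) e e' G|
      ≤ ballVol d * (2 * β * (2 * β / α + 1)) * ‖e‖ * ‖e'‖ := by
  rw [← inner_constBall_mulOp hm hG]
  have hv : Real.sqrt (ballVol d) * Real.sqrt (ballVol d) = ballVol d :=
    Real.mul_self_sqrt ballVol_pos.le
  have h1 := hsol.norm_le hα hβ
  calc _ ≤ ‖constBall x e'‖ * ‖mulOp hm.bdd ((MemLp.comp_sub_right hG x).toLp + constBall x e)‖ :=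
        abs_real_inner_le_norm _ _
    _ ≤ (Real.sqrt (ballVol d) * ‖e'‖) * (2 * β * (2 * β / α * Real.sqrt (ballVol d) * ‖e‖
          + Real.sqrt (ballVol d) * ‖e‖)) := by
        rw [norm_constBall]
        refine mul_le_mul_of_nonneg_left ((norm_mulOp_le _ _).trans ?_) (by positivity)
        refine mul_le_mul_of_nonneg_left ((norm_add_le _ _).trans ?_) (by positivity)
        rw [norm_constBall]
        linarith
    _ = (Real.sqrt (ballVol d) * Real.sqrt (ballVol d)) * (2 * β * (2 * β / α + 1)) * ‖e‖ * ‖e'‖ := by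
        ring
    _ = _ := by rw [hv]

end

/-! ### The error bound for one realization -/

theorem volume_cube_ne_top (N : ℝ) (z : Space d) : volume (cube N z) ≠ ∞ :=
  (isBounded_cube N z).measure_lt_top.ne

/-- `exists_error_bound` for the good points of a point set, with the L² pairings written as
integrals over the cube so that stationarity can be applied to them. -/
theorem exists_pathwise_bound (d : ℕ) (hd : 1 ≤ d) {α β : ℝ} (hα : 0 < α) (hβ : 0 < β) :
    ∃ C C₂ : ℝ, 0 < C ∧ 0 < C₂ ∧ ∀ (A₁ : Mat d), IsElliptic α β A₁ → ∀ (P : PointSet d)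
      (b : Space d → Mat d), (∀ i j, Measurable fun y => b y i j) →
      (∀ᵐ y, IsElliptic α β (b y)) → ∀ (K : ℕ), 1 ≤ K → ∀ (N : ℝ) (e e' : Space d),
      ‖e‖ ≤ 1 → ‖e'‖ ≤ 1 → ∀ (ϕ : Space d → ℝ) (u : Space d → Space d), HasWeakGradient ϕ u →
      MemLp ((cube N 0).indicator u) 2 volume →
      IsDivFree (twoPhase A₁ P.inclusions b) (fun y => u y + e) →
      ∀ (ψ : Space d → Space d → ℝ) (G : Space d → Space d → Space d),
      (∀ x ∈ P.goodPoints K N, HasWeakGradient (ψ x) (G x) ∧ MemLp (G x) 2 volume ∧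
        IsDivFree (twoPhase A₁ (Metric.ball 0 1) fun y => b (y + x)) fun y => G x y + e) →
      |(∫ y in cube N 0, inner ℝ e' ((twoPhase A₁ P.inclusions b y - A₁).op (u y + e)))
        - ∑ x ∈ (P.goodPoints_finite K N).toFinset,
          polarization A₁ (fun y => b (y + x)) e e' (G x)| ≤
      C * (∑ x ∈ (P.goodPoints_finite K N).toFinset, (((2 : ℝ) ^ P.level K x) ^ d)⁻¹
          + volume.real (P.badRegion K N))
        + C₂ * ∫ y in cube N 0, (inner ℝ (u y) ((twoPhase A₁ P.inclusions b y).op (u y + e))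
          - inner ℝ (u y) (A₁.op e)) := by
  obtain ⟨C, C₂, hC, hC₂, hmain⟩ := exists_error_bound d hα hβ
  refine ⟨C, C₂, hC, hC₂, ?_⟩
  intro A₁ hA P b hb hbe K hK N e e' he he' ϕ u hϕ hu hdiv ψ G hG
  have hS : MeasurableSet P.inclusions := P.isOpen_inclusions.measurableSet
  have hm := isPert_indicator hA hS hb hbe
  have hmx := fun x : Space d => isPert_indicator hA (measurableSet_ball (x := x) (ε := 1)) hb hbe
  have hQ : MeasurableSet (cube N (0 : Space d)) := measurableSet_cube N 0
  have hQv : volume (cube N (0 : Space d)) ≠ ∞ := volume_cube_ne_top N 0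
  set Q := cube N (0 : Space d)
  set s := (P.goodPoints_finite K N).toFinset with hs
  have hG' : ∀ x ∈ s, HasWeakGradient (ψ x) (G x) ∧ MemLp (G x) 2 volume ∧
      IsDivFree (twoPhase A₁ (Metric.ball 0 1) fun y => b (y + x)) fun y => G x y + e :=
    fun x hx => hG x ((Set.Finite.mem_toFinset _).mp hx)
  -- The cut-off corrector gradient is curl-free only inside the cube, which is all the
  -- deterministic estimate asks for.
  set U : L2 d := hu.toLp with hU
  have hUae : U =ᵐ[volume] Q.indicator u := hu.coeFn_toLp
  have hsum : ∀ᵐ y, (U + constOn hQ hQv e : L2 d) y = Q.indicator (fun y => u y + e) y := by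
    filter_upwards [hUae, coeFn_constOn hQ hQv e, Lp.coeFn_add U (constOn hQ hQv e)]
      with y h1 h2 h3
    rw [h3, Pi.add_apply, h1, h2]
    by_cases hy : y ∈ Q <;> simp [hy]
  have hA₁W : ∀ᵐ y, mulOp hA.isBddField (U + constOn hQ hQv e) y
      = Q.indicator (fun y => A₁.op (u y + e)) y := by
    filter_upwards [hsum, coeFn_mulOp hA.isBddField (U + constOn hQ hQv e)] with y h1 h2
    rw [h2, h1]
    by_cases hy : y ∈ Q <;> simp [hy]
  have hW : ∀ᵐ y, pertOp hA hm (U + constOn hQ hQv e) y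
      = Q.indicator (fun y => (twoPhase A₁ P.inclusions b y).op (u y + e)) y := by
    filter_upwards [hsum, hA₁W, coeFn_mulOp hm.bdd (U + constOn hQ hQv e),
      Lp.coeFn_add (mulOp hA.isBddField (U + constOn hQ hQv e))
        (mulOp hm.bdd (U + constOn hQ hQv e))] with y h1 h2 h3 h4
    rw [pertOp, add_apply, h4, Pi.add_apply, h2, h3, h1]
    by_cases hy : y ∈ Q
    · rw [indicator_of_mem hy, indicator_of_mem hy, indicator_of_mem hy, twoPhase, Mat.add_op]
    · simp [hy]
  have hcurl : IsCurlFree Q U := (hϕ.isCurlFree.mono (subset_univ _)).congr_on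
    (hUae.mono fun y hy hyQ => by rw [hy, indicator_of_mem hyQ])
  have hdivQ : ∀ v ∈ gradSpace Q, inner ℝ v (pertOp hA hm (U + constOn hQ hQv e)) = 0 := by
    intro v hv
    refine inner_eq_zero_of_gradSpace (fun η hη => ?_) hv
    rw [← hdiv η hη.contDiff hη.compact]
    refine integral_congr_ae ?_
    filter_upwards [hW] with y hy
    rw [hy]
    by_cases hyQ : y ∈ Q
    · rw [indicator_of_mem hyQ]
    · rw [hη.gradient_eq_zero hyQ, inner_zero_left, inner_zero_left]
  classical
  -- The value zero off the good points is never used.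
  let Gx : Space d → L2 d := fun x =>
    if hx : x ∈ s then (MemLp.comp_sub_right (hG' x hx).2.1 x).toLp else 0
  have hGx : ∀ x (hx : x ∈ s), Gx x = (MemLp.comp_sub_right (hG' x hx).2.1 x).toLp :=
    fun x hx => dif_pos hx
  have hloc : ∀ x ∈ s, IsLocalSol hA (hmx x) univ x e (Gx x) := by
    intro x hx
    rw [hGx x hx]
    exact isLocalSol_of_divFree hd hα hβ hA (hmx x) (hG' x hx).1 (hG' x hx).2.1 (hG' x hx).2.2
  have hfam := P.isGoodFamily_goodPoints hK N
  have hmm : ∀ x ∈ s, ∀ y ∈ Metric.ball x 1,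
      (Metric.ball x 1).indicator (fun y => b y - A₁) y
        = P.inclusions.indicator (fun y => b y - A₁) y := by
    intro x hx y hy
    have : y ∈ P.inclusions := (hfam.inter x hx ▸ hy : y ∈ P.inclusions ∩ _).1
    rw [indicator_of_mem hy, indicator_of_mem this]
  have hfinal := hmain A₁ hA P.inclusions Q (P.badRegion K N) _ hm _ hmx hQ hQv
    (P.measurableSet_badRegion K N) s (fun x => 2 ^ P.level K x) hfam hmm e e' he he' U hcurl hdivQ
    Gx hloc
  have e1 : inner ℝ (constOn hQ hQv e') (pertOp hA hm (U + constOn hQ hQv e))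
      - inner ℝ (constOn hQ hQv e') (mulOp hA.isBddField (U + constOn hQ hQv e))
      = ∫ y in Q, inner ℝ e' ((twoPhase A₁ P.inclusions b y - A₁).op (u y + e)) := by
    rw [← inner_sub_right, L2.inner_def, ← integral_indicator hQ]
    refine integral_congr_ae ?_
    filter_upwards [hW, hA₁W, coeFn_constOn hQ hQv e',
      Lp.coeFn_sub (pertOp hA hm (U + constOn hQ hQv e))
        (mulOp hA.isBddField (U + constOn hQ hQv e))] with y h1 h2 h3 h4
    rw [h4, Pi.sub_apply, h1, h2, h3]
    by_cases hy : y ∈ Q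
    · simp only [indicator_of_mem hy, Mat.sub_op]
    · simp [hy]
  have e2 : inner ℝ U (pertOp hA hm (U + constOn hQ hQv e))
      - inner ℝ U (mulOp hA.isBddField (constOn hQ hQv e))
      = ∫ y in Q, (inner ℝ (u y) ((twoPhase A₁ P.inclusions b y).op (u y + e))
          - inner ℝ (u y) (A₁.op e)) := by
    rw [← inner_sub_right, L2.inner_def, ← integral_indicator hQ]
    refine integral_congr_ae ?_
    filter_upwards [hW, hUae, coeFn_constOn hQ hQv e,
      coeFn_mulOp hA.isBddField (constOn hQ hQv e),
      Lp.coeFn_sub (pertOp hA hm (U + constOn hQ hQv e))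
        (mulOp hA.isBddField (constOn hQ hQv e))] with y h1 h2 h3 h4 h5
    rw [h5, Pi.sub_apply, h1, h4, h3, h2]
    by_cases hy : y ∈ Q
    · simp only [indicator_of_mem hy, inner_sub_right]
    · simp [hy]
  have e3 : ∑ x ∈ s, inner ℝ (constBall x e') (mulOp (hmx x).bdd (Gx x + constBall x e))
      = ∑ x ∈ s, polarization A₁ (fun y => b (y + x)) e e' (G x) := by
    refine Finset.sum_congr rfl fun x hx => ?_
    rw [hGx x hx]
    exact inner_constBall_mulOp (hmx x) (hG' x hx).2.1 e'
  rw [e1, e2, e3] at hfinal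
  exact hfinal

/-! ### Expectations -/

section

variable {α β : ℝ} {A₁ : Mat d} {ℙ₁ : Measure (PointSet d)} [IsProbabilityMeasure ℙ₁]
  [VAddInvariantMeasure (Space d) (PointSet d) ℙ₁] {Ω : Type*} [MeasurableSpace Ω]
  [AddAction (Space d) Ω] [MeasurableVAdd₂ (Space d) Ω] {ℙ₂ : Measure Ω} [IsProbabilityMeasure ℙ₂]
  [VAddInvariantMeasure (Space d) Ω ℙ₂] {a₂ : Ω → Mat d} {e : Space d}

theorem integral_volume_inclusions {N : ℝ} (hN : 0 ≤ N) :
    Integrable (fun P : PointSet d => volume.real (P.inclusions ∩ cube N 0)) ℙ₁ ∧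
      ∫ P, volume.real (P.inclusions ∩ cube N 0) ∂ℙ₁ = N ^ d * volumeFraction ℙ₁ := by
  have hS := PointSet.measurableSet_zero_mem_inclusions (d := d)
  have hF : Integrable ({P : PointSet d | (0 : Space d) ∈ P.inclusions}.indicator
      (1 : PointSet d → ℝ)) ℙ₁ :=
    (integrable_indicator_iff hS).mpr (integrableOn_const (measure_ne_top _ _))
  have hQ := measurableSet_cube N (0 : Space d)
  have hQv := volume_cube_ne_top N (0 : Space d)
  have key : ∀ P : PointSet d, ∫ y in cube N (0 : Space d), field ({P : PointSet d | (0 : Space d) ∈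
      P.inclusions}.indicator (1 : PointSet d → ℝ)) P y = volume.real (P.inclusions ∩ cube N 0) := by
    intro P
    have hfield : ∀ y : Space d, field ({P : PointSet d | (0 : Space d) ∈ P.inclusions}.indicator
        (1 : PointSet d → ℝ)) P y = P.inclusions.indicator 1 y := by
      intro y
      have h1 : (-y) +ᵥ P ∈ {P : PointSet d | (0 : Space d) ∈ P.inclusions} ↔ y ∈ P.inclusions := by
        rw [mem_ofPred_eq, PointSet.mem_inclusions_vadd]
        simp
      by_cases hy : y ∈ P.inclusions
      · rw [field, indicator_of_mem (h1.mpr hy), indicator_of_mem hy]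
        rfl
      · rw [field, indicator_of_notMem (mt h1.mp hy), indicator_of_notMem hy]
    simp_rw [hfield]
    rw [integral_indicator_one P.isOpen_inclusions.measurableSet, measureReal_restrict_apply
      P.isOpen_inclusions.measurableSet]
  have h1 := integrable_setIntegral_field hF hQ hQv
  have h2 := integral_indicator_mul_field hF hQ hQv
  simp_rw [key] at h1 h2
  refine ⟨h1, ?_⟩
  rw [h2, integral_indicator_one hS, volume_real_cube hN]
  rfl

theorem coefficient_eq_field {Ω : Type*} [AddAction (Space d) Ω] {a₂ : Ω → Mat d}
    (ω : PointSet d × Ω) (y : Space d) :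
    coefficient A₁ a₂ ω y = field (fun ω => coefficient A₁ a₂ ω 0) ω y := by
  have h1 : (0 : Space d) ∈ ((-y) +ᵥ ω.1).inclusions ↔ y ∈ ω.1.inclusions := by
    rw [PointSet.mem_inclusions_vadd]
    simp
  simp only [coefficient, field, twoPhase]
  congr 1
  by_cases hy : y ∈ ω.1.inclusions
  · rw [indicator_of_mem hy, indicator_of_mem (show _ ∈ ((-y) +ᵥ ω).1.inclusions from h1.mpr hy)]
    simp
  · rw [indicator_of_notMem hy, indicator_of_notMem (show _ ∉ ((-y) +ᵥ ω).1.inclusions from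
      mt h1.mp hy)]

theorem measurable_coefficient_zero (ha : ∀ i j, Measurable fun ω => a₂ ω i j) (i j : Fin d) :
    Measurable fun ω : PointSet d × Ω => coefficient A₁ a₂ ω 0 i j := by
  have h1 : (fun ω : PointSet d × Ω => coefficient A₁ a₂ ω 0 i j)
      = fun ω => A₁ i j + (Prod.fst ⁻¹' {P : PointSet d | (0 : Space d) ∈ P.inclusions}).indicator
        (fun ω : PointSet d × Ω => a₂ ω.2 i j - A₁ i j) ω := by
    funext ω
    simp only [coefficient, twoPhase, Matrix.add_apply]
    congr 1
    by_cases h : (0 : Space d) ∈ ω.1.inclusions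
    · rw [indicator_of_mem h,
        indicator_of_mem (show ω ∈ Prod.fst ⁻¹' {P : PointSet d | (0 : Space d) ∈ P.inclusions} from h)]
      simp [field]
    · rw [indicator_of_notMem h,
        indicator_of_notMem (show ω ∉ Prod.fst ⁻¹' {P : PointSet d | (0 : Space d) ∈ P.inclusions} from h)]
      rfl
  rw [h1]
  exact measurable_const.add ((((ha i j).comp measurable_snd).sub measurable_const).indicator
    (measurable_fst PointSet.measurableSet_zero_mem_inclusions))

theorem ae_isElliptic_coefficient_zero (hA : IsElliptic α β A₁)
    (hae : ∀ᵐ ω ∂ℙ₂, IsElliptic α β (a₂ ω)) :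
    ∀ᵐ ω ∂(ℙ₁.prod ℙ₂), IsElliptic α β (coefficient A₁ a₂ ω 0) := by
  have h1 : ∀ᵐ ω ∂(ℙ₁.prod ℙ₂), IsElliptic α β (a₂ ω.2) :=
    Measure.quasiMeasurePreserving_snd.ae hae
  filter_upwards [h1] with ω hω
  simp only [coefficient, twoPhase]
  by_cases h : (0 : Space d) ∈ ω.1.inclusions
  · rw [indicator_of_mem h]
    simpa [field] using hω
  · rw [indicator_of_notMem h]
    simpa using hA

theorem memLp_flux (hA : IsElliptic α β A₁) (ha : ∀ i j, Measurable fun ω => a₂ ω i j)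
    (hae : ∀ᵐ ω ∂ℙ₂, IsElliptic α β (a₂ ω)) {g : PointSet d × Ω → Space d}
    (hg : MemLp g 2 (ℙ₁.prod ℙ₂)) :
    MemLp (fun ω => (coefficient A₁ a₂ ω 0).op (g ω + e)) 2 (ℙ₁.prod ℙ₂) := by
  have h1 : MemLp (fun ω => g ω + e) 2 (ℙ₁.prod ℙ₂) := hg.add (memLp_const e)
  refine h1.of_le_mul (c := β) (aestronglyMeasurable_op
    (fun i j => (measurable_coefficient_zero ha i j).aestronglyMeasurable)
    h1.aestronglyMeasurable) ?_
  filter_upwards [ae_isElliptic_coefficient_zero (ℙ₁ := ℙ₁) hA hae] with ω hω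
  exact (hω _).2

theorem MemLp.integrable_inner {X : Type*} [MeasurableSpace X] {μ : Measure X} {f g : X → Space d}
    (hf : MemLp f 2 μ) (hg : MemLp g 2 μ) : Integrable (fun ω => inner ℝ (f ω) (g ω)) μ := by
  refine (L2.integrable_inner (𝕜 := ℝ) hf.toLp hg.toLp).congr ?_
  filter_upwards [hf.coeFn_toLp, hg.coeFn_toLp] with ω h1 h2
  rw [h1, h2]

namespace IsCorrector

variable {ϕ : PointSet d × Ω → Space d → ℝ} {g : PointSet d × Ω → Space d}

/-- The mean of T. The gradient is orthogonal to the flux by `integral_inner_eq_zero`, and its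
pairing with the constant A₁ e vanishes because its mean does. -/
theorem integral_energy (h : IsCorrector ℙ₁ ℙ₂ A₁ a₂ e ϕ g) (hA : IsElliptic α β A₁)
    (ha : ∀ i j, Measurable fun ω => a₂ ω i j) (hae : ∀ᵐ ω ∂ℙ₂, IsElliptic α β (a₂ ω)) :
    Integrable (fun ω => inner ℝ (g ω) ((coefficient A₁ a₂ ω 0).op (g ω + e))
        - inner ℝ (g ω) (A₁.op e)) (ℙ₁.prod ℙ₂) ∧
      ∫ ω, (inner ℝ (g ω) ((coefficient A₁ a₂ ω 0).op (g ω + e))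
        - inner ℝ (g ω) (A₁.op e)) ∂(ℙ₁.prod ℙ₂) = 0 := by
  have hq := memLp_flux (ℙ₁ := ℙ₁) (e := e) hA ha hae h.memLp
  have h1 := MemLp.integrable_inner h.memLp hq
  have hgi : Integrable g (ℙ₁.prod ℙ₂) := h.memLp.integrable (by norm_num)
  have h2 : Integrable (fun ω => inner ℝ (g ω) (A₁.op e)) (ℙ₁.prod ℙ₂) := hgi.inner_const _
  refine ⟨h1.sub h2, ?_⟩
  rw [integral_sub h1 h2]
  have h3 : ∫ ω, g ω ∂(ℙ₁.prod ℙ₂) = 0 := by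
    have := h.mean_zero univ MeasurableSet.univ fun z => by simp
    simpa using this
  have h4 : ∫ ω, inner ℝ (g ω) (A₁.op e) ∂(ℙ₁.prod ℙ₂) = 0 := by
    have : ∀ ω, inner ℝ (g ω) (A₁.op e) = inner ℝ (A₁.op e) (g ω) := fun ω => real_inner_comm _ _
    simp_rw [this]
    rw [integral_inner hgi, h3, inner_zero_right]
  have h5 := integral_inner_eq_zero h.memLp hq h.mean_zero
    (h.gradient_eq.mono fun ω hω => hω.isCurlFree) (h.equation.mono fun ω hω η hη => by
      rw [← hω η hη.contDiff hη.compact]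
      refine integral_congr_ae (Eventually.of_forall fun y => ?_)
      simp only [coefficient_eq_field ω y]
      rfl)
  rw [h4, h5, sub_zero]

/-- The gradient has mean zero, so the A₁ part of the flux has mean A₁ e. The perturbation alone
thus carries the difference between the effective matrix and A₁. -/
theorem integral_excess_flux (h : IsCorrector ℙ₁ ℙ₂ A₁ a₂ e ϕ g) (hA : IsElliptic α β A₁)
    (ha : ∀ i j, Measurable fun ω => a₂ ω i j) (hae : ∀ᵐ ω ∂ℙ₂, IsElliptic α β (a₂ ω))
    (e' : Space d) :
    Integrable (fun ω => inner ℝ e' ((coefficient A₁ a₂ ω 0 - A₁).op (g ω + e))) (ℙ₁.prod ℙ₂) ∧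
      ∫ ω, inner ℝ e' ((coefficient A₁ a₂ ω 0 - A₁).op (g ω + e)) ∂(ℙ₁.prod ℙ₂)
        = inner ℝ e' ((∫ ω, (coefficient A₁ a₂ ω 0).op (g ω + e) ∂(ℙ₁.prod ℙ₂)) - A₁.op e) := by
  have hq : Integrable (fun ω => (coefficient A₁ a₂ ω 0).op (g ω + e)) (ℙ₁.prod ℙ₂) :=
    (memLp_flux hA ha hae h.memLp).integrable (by norm_num)
  have hgi : Integrable g (ℙ₁.prod ℙ₂) := h.memLp.integrable (by norm_num)
  have hge : Integrable (fun ω => g ω + e) (ℙ₁.prod ℙ₂) := hgi.add (integrable_const e)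
  have hAg : Integrable (fun ω => A₁.op (g ω + e)) (ℙ₁.prod ℙ₂) := A₁.op.integrable_comp hge
  have h3 : ∫ ω, g ω ∂(ℙ₁.prod ℙ₂) = 0 := by
    have := h.mean_zero univ MeasurableSet.univ fun z => by simp
    simpa using this
  have h4 : ∫ ω, A₁.op (g ω + e) ∂(ℙ₁.prod ℙ₂) = A₁.op e := by
    rw [A₁.op.integral_comp_comm hge, integral_add hgi (integrable_const e), h3]
    simp
  simp_rw [Mat.sub_op]
  refine ⟨(hq.sub hAg).const_inner e', ?_⟩
  have h5 := integral_inner (𝕜 := ℝ) (hq.sub hAg) e'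
  simp only [Pi.sub_apply] at h5
  rw [h5, integral_sub hq hAg, h4]

end IsCorrector

theorem measurable_field_entry (ha : ∀ i j, Measurable fun ω => a₂ ω i j) (ω : Ω) (i j : Fin d) :
    Measurable fun y : Space d => field a₂ ω y i j :=
  (ha i j).comp (measurable_neg.vadd_const ω)

theorem integral_polarization (hd : 1 ≤ d) (hα : 0 < α) (hβ : 0 < β) (hA : IsElliptic α β A₁)
    (ha : ∀ i j, Measurable fun ω => a₂ ω i j) (hae : ∀ᵐ ω ∂ℙ₂, IsElliptic α β (a₂ ω))
    {ψ : Ω → Space d → ℝ} {G : Ω → Space d → Space d} (h : IsSingleInclusion ℙ₂ A₁ a₂ e ψ G)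
    (e' : Space d) :
    Integrable (fun ω => polarization A₁ (field a₂ ω) e e' (G ω)) ℙ₂ ∧
      ∫ ω, polarization A₁ (field a₂ ω) e e' (G ω) ∂ℙ₂ = ballVol d * inner ℝ e'
        (∫ ω, (⨍ y in Metric.ball (0 : Space d) 1, (field a₂ ω y - A₁).op (G ω y + e)) ∂ℙ₂) ∧
      |inner ℝ e'
        (∫ ω, (⨍ y in Metric.ball (0 : Space d) 1, (field a₂ ω y - A₁).op (G ω y + e)) ∂ℙ₂)|
        ≤ 2 * β * (2 * β / α + 1) * ‖e‖ * ‖e'‖ := by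
  have hfin : IsFiniteMeasure (volume.restrict (Metric.ball (0 : Space d) 1)) :=
    ⟨by simpa using measure_ball_lt_top⟩
  set V : Ω → Space d := fun ω =>
    ⨍ y in Metric.ball (0 : Space d) 1, (field a₂ ω y - A₁).op (G ω y + e) with hV
  have hb := ballVol_pos (d := d)
  have hgood : ∀ᵐ ω ∂ℙ₂, ∀ e', inner ℝ e' (V ω)
      = (ballVol d)⁻¹ * polarization A₁ (field a₂ ω) e e' (G ω) ∧
      |polarization A₁ (field a₂ ω) e e' (G ω)|
        ≤ ballVol d * (2 * β * (2 * β / α + 1)) * ‖e‖ * ‖e'‖ := by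
    filter_upwards [h.gradient_eq, h.memLp, h.equation, ae_field (d := d) hae] with ω h1 h2 h3 h4 e'
    have hme := measurable_field_entry ha ω
    have hm := isPert_indicator hA (measurableSet_ball (x := (0 : Space d)) (ε := 1)) hme h4
    have hmu := isPert_indicator hA MeasurableSet.univ hme h4
    rw [indicator_univ] at hmu
    constructor
    · have hint : Integrable (fun y => (field a₂ ω y - A₁).op (G ω y + e))
          (volume.restrict (Metric.ball (0 : Space d) 1)) :=
        (hmu.bdd.memLp Measure.restrict_le_self.absolutelyContinuous
          ((h2.restrict _).add (memLp_const e))).integrable (by norm_num)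
      rw [hV, polarization]
      simp only
      rw [setAverage_eq, inner_smul_right, integral_inner hint, volume_real_ball]
    · have hsol := isLocalSol_of_divFree hd hα hβ hA hm h1 h2 (by simpa only [add_zero] using h3)
      have := abs_polarization_le hα hβ hA hm h2 hsol e'
      simpa only [add_zero] using this
  have hGm : AEStronglyMeasurable (Function.uncurry G)
      (ℙ₂.prod (volume.restrict (Metric.ball (0 : Space d) 1))) :=
    h.measurable.mono_ac (Measure.AbsolutelyContinuous.rfl.prod
      Measure.restrict_le_self.absolutelyContinuous)
  have hfm : AEStronglyMeasurable (fun p : Ω × Space d =>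
      (field a₂ p.1 p.2 - A₁).op (G p.1 p.2 + e))
      (ℙ₂.prod (volume.restrict (Metric.ball (0 : Space d) 1))) := by
    refine aestronglyMeasurable_op (fun i j => Measurable.aestronglyMeasurable ?_)
      (hGm.add aestronglyMeasurable_const)
    exact ((ha i j).comp (measurable_snd.neg.vadd measurable_fst)).sub measurable_const
  have hVm : AEStronglyMeasurable V ℙ₂ := by
    rw [hV]
    simp_rw [setAverage_eq]
    exact hfm.integral_prod_right'.const_smul (volume.real (Metric.ball (0 : Space d) 1))⁻¹
  have hVb : ∀ᵐ ω ∂ℙ₂, ‖V ω‖ ≤ 2 * β * (2 * β / α + 1) * ‖e‖ := by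
    filter_upwards [hgood] with ω hω
    -- The direction is chosen as V itself, which turns the bound for every e' into a norm bound and
    -- makes V integrable.
    obtain ⟨h1, h2⟩ := hω (V ω)
    rw [real_inner_self_eq_norm_sq] at h1
    have h3 : ‖V ω‖ ^ 2 ≤ (2 * β * (2 * β / α + 1) * ‖e‖) * ‖V ω‖ := by
      rw [h1]
      calc _ ≤ (ballVol d)⁻¹ * (ballVol d * (2 * β * (2 * β / α + 1)) * ‖e‖ * ‖V ω‖) := by
            gcongr
            exact (le_abs_self _).trans h2
        _ = _ := by field_simp
    rcases (norm_nonneg (V ω)).eq_or_lt with h0 | h0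
    · rw [← h0]
      positivity
    · rw [sq] at h3
      exact le_of_mul_le_mul_right h3 h0
  have hVi : Integrable V ℙ₂ := Integrable.of_bound hVm _ hVb
  have hpol : (fun ω => polarization A₁ (field a₂ ω) e e' (G ω))
      =ᵐ[ℙ₂] fun ω => ballVol d * inner ℝ e' (V ω) := by
    filter_upwards [hgood] with ω hω
    rw [(hω e').1]
    field_simp
  refine ⟨((hVi.const_inner e').const_mul _).congr hpol.symm, ?_, ?_⟩
  · rw [integral_congr_ae hpol, integral_const_mul, integral_inner hVi]
  · refine (abs_real_inner_le_norm _ _).trans ?_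
    rw [mul_comm]
    gcongr
    have := norm_integral_le_of_norm_le_const hVb
    simpa using this

end

/-! ### The expansion on large cubes -/

/-- Converts the number of good points into the volume of all inclusions, whose mean is the volume
fraction, at the price of the volume of Z. -/
theorem IsGoodFamily.volume_inter {S Q Z : Set (Space d)} {s : Finset (Space d)} {ρ : Space d → ℝ}
    (h : IsGoodFamily S Q Z s ρ) (hQv : volume Q ≠ ∞) :
    volume.real (S ∩ Q) = s.card * ballVol d + volume.real Z := by
  have h1 : (s : Set (Space d)).PairwiseDisjoint fun x => Metric.ball x 1 := fun x hx y hy hne =>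
    (h.disjoint hx hy hne).mono (h.ball_subset hx) (h.ball_subset hy)
  have h2 := measureReal_biUnion_finset (μ := (volume : Measure (Space d))) h1
    (fun _ _ => measurableSet_ball) (fun _ _ => measure_ball_lt_top.ne)
  simp only [volume_real_ball, Finset.sum_const, nsmul_eq_mul] at h2
  have hsub : ⋃ x ∈ s, Metric.ball x 1 ⊆ S ∩ Q := iUnion₂_subset fun x hx y hy =>
    ⟨(h.inter x hx ▸ hy : y ∈ S ∩ _).1, h.subset x hx (h.ball_subset hx hy)⟩
  have h3 : volume (S ∩ Q) ≠ ∞ := measure_ne_top_of_subset inter_subset_right hQv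
  rw [h.rest, measureReal_sdiff hsub (Finset.measurableSet_biUnion _ fun _ _ => measurableSet_ball) h3,
    h2]
  ring

/-- The pathwise bound is integrated first over A₂ with the points frozen: independence and
stationarity give every good point the same mean polarization. Integrating over the points then
yields the volume fraction, while T drops out. -/
theorem exists_cube_bound (d : ℕ) (hd : 1 ≤ d) {α β : ℝ} (hα : 0 < α) (hβ : 0 < β) :
    ∃ C : ℝ, 0 < C ∧ ∀ (A₁ : Mat d), IsElliptic α β A₁ → ∀ (ℙ₁ : Measure (PointSet d))
      [IsProbabilityMeasure ℙ₁] [VAddInvariantMeasure (Space d) (PointSet d) ℙ₁] (Ω : Type*)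
      [MeasurableSpace Ω] [AddAction (Space d) Ω] [MeasurableVAdd₂ (Space d) Ω] (ℙ₂ : Measure Ω)
      [IsProbabilityMeasure ℙ₂] [VAddInvariantMeasure (Space d) Ω ℙ₂] (a₂ : Ω → Mat d),
      (∀ i j, Measurable fun ω => a₂ ω i j) → (∀ᵐ ω ∂ℙ₂, IsElliptic α β (a₂ ω)) →
      ∀ (Λ : ℝ), 0 ≤ Λ → secondIntensity ℙ₁ < ENNReal.ofReal Λ → ∀ (K : ℕ), 1 ≤ K →
      ∀ (N : ℝ), 2 ^ (K + 1) + 2 ≤ N → ∀ (e e' : Space d), ‖e‖ ≤ 1 → ‖e'‖ ≤ 1 →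
      ∀ ϕ g, IsCorrector ℙ₁ ℙ₂ A₁ a₂ e ϕ g → ∀ ψ G, IsSingleInclusion ℙ₂ A₁ a₂ e ψ G →
      N ^ d * |inner ℝ e' ((∫ ω, (coefficient A₁ a₂ ω 0).op (g ω + e) ∂(ℙ₁.prod ℙ₂)) - A₁.op e)
        - volumeFraction ℙ₁ * inner ℝ e' (∫ ω, (⨍ y in Metric.ball (0 : Space d) 1,
            (field a₂ ω y - A₁).op (G ω y + e)) ∂ℙ₂)|
      ≤ C * ∫ P, geometricError K N P ∂ℙ₁ := by
  obtain ⟨C, C₂, hC, hC₂, hpath⟩ := exists_pathwise_bound d hd hα hβ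
  refine ⟨C + 2 * β * (2 * β / α + 1), by positivity, ?_⟩
  intro A₁ hA ℙ₁ _ _ Ω _ _ _ ℙ₂ _ _ a₂ ha hae Λ hΛ0 hΛ K hK N hN e e' he he' ϕ g hϕ ψ G hψ
  have hN0 : 0 < N := lt_of_lt_of_le (by positivity) hN
  have hQ : MeasurableSet (cube N (0 : Space d)) := measurableSet_cube N 0
  have hQv : volume (cube N (0 : Space d)) ≠ ∞ := volume_cube_ne_top N 0
  obtain ⟨hκi, hκ, habs⟩ := integral_polarization hd hα hβ hA ha hae hψ e'
  set a : ℝ := inner ℝ e' (∫ ω, (⨍ y in Metric.ball (0 : Space d) 1,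
            (field a₂ ω y - A₁).op (G ω y + e)) ∂ℙ₂)
  set κ : Ω → ℝ := fun ω => polarization A₁ (field a₂ ω) e e' (G ω) with hκdef
  have hale : |a| ≤ 2 * β * (2 * β / α + 1) := by
    refine habs.trans ?_
    calc 2 * β * (2 * β / α + 1) * ‖e‖ * ‖e'‖ ≤ 2 * β * (2 * β / α + 1) * 1 * 1 := by gcongr
      _ = _ := by ring
  obtain ⟨hFi, hF⟩ := hϕ.integral_excess_flux hA ha hae e'
  obtain ⟨hTi, hT⟩ := hϕ.integral_energy hA ha hae
  set F : PointSet d × Ω → ℝ := fun ω => inner ℝ e' ((coefficient A₁ a₂ ω 0 - A₁).op (g ω + e))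
  set T : PointSet d × Ω → ℝ := fun ω => inner ℝ (g ω) ((coefficient A₁ a₂ ω 0).op (g ω + e))
        - inner ℝ (g ω) (A₁.op e)
  have hXi := integrable_setIntegral_field hFi hQ hQv
  have hX := integral_indicator_mul_field hFi hQ hQv
  have hTTi := integrable_setIntegral_field hTi hQ hQv
  have hTT := integral_indicator_mul_field hTi hQ hQv
  rw [hT, mul_zero] at hTT
  rw [hF, volume_real_cube hN0.le] at hX
  set X : PointSet d × Ω → ℝ := fun ω => ∫ y in cube N (0 : Space d), field F ω y
  set TT : PointSet d × Ω → ℝ := fun ω => ∫ y in cube N (0 : Space d), field T ω y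
  obtain ⟨hvi, hv⟩ := integral_volume_inclusions (ℙ₁ := ℙ₁) hN0.le
  have hgood : ∀ᵐ ω ∂ℙ₂, HasWeakGradient (ψ ω) (G ω) ∧ MemLp (G ω) 2 volume ∧
      IsDivFree (twoPhase A₁ (Metric.ball 0 1) (field a₂ ω)) fun y => G ω y + e := by
    filter_upwards [hψ.gradient_eq, hψ.memLp, hψ.equation] with ω h1 h2 h3
    exact ⟨h1, h2, h3⟩
  -- The environment seen from x carries the coefficients recentred at x, so one random
  -- single-inclusion solution, evaluated at translated environments, serves all points.
  have hshift : ∀ (x : Space d) (ω : Ω), field a₂ ((-x) +ᵥ ω) = fun y => field a₂ ω (y + x) := by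
    intro x ω
    funext y
    simp only [field, vadd_vadd, neg_add]
  have hpw : ∀ᵐ P ∂ℙ₁, ∀ᵐ ω ∂ℙ₂,
      |X (P, ω) - ∑ x ∈ (P.goodPoints_finite K N).toFinset, κ ((-x) +ᵥ ω)| ≤
        C * (∑ x ∈ (P.goodPoints_finite K N).toFinset, (((2 : ℝ) ^ P.level K x) ^ d)⁻¹
          + volume.real (P.badRegion K N)) + C₂ * TT (P, ω) := by
    have hmem := memLp_indicator_field (d := d) hϕ.memLp hQ hQv
    have hall : ∀ᵐ ω ∂(ℙ₁.prod ℙ₂), HasWeakGradient (ϕ ω) (field g ω) ∧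
        MemLp ((cube N (0 : Space d)).indicator (field g ω)) 2 volume ∧
        IsDivFree (coefficient A₁ a₂ ω) (fun y => field g ω y + e) := by
      filter_upwards [hϕ.gradient_eq, hmem, hϕ.equation] with ω h1 h2 h3
      exact ⟨h1, h2, h3⟩
    filter_upwards [Measure.ae_ae_of_ae_prod hall] with P hP
    have hsx : ∀ᵐ ω ∂ℙ₂, ∀ x ∈ (P.goodPoints_finite K N).toFinset,
        HasWeakGradient (ψ ((-x) +ᵥ ω)) (G ((-x) +ᵥ ω)) ∧ MemLp (G ((-x) +ᵥ ω)) 2 volume ∧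
        IsDivFree (twoPhase A₁ (Metric.ball 0 1) (field a₂ ((-x) +ᵥ ω)))
          fun y => G ((-x) +ᵥ ω) y + e :=
      (Finset.eventually_all _).mpr fun x _ =>
        (measurePreserving_vadd (-x) ℙ₂).quasiMeasurePreserving.ae hgood
    filter_upwards [hP, hsx, ae_field (d := d) hae] with ω h1 h2 h3
    have h4 := hpath A₁ hA P (field a₂ ω) (measurable_field_entry ha ω) h3 K hK N e e' he he'
      (ϕ (P, ω)) (field g (P, ω)) h1.1 h1.2.1 h1.2.2 (fun x => ψ ((-x) +ᵥ ω))
      (fun x => G ((-x) +ᵥ ω)) (fun x hx => by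
        have := h2 x ((Set.Finite.mem_toFinset _).mpr hx)
        rwa [hshift] at this)
    simp_rw [← hshift] at h4
    have hcoef : ∀ y, twoPhase A₁ P.inclusions (field a₂ ω) y
        = coefficient A₁ a₂ ((-y) +ᵥ (P, ω)) 0 := fun y =>
      coefficient_eq_field (A₁ := A₁) (a₂ := a₂) (P, ω) y
    simp_rw [hcoef] at h4
    exact h4
  -- Replacing the number of good points by the inclusion volume costs the mean polarization times
  -- the volume of Z, again a geometric error.
  have hP : ∀ᵐ P ∂ℙ₁, |(∫ ω, X (P, ω) ∂ℙ₂) - a * volume.real (P.inclusions ∩ cube N 0)|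
      ≤ (C + 2 * β * (2 * β / α + 1)) * geometricError K N P + C₂ * ∫ ω, TT (P, ω) ∂ℙ₂ := by
    filter_upwards [hpw, hXi.prod_right_ae, hTTi.prod_right_ae,
      ae_le_geometricError hΛ0 hΛ hK hN] with P h1 h2 h3 h4
    set s := (P.goodPoints_finite K N).toFinset
    have hκx : ∀ x : Space d, Integrable (fun ω => κ ((-x) +ᵥ ω)) ℙ₂ := fun x =>
      (measurePreserving_vadd (-x) ℙ₂).integrable_comp_of_integrable hκi
    have hκx' : ∀ x : Space d, ∫ ω, κ ((-x) +ᵥ ω) ∂ℙ₂ = ballVol d * a := fun x => by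
      rw [← hκ]
      exact (measurePreserving_vadd (-x) ℙ₂).integral_comp
        (MeasurableEquiv.vadd (-x) : Ω ≃ᵐ Ω).measurableEmbedding κ
    have hsum : Integrable (fun ω => ∑ x ∈ s, κ ((-x) +ᵥ ω)) ℙ₂ :=
      integrable_finsetSum _ fun x _ => hκx x
    set E := ∑ x ∈ s, (((2 : ℝ) ^ P.level K x) ^ d)⁻¹ + volume.real (P.badRegion K N)
    have hbi : Integrable (fun ω => C * E + C₂ * TT (P, ω)) ℙ₂ :=
      (integrable_const _).add (h3.const_mul C₂)
    have h5 : |∫ ω, (X (P, ω) - ∑ x ∈ s, κ ((-x) +ᵥ ω)) ∂ℙ₂|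
        ≤ ∫ ω, (C * E + C₂ * TT (P, ω)) ∂ℙ₂ := by
      rw [← Real.norm_eq_abs]
      exact norm_integral_le_of_norm_le hbi h1
    rw [integral_sub h2 hsum, integral_finsetSum _ fun x _ => hκx x,
      integral_add (integrable_const _) (h3.const_mul C₂)] at h5
    simp only [integral_const_mul, hκx', Finset.sum_const, nsmul_eq_mul, integral_const, probReal_univ, one_smul] at h5
    have h6 := (P.isGoodFamily_goodPoints hK N).volume_inter hQv
    have h7 : volume.real (P.badRegion K N) ≤ geometricError K N P := by
      refine le_trans ?_ h4
      have : 0 ≤ ∑ x ∈ s, (((2 : ℝ) ^ P.level K x) ^ d)⁻¹ :=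
        Finset.sum_nonneg fun _ _ => by positivity
      linarith
    have h8 : (∫ ω, X (P, ω) ∂ℙ₂) - a * volume.real (P.inclusions ∩ cube N 0)
        = ((∫ ω, X (P, ω) ∂ℙ₂) - s.card * (ballVol d * a))
          - a * volume.real (P.badRegion K N) := by
      rw [h6]
      ring
    have h9 : |a * volume.real (P.badRegion K N)|
        ≤ 2 * β * (2 * β / α + 1) * geometricError K N P := by
      rw [abs_mul, abs_of_nonneg (measureReal_nonneg (s := P.badRegion K N))]
      exact mul_le_mul hale h7 measureReal_nonneg (by positivity)
    rw [h8]
    refine (abs_sub _ _).trans ?_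
    have h10 := mul_le_mul_of_nonneg_left h4 hC.le
    linarith
  have hXi' := hXi.integral_prod_left
  have hTTi' := hTTi.integral_prod_left
  have hgi := integrable_geometricError hΛ0 hΛ K hN0
  have hbi : Integrable (fun P => (C + 2 * β * (2 * β / α + 1)) * geometricError K N P
      + C₂ * ∫ ω, TT (P, ω) ∂ℙ₂) ℙ₁ := (hgi.const_mul _).add (hTTi'.const_mul C₂)
  have hfin : |∫ P, ((∫ ω, X (P, ω) ∂ℙ₂) - a * volume.real (P.inclusions ∩ cube N 0)) ∂ℙ₁|
      ≤ ∫ P, ((C + 2 * β * (2 * β / α + 1)) * geometricError K N P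
        + C₂ * ∫ ω, TT (P, ω) ∂ℙ₂) ∂ℙ₁ := by
    rw [← Real.norm_eq_abs]
    exact norm_integral_le_of_norm_le hbi hP
  rw [integral_sub hXi' (hvi.const_mul a), integral_const_mul, hv,
    integral_add (hgi.const_mul _) (hTTi'.const_mul C₂), integral_const_mul, integral_const_mul,
    ← integral_prod _ hXi, ← integral_prod _ hTTi, hX, hTT, mul_zero, add_zero] at hfin
  refine le_trans (le_of_eq ?_) hfin
  rw [← abs_of_pos (pow_pos hN0 d), ← abs_mul, abs_of_pos (pow_pos hN0 d)]
  congr 1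
  ring

/-! ### Optimization of the number of scales -/

/-- Divide by N^d and let N tend to infinity for fixed K, which removes the boundary layer of the
cube; then let Λ decrease to the second intensity. -/
theorem exists_scale_bound (d : ℕ) (hd : 1 ≤ d) {α β : ℝ} (hα : 0 < α) (hβ : 0 < β) :
    ∃ C : ℝ, 0 < C ∧ ∀ (A₁ : Mat d), IsElliptic α β A₁ → ∀ (ℙ₁ : Measure (PointSet d))
      [IsProbabilityMeasure ℙ₁] [VAddInvariantMeasure (Space d) (PointSet d) ℙ₁] (Ω : Type*)
      [MeasurableSpace Ω] [AddAction (Space d) Ω] [MeasurableVAdd₂ (Space d) Ω] (ℙ₂ : Measure Ω)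
      [IsProbabilityMeasure ℙ₂] [VAddInvariantMeasure (Space d) Ω ℙ₂] (a₂ : Ω → Mat d),
      (∀ i j, Measurable fun ω => a₂ ω i j) → (∀ᵐ ω ∂ℙ₂, IsElliptic α β (a₂ ω)) →
      secondIntensity ℙ₁ ≠ ∞ → ∀ Abar Ahat : Mat d, IsEffectiveMatrix ℙ₁ ℙ₂ A₁ a₂ Abar →
        IsFirstOrderCorrection ℙ₂ A₁ a₂ Ahat → ∀ K : ℕ, 1 ≤ K →
        ‖(Abar - (A₁ + volumeFraction ℙ₁ • Ahat)).op‖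
          ≤ C * ((2 ^ K)⁻¹ + (secondIntensity ℙ₁).toReal * K) := by
  obtain ⟨C, hC, hmain⟩ := exists_cube_bound d hd hα hβ
  have hv := ballVol_pos (d := d)
  refine ⟨C * ((ballVol d)⁻¹ + 16 ^ d * (1 + ballVol d)), by positivity, ?_⟩
  intro A₁ hA ℙ₁ _ _ Ω _ _ _ ℙ₂ _ _ a₂ ha hae hfin Abar Ahat hbar hhat K hK
  have hlam0 : 0 ≤ (secondIntensity ℙ₁).toReal := ENNReal.toReal_nonneg
  set lam := (secondIntensity ℙ₁).toReal with hlam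
  have hK1 : (1 : ℝ) ≤ K := by exact_mod_cast hK
  have hpow : (((2 : ℝ) ^ K) ^ d)⁻¹ ≤ (2 ^ K)⁻¹ := by
    have h1 : (1 : ℝ) ≤ 2 ^ K := one_le_pow₀ (by norm_num)
    gcongr
    exact le_self_pow₀ h1 (by omega)
  have hinner : ∀ e e' : Space d, ‖e‖ ≤ 1 → ‖e'‖ ≤ 1 →
      inner ℝ e' ((Abar - (A₁ + volumeFraction ℙ₁ • Ahat)).op e)
        ≤ C * ((ballVol d)⁻¹ + 16 ^ d * (1 + ballVol d)) * ((2 ^ K)⁻¹ + lam * K) := by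
    intro e e' he he'
    obtain ⟨ϕ, g, hϕ, hg⟩ := hbar e
    obtain ⟨ψ, G, hψ, hG⟩ := hhat e
    have hop : inner ℝ e' ((Abar - (A₁ + volumeFraction ℙ₁ • Ahat)).op e)
        = inner ℝ e' (Abar.op e - A₁.op e) - volumeFraction ℙ₁ * inner ℝ e' (Ahat.op e) := by
      rw [Mat.sub_op, Mat.add_op]
      have : (volumeFraction ℙ₁ • Ahat).op e = volumeFraction ℙ₁ • Ahat.op e := by simp [Mat.op]
      rw [this, ← sub_sub, inner_sub_right, inner_smul_right]
    have hstep : ∀ Λ : ℝ, lam < Λ →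
        inner ℝ e' ((Abar - (A₁ + volumeFraction ℙ₁ • Ahat)).op e)
          ≤ C * ((ballVol d)⁻¹ * ((2 ^ K) ^ d)⁻¹ + Λ * 16 ^ d * (K + ballVol d)) := by
      intro Λ hΛ
      have hΛ0 : 0 ≤ Λ := hlam0.trans hΛ.le
      have hΛ' : secondIntensity ℙ₁ < ENNReal.ofReal Λ :=
        (ENNReal.lt_ofReal_iff_toReal_lt hfin).mpr hΛ
      refine ge_of_tendsto ((tendsto_geometricError_bound Λ K).const_mul C) ?_
      filter_upwards [eventually_ge_atTop (2 ^ (K + 1) + 2 : ℝ)] with N hN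
      have hN0 : 0 < N := lt_of_lt_of_le (by positivity) hN
      have h1 := hmain A₁ hA ℙ₁ Ω ℙ₂ a₂ ha hae Λ hΛ0 hΛ' K hK N hN e e' he he' ϕ g hϕ ψ G hψ
      rw [← hg, ← hG, ← hop] at h1
      have h2 := h1.trans (mul_le_mul_of_nonneg_left
        (integral_geometricError_le hΛ0 hΛ' K hN0) hC.le)
      rw [mul_comm, ← le_div_iff₀ (pow_pos hN0 d), mul_div_assoc] at h2
      exact (le_abs_self _).trans h2
    have hlim : inner ℝ e' ((Abar - (A₁ + volumeFraction ℙ₁ • Ahat)).op e)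
        ≤ C * ((ballVol d)⁻¹ * ((2 ^ K) ^ d)⁻¹ + lam * 16 ^ d * (K + ballVol d)) := by
      have hcont : Continuous fun Λ : ℝ =>
          C * ((ballVol d)⁻¹ * ((2 ^ K) ^ d)⁻¹ + Λ * 16 ^ d * (K + ballVol d)) := by fun_prop
      refine ge_of_tendsto (hcont.continuousWithinAt (s := Ioi lam) (x := lam)) ?_
      filter_upwards [self_mem_nhdsWithin] with Λ hΛ
      exact hstep Λ hΛ
    refine hlim.trans ?_
    rw [mul_assoc C]
    refine mul_le_mul_of_nonneg_left ?_ hC.le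
    have h3 : (K : ℝ) + ballVol d ≤ (1 + ballVol d) * K := by nlinarith
    calc (ballVol d)⁻¹ * ((2 ^ K) ^ d)⁻¹ + lam * 16 ^ d * (K + ballVol d)
        ≤ (ballVol d)⁻¹ * (2 ^ K)⁻¹ + lam * 16 ^ d * ((1 + ballVol d) * K) := by gcongr
      _ = (ballVol d)⁻¹ * (2 ^ K)⁻¹ + (16 ^ d * (1 + ballVol d)) * (lam * K) := by ring
      _ ≤ ((ballVol d)⁻¹ + 16 ^ d * (1 + ballVol d)) * (2 ^ K)⁻¹
          + ((ballVol d)⁻¹ + 16 ^ d * (1 + ballVol d)) * (lam * K) := by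
        gcongr
        · exact le_add_of_nonneg_right (by positivity)
        · exact le_add_of_nonneg_left (by positivity)
      _ = _ := by ring
  refine ContinuousLinearMap.opNorm_le_of_unit_norm (by positivity) fun e he => ?_
  set w := (Abar - (A₁ + volumeFraction ℙ₁ • Ahat)).op e with hw
  rcases eq_or_ne w 0 with h0 | h0
  · rw [h0, norm_zero]
    positivity
  -- The direction e' = w/|w| realizes the norm of w.
  · have hpos : 0 < ‖w‖ := norm_pos_iff.mpr h0
    have h1 := hinner e (‖w‖⁻¹ • w) he.le (by rw [norm_smul, norm_inv, norm_norm,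
      inv_mul_cancel₀ hpos.ne'])
    rw [← hw, real_inner_smul_left, real_inner_self_eq_norm_sq] at h1
    have h2 : ‖w‖⁻¹ * ‖w‖ ^ 2 = ‖w‖ := by field_simp
    rwa [h2] at h1

/-- For lam = 0 let K tend to infinity. For lam ≥ 1 a single scale suffices. For 0 < lam ≤ 1 take
the least K with 2^{-K} ≤ lam. The gap keeps |log lam| away from zero, so a bare multiple of lam is
at most a multiple of lam |log lam|. -/
theorem le_mul_abs_log_of_forall_scale {x C lam δ : ℝ} (hC : 0 < C) (hδ : 0 < δ) (hlam : 0 ≤ lam)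
    (hgap : δ ≤ |lam - 1|) (h : ∀ K : ℕ, 1 ≤ K → x ≤ C * ((2 ^ K)⁻¹ + lam * K)) :
    x ≤ C * (2 / Real.log (1 + δ) + 2 / δ + 1 / Real.log 2) * (lam * |Real.log lam|) := by
  have hlog2 : 0 < Real.log 2 := Real.log_pos (by norm_num)
  have hlogδ : 0 < Real.log (1 + δ) := Real.log_pos (by linarith)
  rcases hlam.eq_or_lt with h0 | h0
  · subst h0
    have ht : Tendsto (fun K : ℕ => C * ((2 : ℝ) ^ K)⁻¹) atTop (𝓝 (C * 0)) := by
      refine Tendsto.const_mul C ?_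
      simp_rw [← inv_pow]
      exact tendsto_pow_atTop_nhds_zero_of_lt_one (by norm_num) (by norm_num)
    rw [mul_zero] at ht
    have : x ≤ 0 := by
      refine ge_of_tendsto ht ?_
      filter_upwards [eventually_ge_atTop 1] with K hK
      simpa using h K hK
    simpa using this
  rcases le_total 1 lam with h1 | h1
  · rw [abs_of_nonneg (by linarith)] at hgap
    have hl : Real.log (1 + δ) ≤ Real.log lam := Real.log_le_log (by linarith) (by linarith)
    rw [abs_of_pos (hlogδ.trans_le hl)]
    have h2 := h 1 le_rfl
    have h3 : 1 ≤ Real.log lam / Real.log (1 + δ) := (one_le_div hlogδ).mpr hl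
    calc x ≤ C * ((2 ^ 1)⁻¹ + lam * (1 : ℕ)) := h2
      _ ≤ C * (2 * lam * 1) := by
          refine mul_le_mul_of_nonneg_left ?_ hC.le
          norm_num
          linarith
      _ ≤ C * (2 * lam * (Real.log lam / Real.log (1 + δ))) := by gcongr
      _ = C * (2 / Real.log (1 + δ)) * (lam * Real.log lam) := by ring
      _ ≤ _ := by
          have : 0 < Real.log lam := hlogδ.trans_le hl
          gcongr
          have h4 : 0 ≤ 2 / δ := by positivity
          have h5 : 0 ≤ 1 / Real.log 2 := by positivity
          linarith
  · rw [abs_of_nonpos (by linarith)] at hgap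
    have hl : Real.log lam ≤ -δ := (Real.log_le_sub_one_of_pos h0).trans (by linarith)
    have hneg : Real.log lam < 0 := by linarith
    rw [abs_of_neg hneg]
    set L := -Real.log lam with hL
    have hLδ : δ ≤ L := by linarith
    have hL0 : 0 < L := hδ.trans_le hLδ
    -- K is log₂(1/lam) rounded up: rounding ensures 2^{-K} ≤ lam and adds at most one further lam,
    -- absorbed through L ≥ δ.
    have hK : 1 ≤ ⌈L / Real.log 2⌉₊ := Nat.one_le_ceil_iff.mpr (by positivity)
    have hle : L / Real.log 2 ≤ ⌈L / Real.log 2⌉₊ := Nat.le_ceil _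
    have hlt : (⌈L / Real.log 2⌉₊ : ℝ) < L / Real.log 2 + 1 := Nat.ceil_lt_add_one (by positivity)
    set K := ⌈L / Real.log 2⌉₊
    have hpow : ((2 : ℝ) ^ K)⁻¹ ≤ lam := by
      rw [inv_le_comm₀ (by positivity) h0, ← Real.log_le_log_iff (by positivity) (by positivity),
        Real.log_inv, Real.log_pow]
      rwa [div_le_iff₀ hlog2] at hle
    have hone : 1 ≤ L / δ := (one_le_div hδ).mpr hLδ
    calc x ≤ C * ((2 ^ K)⁻¹ + lam * K) := h K hK
      _ ≤ C * (lam + lam * (L / Real.log 2 + 1)) := by gcongr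
      _ = C * (lam * (2 * 1 + L / Real.log 2)) := by ring
      _ ≤ C * (lam * (2 * (L / δ) + L / Real.log 2)) := by gcongr
      _ = C * (2 / δ + 1 / Real.log 2) * (lam * L) := by ring
      _ ≤ _ := by
          gcongr
          have h4 : 0 ≤ 2 / Real.log (1 + δ) := by positivity
          linarith

end DiluteHomogenization

end

open DiluteHomogenization
theorem theorem2 (d : ℕ) (hd : 1 ≤ d) (α β δ : ℝ) (hα : 0 < α) (hβ : 0 < β) (hδ : 0 < δ) :
    ∃ C : ℝ, ∀ (A₁ : Mat d), IsElliptic α β A₁ →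
      ∀ (ℙ₁ : Measure (PointSet d)) [IsProbabilityMeasure ℙ₁] [ErgodicVAdd (Space d) (PointSet d) ℙ₁]
        (Ω : Type*) [MeasurableSpace Ω] [AddAction (Space d) Ω] [MeasurableVAdd₂ (Space d) Ω]
        (ℙ₂ : Measure Ω) [IsProbabilityMeasure ℙ₂] [ErgodicVAdd (Space d) Ω ℙ₂]
        (a₂ : Ω → Mat d), (∀ i j, Measurable fun ω => a₂ ω i j) →
        (∀ᵐ ω ∂ℙ₂, IsElliptic α β (a₂ ω)) →
      secondIntensity ℙ₁ ≠ ∞ → δ ≤ |(secondIntensity ℙ₁).toReal - 1| →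
      ∀ Abar Ahat : Mat d, IsEffectiveMatrix ℙ₁ ℙ₂ A₁ a₂ Abar →
        IsFirstOrderCorrection ℙ₂ A₁ a₂ Ahat →
        ‖(Abar - (A₁ + volumeFraction ℙ₁ • Ahat)).op‖ ≤
          C * ((secondIntensity ℙ₁).toReal * |Real.log (secondIntensity ℙ₁).toReal|) := by
  obtain ⟨C, hC, hmain⟩ := exists_scale_bound d hd hα hβ
  refine ⟨C * (2 / Real.log (1 + δ) + 2 / δ + 1 / Real.log 2), ?_⟩
  intro A₁ hA ℙ₁ _ _ Ω _ _ _ ℙ₂ _ _ a₂ ha hae hfin hgap Abar Ahat hbar hhat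
  exact le_mul_abs_log_of_forall_scale hC hδ ENNReal.toReal_nonneg hgap
    fun K hK => hmain A₁ hA ℙ₁ Ω ℙ₂ a₂ ha hae hfin Abar Ahat hbar hhat K hK
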